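/- Let $L$ be a field of characteristic $0$, and let $n,m,d$ be integers with $1\le m\le n-2$ and $d\ge 2n+2m+1$. Let $\Gamma=\{p_0,\dots,p_{d-1}\}\subset\mathbf P^n_L$ be a set of $d$ distinct points in symmetric position. This means that there are a subfield $K\subseteq L$ and an integral zero-dimensional closed subscheme $\Gamma_K\subset\mathbf P^n_K$ of degree $d$, not contained in a hyperplane, with function field $F$, such that the Galois closure of $F/K$ has Galois group $S_d$ and $\Gamma=\Gamma_K\times_K L$ splits as $d$ distinct $L$-points (up to a linear change of coordinates over $L$). Assume that the Hilbert function of $\Gamma$ satisfies $h_\Gamma(2)=2n+m$. Choose homogeneous coordinates $x_0,\dots,x_n$ over $L$ in which $p_0,\dots,p_n$ are the standard vertices. Let $I_\Gamma$ be the homogeneous ideal of $\Gamma$, and let $in(I_\Gamma)$ be its initial ideal for the graded lexicographic order with $x_0>x_1>\dots>x_n$. Let $Bs(|\mathcal I_\Gamma(2)|)$ be the scheme-theoretic intersection of all quadrics through $\Gamma$. The *Weak Conjecture for $\Gamma$* is the assertion that for every $p_i\in\Gamma$ the Zariski tangent space $T_{p_i}Bs(|\mathcal I_\Gamma(2)|)$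 is $1$-dimensional. **(1)** The following are equivalent: (a) the Weak Conjecture holds for $\Gamma$; (b) $x_0x_n\notin in(I_\Gamma)$; (c) $x_ix_n\notin in(I_\Gamma)$ for every $0\le i\le n$; (d) $\dim_L\bigl(in(I_\Gamma)_2\cap L[x_{n-m},\dots,x_n]\bigr)=\binom{m-1}{2}$; (e) $\dim_L\bigl(in(I_\Gamma)_2\cap L[x_{n-m-1},\dots,x_n]\bigr)=\binom m2+1$. **(2)** Let $\pi:\mathbf P^n\dashrightarrow\mathbf P^{m+1}$, $[x_0:\dots:x_n]\mapsto[x_{n-m-1}:\dots:x_n]$, be the projection from the span of $p_0,\dots,p_{n-m-2}$. Put $e=d-(n-m-1)$, $q_i=\pi(p_{i+n-m-1})$ for $0\le i<e$, and $\Gamma_{m+1}=\{q_0,\dots,q_{e-1}\}$. For a multi-index $\mathbf i=(i_0<\dots<i_{m-1})$ with entries in $\{0,\dots,e-1\}$, let $\Lambda_{\mathbf i}\cong\mathbf P^{m-1}$ be the span of $q_{i_0},\dots,q_{i_{m-1}}$. If for some $\mathbf i$ the restriction map $$\rho_{\mathbf i}:H^0(\mathbf P^{m+1},\mathcal I_{\Gamma_{m+1}}(2))\to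 H^0(\Lambda_{\mathbf i},\mathcal I_{\Lambda_{\mathbf i}\cap\Gamma_{m+1}}(2))$$ has maximal rank (that is, is injective or surjective), then $\rho_{\mathbf i}$ has maximal rank for every $\mathbf i$, and the Weak Conjecture holds for $\Gamma$. -/

import Mathlib

open MvPolynomial LinearAlgebra.Projectivization

noncomputable section

/-- Points of `ℙⁿ(L)` in symmetric position. There are a subfield `K ⊆ L`, a finite extension
`F / K` of degree `d` and an `F`-valued point `y` of `ℙⁿ` over `K` whose residue field is `F` (so
that its image is an integral zero-dimensional closed subscheme `Γ_K ⊆ ℙⁿ_K` of degree `d` with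
function field `F`), contained in no hyperplane of `ℙⁿ_K`, such that the Galois group of the Galois
closure of `F / K` is the full symmetric group on `d` letters, `Γ_K` splits over `L` as a set of
`d` distinct points (one for each `K`-embedding `F → L`), and `Γ` is an enumeration of this set. -/
def InSymmetricPosition {L : Type*} [Field L] {n d : ℕ}
    (Γ : Fin d → ℙ L (Fin (n + 1) → L)) : Prop :=
  Function.Injective Γ ∧
  ∃ (K : Subfield L) (F : IntermediateField K L) (y : Fin (n + 1) → F),
    FiniteDimensional K F ∧ Module.finrank K F = d ∧
    IntermediateField.adjoin K {a : F | ∃ i j, a = y i / y j} = ⊤ ∧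
    LinearIndependent K y ∧
    Nonempty ((IntermediateField.normalClosure K F L ≃ₐ[K]
      IntermediateField.normalClosure K F L) ≃* Equiv.Perm (Fin d)) ∧
    ∃ e : Fin d ≃ (F →ₐ[K] L), ∀ i, ∃ h : (fun k => e i (y k)) ≠ 0,
      Γ i = Projectivization.mk L (fun k => e i (y k)) h

/-- The action of a linear change of homogeneous coordinates on `ℙⁿ`. -/
def changeCoords {L : Type*} [Field L] {n : ℕ}
    (g : (Fin (n + 1) → L) ≃ₗ[L] (Fin (n + 1) → L)) :
    ℙ L (Fin (n + 1) → L) → ℙ L (Fin (n + 1) → L) :=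
  Projectivization.map g.toLinearMap g.injective

/-- The `i`-th standard vertex of `ℙⁿ`. -/
def vertex (L : Type*) [Field L] {n : ℕ} (i : Fin (n + 1)) : ℙ L (Fin (n + 1) → L) :=
  Projectivization.mk L (Pi.single i 1) (by simp)

/-- The Hilbert function `h_Γ(l)` of a finite set of distinct points: the rank of the restriction
map `H⁰(ℙⁿ, 𝒪(l)) → H⁰(Γ, 𝒪_Γ(l))`. The target is `L^d`, through the choice of a homogeneous
coordinate vector of each point. -/
def hilbertFunction {L : Type*} [Field L] {n d : ℕ}
    (Γ : Fin d → ℙ L (Fin (n + 1) → L)) (l : ℕ) : ℕ :=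
  Module.finrank L (LinearMap.range
    ((LinearMap.pi fun i : Fin d =>
      (aeval (Γ i).rep : MvPolynomial (Fin (n + 1)) L →ₐ[L] L).toLinearMap) ∘ₗ
        (homogeneousSubmodule (Fin (n + 1)) L l).subtype))

/-- The quadratic forms vanishing at the points with homogeneous coordinate vectors `v i`, that is
`H⁰(ℙ, 𝓘(2))` for the set of these points. -/
def quadricsThrough {L : Type*} [Field L] {N : ℕ} {ι : Type*} (v : ι → Fin N → L) :
    Submodule L (MvPolynomial (Fin N) L) :=
  homogeneousSubmodule (Fin N) L 2 ⊓
    ⨅ i, LinearMap.ker (aeval (v i) : MvPolynomial (Fin N) L →ₐ[L] L).toLinearMap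

/-- Homogeneous coordinate vectors of the points of `Γ`. -/
def coordVec {L : Type*} [Field L] {n d : ℕ} (Γ : Fin d → ℙ L (Fin (n + 1) → L)) :
    Fin d → Fin (n + 1) → L :=
  fun i => (Γ i).rep

/-- The homogeneous ideal `I_Γ`. -/
def homogeneousIdeal {L : Type*} [Field L] {n d : ℕ}
    (Γ : Fin d → ℙ L (Fin (n + 1) → L)) : Ideal (MvPolynomial (Fin (n + 1)) L) :=
  Ideal.span {f | (∃ l, f.IsHomogeneous l) ∧ ∀ i, eval (coordVec Γ i) f = 0}

/-- The initial ideal `in(I)` for the graded lexicographic order with `x₀ > x₁ > ⋯ > x_n`. -/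
def initialIdeal {L : Type*} [Field L] {n : ℕ} (I : Ideal (MvPolynomial (Fin (n + 1)) L)) :
    Ideal (MvPolynomial (Fin (n + 1)) L) :=
  Ideal.span {t | ∃ f ∈ I, f ≠ 0 ∧ t = monomial (MonomialOrder.degLex.degree f) 1}

/-- `in(I)₂ ∩ L[x_k, …, x_n]`. -/
def initialQuadricsFrom {L : Type*} [Field L] {n : ℕ}
    (I : Ideal (MvPolynomial (Fin (n + 1)) L)) (k : ℕ) :
    Submodule L (MvPolynomial (Fin (n + 1)) L) :=
  (initialIdeal I).restrictScalars L ⊓ homogeneousSubmodule (Fin (n + 1)) L 2 ⊓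
    Subalgebra.toSubmodule (supported L {i : Fin (n + 1) | k ≤ (i : ℕ)})

/-- For a set `V` of forms, the coordinate ring of the affine chart `x_j ≠ 0` of the closed
subscheme `{Q = 0, Q ∈ V}` of `ℙⁿ`, that is, of the scheme-theoretic base locus of `V`. -/
abbrev BaseLocusChart {L : Type*} [Field L] {n : ℕ} (V : Set (MvPolynomial (Fin (n + 1)) L))
    (j : Fin (n + 1)) : Type _ :=
  MvPolynomial (Fin (n + 1)) L ⧸ Ideal.span (V ∪ {X j - 1})

/-- The ideal of the point `p` (where `x_j(p) ≠ 0`) in the coordinate ring of the chart `x_j ≠ 0`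
of the base locus of `V`; a maximal ideal if `p` lies in the base locus. -/
def BaseLocusChart.pointIdeal {L : Type*} [Field L] {n : ℕ}
    (V : Set (MvPolynomial (Fin (n + 1)) L)) (j : Fin (n + 1)) (p : ℙ L (Fin (n + 1) → L)) :
    Ideal (BaseLocusChart V j) :=
  (RingHom.ker (eval fun k => p.rep k / p.rep j)).map
    (Ideal.Quotient.mk (Ideal.span (V ∪ {X j - 1})))

/-- The Zariski tangent space `(𝔪/𝔪²)^∨` of the base locus of `V` at its point `p`, computed in the
chart `x_j ≠ 0`. -/
abbrev BaseLocusTangentSpace {L : Type*} [Field L] {n : ℕ}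
    (V : Set (MvPolynomial (Fin (n + 1)) L)) (j : Fin (n + 1)) (p : ℙ L (Fin (n + 1) → L)) :
    Type _ :=
  Module.Dual L (BaseLocusChart.pointIdeal V j p).Cotangent

/-- The Weak Conjecture for `Γ`: at each point of `Γ`, the Zariski tangent space of the
scheme-theoretic base locus of `|𝓘_Γ(2)|` is 1-dimensional (in every chart that contains the
point). -/
def WeakConjecture {L : Type*} [Field L] {n d : ℕ}
    (Γ : Fin d → ℙ L (Fin (n + 1) → L)) : Prop :=
  ∀ (i : Fin d) (j : Fin (n + 1)), (Γ i).rep j ≠ 0 →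
    Module.finrank L
      (BaseLocusTangentSpace (quadricsThrough (coordVec Γ) : Set _) j (Γ i)) = 1

/-- Homogeneous coordinate vectors of the points `q_i = π_k(p_{i+n-k})` of
`Γ_k = π_k(Γ - {p₀, …, p_{n-k-1}}) ⊆ ℙᵏ`, where `π_k : ℙⁿ ⇢ ℙᵏ` keeps the last `k + 1`
coordinates. -/
def projectedPoints {L : Type*} [Field L] {n d : ℕ} (Γ : Fin d → ℙ L (Fin (n + 1) → L))
    (k : ℕ) (hk : k ≤ n) (i : Fin (d - (n - k))) : Fin (k + 1) → L :=
  fun s => coordVec Γ ⟨(i : ℕ) + (n - k), by omega⟩ ⟨(s : ℕ) + (n - k), by omega⟩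

section Restriction

variable {L : Type*} [Field L] {N e m : ℕ} (q : Fin e → Fin N → L) (a : Fin m → Fin e)

/-- The point of the linear span of the `q_{a_0}, …, q_{a_{m-1}}` with coordinate vector `t`
with respect to these vectors. -/
def spanPoint (t : Fin m → L) : Fin N → L := fun k => ∑ s, t s * q (a s) k

/-- `H⁰(Λ, 𝓘_{Λ ∩ {q_i}}(2))` for `Λ` the span of `q_{a_0}, …, q_{a_{m-1}}`: the quadratic forms in
the coordinates of `Λ` that vanish at each point of `Λ` which is one of the `q_i`. -/
def spanQuadrics : Submodule L (MvPolynomial (Fin m) L) :=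
  quadricsThrough
    (fun t : {t : Fin m → L // ∃ (i : Fin e) (c : L), c ≠ 0 ∧ spanPoint q a t = c • q i} => t.1)

/-- Restriction of polynomials to `Λ`. -/
def restrictToSpan : MvPolynomial (Fin N) L →ₐ[L] MvPolynomial (Fin m) L :=
  aeval fun k => ∑ s, C (q (a s) k) * X s

theorem eval_restrictToSpan (t : Fin m → L) (f : MvPolynomial (Fin N) L) :
    aeval t (restrictToSpan q a f) = aeval (spanPoint q a t) f := by
  have : (aeval t).comp (restrictToSpan q a) = (aeval (spanPoint q a t) :
      MvPolynomial (Fin N) L →ₐ[L] L) := by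
    apply MvPolynomial.algHom_ext
    intro k
    simp [restrictToSpan, spanPoint, mul_comm]
  exact DFunLike.congr_fun this f

theorem restrictToSpan_mem (f : MvPolynomial (Fin N) L) (hf : f ∈ quadricsThrough q) :
    (restrictToSpan q a).toLinearMap f ∈ spanQuadrics q a := by
  simp only [quadricsThrough, Submodule.mem_inf, mem_homogeneousSubmodule, Submodule.mem_iInf,
    LinearMap.mem_ker, AlgHom.toLinearMap_apply, spanQuadrics] at hf ⊢
  refine ⟨?_, ?_⟩
  · have := hf.1.aeval (S := L) (fun k => ∑ s, C (q (a s) k) * X s) (n := 1) (fun k => ?_)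
    · simpa [restrictToSpan] using this
    · refine IsHomogeneous.sum _ _ _ fun s _ => ?_
      simpa using (isHomogeneous_C (Fin m) (q (a s) k)).mul (isHomogeneous_X L s)
  · rintro ⟨t, i, c, hc, h⟩
    have h2 : aeval (c • q i) f = c ^ 2 * aeval (q i) f := by
      simp only [aeval_def, eval₂_eq, Finset.mul_sum]
      refine Finset.sum_congr rfl fun u hu => ?_
      have hdeg : ∑ k ∈ u.support, u k = 2 := by
        simpa [Finsupp.weight_apply, Finsupp.sum] using hf.1 (mem_support_iff.mp hu)
      simp only [Pi.smul_apply, smul_eq_mul, mul_pow, Finset.prod_mul_distrib,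
        Finset.prod_pow_eq_pow_sum, hdeg]
      ring
    rw [eval_restrictToSpan, h, h2, hf.2 i, mul_zero]

/-- The restriction map `ρ_a : H⁰(ℙ, 𝓘_{{q_i}}(2)) → H⁰(Λ, 𝓘_{Λ ∩ {q_i}}(2))`. -/
def rho : quadricsThrough q →ₗ[L] spanQuadrics q a :=
  (restrictToSpan q a).toLinearMap.restrict (restrictToSpan_mem q a)

/-- `ρ_a` has maximal rank. -/
def RhoHasMaximalRank : Prop :=
  Function.Injective (rho q a) ∨ Function.Surjective (rho q a)

end Restriction

end

/-! Everything reduces to dimensions of spaces of quadrics, encoded as Gram matrices `Sym2 _ → L`;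
`apolar` asks that chosen pairs of points be conjugate. Up to a linear map and scalars the points
are all the conjugates of one point, so permuting them conjugates the coefficients of the linear
system and preserves its rank (`exists_aut_realizing_perm`, `finrank_apolar_comp_perm`). Symmetry
and submodularity make dimension functions convex (`exists_convex_finrank`), and symmetric families
of functionals are uniform matroids (`finrank_of_symmetric_functionals`).

Write w_k for `coneRank v k` and r_k = w_k - w_{k+1}. By uniformity the leading monomials divisible
by x_k but by no earlier variable are x_k x_{k+1}, ..., x_k x_{k+r_k} (`finrank_rowQuadrics`), and
r_{k+1} ≤ r_k - 1 as long as r_k > 0 (`coneRank_convex`). The Hilbert function gives w_0 = C(n,2) +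
1 - m, which forces r_0 to be n - 1 or n. The tangent space of the base locus at each point has
dimension n - r_0, so the Weak Conjecture says r_0 = n - 1, that is, x_0 x_n is not a leading
monomial.

The geometric input is `exists_quadric_singular_along`: a nonzero quadric through Γ that is singular
at the first n - m - 1 points and contains the span of the first n - 1. Quadrics containing this
codimension-two space have the form x_p f + x_q g; for two of them the determinant f g' - f' g
vanishes at every point of Γ off the space, hence on all of Γ after few further conditions. This
supplies enough proportionality between such quadrics for a dimension count. The singular quadric
yields r_{n-m-1} ≥ m (`le_coneRank_sub`).

Strict decrease of the r_k then fixes the numbers. If r_0 = n - 1, the drops are exactly n - 1, n -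
2, ..., m up to index n - m - 1, so w_{n-m-1} = C(m,2) + 1 and w_{n-m} = C(m-1,2). If r_0 = n, both
numbers are strictly smaller. Since w_k is the dimension of the degree-two part of the initial ideal
in x_k, ..., x_n, this settles (1).

In (2) the source of ρ has dimension w_{n-m-1} and the target C(m,2). The kernel is, up to a
permutation, the space of the singular quadrics above: nonzero, and of a dimension independent of
the span. Maximal rank thus means surjectivity, which is one numerical condition for all spans and
gives w_{n-m-1} > C(m,2), hence r_0 = n - 1. -/

noncomputable section

/-! ### Solution spaces of linear systems -/

/-- The solutions of the homogeneous linear system with coefficient rows `c r`. -/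
def solutionSpace {L ρ κ : Type*} [Field L] [Fintype κ] (c : ρ → κ → L) : Submodule L (κ → L) :=
  ⨅ r, LinearMap.ker (dotProductBilin L L (c r))

theorem mem_solutionSpace {L ρ κ : Type*} [Field L] [Fintype κ] {c : ρ → κ → L}
    {x : κ → L} : x ∈ solutionSpace c ↔ ∀ r, ∑ t, c r t * x t = 0 := by
  simp [solutionSpace, dotProduct]

theorem finrank_solutionSpace {L ρ κ : Type*} [Field L] [Fintype κ] (c : ρ → κ → L) :
    Module.finrank L (Submodule.span L (Set.range c)) + Module.finrank L (solutionSpace c) =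
      Fintype.card κ := by
  classical
  have h := Subspace.finrank_add_finrank_dualCoannihilator_eq
    ((Submodule.span L (Set.range c)).map (dotProductEquiv L κ).toLinearMap)
  rw [LinearEquiv.finrank_map_eq, Module.finrank_fintype_fun_eq_card] at h
  rw [← h]
  have hc : solutionSpace c = Submodule.dualCoannihilator
      ((Submodule.span L (Set.range c)).map (dotProductEquiv L κ).toLinearMap) := by
    ext x
    rw [mem_solutionSpace, Submodule.mem_dualCoannihilator]
    constructor
    · rintro hx _ ⟨y, hy, rfl⟩
      induction hy using Submodule.span_induction with
      | mem y hy => obtain ⟨r, rfl⟩ := hy; exact hx r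
      | zero => simp
      | add y z _ _ h₁ h₂ => simp_all
      | smul a y _ h₁ => simp_all
    · intro hx r
      exact hx _ ⟨c r, Submodule.subset_span ⟨r, rfl⟩, rfl⟩
  rw [hc]

/-- A maximal independent set of rows stays independent and spanning after extension of scalars. Two
embeddings of E in L therefore give systems of equal rank. -/
theorem finrank_span_map {E L ρ κ : Type*} [Field E] [Field L] [Fintype κ] (f : E →+* L)
    (c : ρ → κ → E) :
    Module.finrank L (Submodule.span L (Set.range fun r t => f (c r t))) =
      Module.finrank E (Submodule.span E (Set.range c)) := by
  let := f.toAlgebra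
  obtain ⟨ι, a, -, hs, hli⟩ := exists_linearIndependent' E c
  have hli' : LinearIndependent L (fun i => algebraMap E L ∘ (c ∘ a) i) :=
    linearIndependent_algebraMap_comp_iff.mpr hli
  have : Finite ι := hli.finite
  have := Fintype.ofFinite ι
  have hs' : Submodule.span L (Set.range fun r t => f (c r t)) =
      Submodule.span L (Set.range (fun i => algebraMap E L ∘ (c ∘ a) i)) := by
    apply le_antisymm
    · rw [Submodule.span_le]
      rintro _ ⟨r, rfl⟩
      have hr : c r ∈ Submodule.span E (Set.range (c ∘ a)) := by
        rw [hs]; exact Submodule.subset_span ⟨r, rfl⟩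
      have key : ∀ y ∈ Submodule.span E (Set.range (c ∘ a)), (fun t => f (y t)) ∈
          Submodule.span L (Set.range (fun i => algebraMap E L ∘ (c ∘ a) i)) := by
        intro y hy
        induction hy using Submodule.span_induction with
        | mem y hy => obtain ⟨i, rfl⟩ := hy; exact Submodule.subset_span ⟨i, rfl⟩
        | zero => convert Submodule.zero_mem _ using 1; ext; simp
        | add y z _ _ h₁ h₂ => convert Submodule.add_mem _ h₁ h₂ using 1; ext; simp
        | smul b y _ h₁ => convert Submodule.smul_mem _ (f b) h₁ using 1; ext; simp
      exact key _ hr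
    · rw [Submodule.span_le]
      rintro _ ⟨i, rfl⟩
      exact Submodule.subset_span ⟨a i, rfl⟩
  rw [hs', ← hs, finrank_span_eq_card hli', finrank_span_eq_card hli]

theorem finrank_solutionSpace_map {E L ρ κ : Type*} [Field E] [Field L] [Fintype κ]
    (f g : E →+* L) (c : ρ → κ → E) :
    Module.finrank L (solutionSpace fun r t => f (c r t)) =
      Module.finrank L (solutionSpace fun r t => g (c r t)) := by
  have h₁ := finrank_solutionSpace (fun r t => f (c r t))
  have h₂ := finrank_solutionSpace (fun r t => g (c r t))
  rw [finrank_span_map] at h₁ h₂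
  omega

/-! ### Quadrics as functions on unordered pairs of indices -/

/-- The symmetric bilinear form with Gram matrix `S`. -/
def polar {L κ : Type*} [Field L] [Fintype κ] (S : Sym2 κ → L) (u w : κ → L) : L :=
  ∑ k, ∑ l, S s(k, l) * (u k * w l)

section polar

variable {L κ : Type*} [Field L] [Fintype κ] (S T : Sym2 κ → L) (u w z : κ → L) (a : L)

theorem polar_comm : polar S u w = polar S w u := by
  unfold polar
  rw [Finset.sum_comm]
  refine Finset.sum_congr rfl fun k _ => Finset.sum_congr rfl fun l _ => ?_
  rw [Sym2.eq_swap, mul_comm (u l)]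

theorem polar_add_right : polar S u (w + z) = polar S u w + polar S u z := by
  simp [polar, mul_add, Finset.sum_add_distrib]

theorem polar_smul_right : polar S u (a • w) = a * polar S u w := by
  simp only [polar, Finset.mul_sum, Pi.smul_apply, smul_eq_mul]
  refine Finset.sum_congr rfl fun k _ => Finset.sum_congr rfl fun l _ => ?_
  ring

theorem polar_smul_left : polar S (a • u) w = a * polar S u w := by
  simp [polar_comm _ _ w, polar_smul_right]

theorem add_polar : polar (S + T) u w = polar S u w + polar T u w := by
  simp [polar, add_mul, Finset.sum_add_distrib]

theorem smul_polar : polar (a • S) u w = a * polar S u w := by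
  simp only [polar, Finset.mul_sum, Pi.smul_apply, smul_eq_mul, mul_assoc]

@[simp] theorem zero_polar : polar (0 : Sym2 κ → L) u w = 0 := by simp [polar]

@[simp] theorem polar_zero_right : polar S u 0 = 0 := by simp [polar]

theorem polar_sum_right {ι : Type*} (s : Finset ι) (w : ι → κ → L) :
    polar S u (∑ i ∈ s, w i) = ∑ i ∈ s, polar S u (w i) := by
  classical
  induction s using Finset.induction_on with
  | empty => simp
  | insert i s hi ih => rw [Finset.sum_insert hi, Finset.sum_insert hi, polar_add_right, ih]

theorem polar_single_right [DecidableEq κ] (k : κ) :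
    polar S u (Pi.single k a) = (∑ l, S s(l, k) * u l) * a := by
  simp [polar, Pi.single_apply, Finset.sum_mul, mul_assoc]

theorem polar_single_single [DecidableEq κ] (k l : κ) (b : L) :
    polar S (Pi.single k a) (Pi.single l b) = S s(k, l) * (a * b) := by
  simp [polar, Pi.single_apply]

/-- The value of the bilinear form at a pair of vectors, as a functional of the form. -/
def polarAt : (Sym2 κ → L) →ₗ[L] L where
  toFun S := polar S u w
  map_add' S T := add_polar S T u w
  map_smul' a S := smul_polar S u w a

@[simp] theorem polarAt_apply : polarAt u w S = polar S u w := rfl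

end polar

/-- The quadrics whose symmetric bilinear form vanishes at the pairs `(v i, v j)`, `(i, j) ∈ A`. -/
def apolar {L κ ι : Type*} [Field L] [Fintype κ] (v : ι → κ → L) (A : Set (ι × ι)) :
    Submodule L (Sym2 κ → L) where
  carrier := {S | ∀ i j, (i, j) ∈ A → polar S (v i) (v j) = 0}
  add_mem' hS hT i j h := by rw [add_polar, hS i j h, hT i j h, add_zero]
  zero_mem' i j _ := by simp
  smul_mem' a S hS i j h := by rw [smul_polar, hS i j h, mul_zero]

section apolar

variable {L κ ι : Type*} [Field L] [Fintype κ] {v : ι → κ → L} {A B : Set (ι × ι)}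

theorem mem_apolar {S : Sym2 κ → L} :
    S ∈ apolar v A ↔ ∀ i j, (i, j) ∈ A → polar S (v i) (v j) = 0 := Iff.rfl

/-- Conjugacy depends only on the projective points, so representatives can be replaced by vectors
that are Galois conjugates of one another. -/
theorem apolar_smul (c : ι → L) (hc : ∀ i, c i ≠ 0) :
    apolar (fun i => c i • v i) A = apolar v A := by
  ext S
  simp [mem_apolar, polar_smul_left, polar_smul_right, hc]

theorem apolar_comp {ι' : Type*} (f : ι' → ι) (A : Set (ι' × ι')) :
    apolar (v ∘ f) A = apolar v (Prod.map f f '' A) := by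
  ext S
  simp only [mem_apolar, Function.comp, Set.mem_image, Prod.exists, Prod.map_apply,
    Prod.mk.injEq]
  constructor
  · rintro h _ _ ⟨i, j, hij, rfl, rfl⟩; exact h i j hij
  · exact fun h i j hij => h _ _ ⟨i, j, hij, rfl, rfl⟩

/-- Pull-back of quadrics under a linear map. -/
def pullQuadric {κ' : Type*} [Fintype κ'] [DecidableEq κ] (g : (κ → L) →ₗ[L] (κ' → L)) :
    (Sym2 κ' → L) →ₗ[L] (Sym2 κ → L) where
  toFun S := Sym2.lift ⟨fun k l => polar S (g (Pi.single k 1)) (g (Pi.single l 1)),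
    fun k l => polar_comm _ _ _⟩
  map_add' S T := by ext z; induction z; simp [add_polar]
  map_smul' a S := by ext z; induction z; simp [smul_polar]

theorem polar_pullQuadric {κ' : Type*} [Fintype κ'] [DecidableEq κ]
    (g : (κ → L) →ₗ[L] (κ' → L)) (S : Sym2 κ' → L) (u w : κ → L) :
    polar (pullQuadric g S) u w = polar S (g u) (g w) := by
  have h : ∀ u : κ → L, g u = ∑ k, u k • g (Pi.single k 1) := by
    intro u
    conv_lhs => rw [pi_eq_sum_univ' u, map_sum]
    refine Finset.sum_congr rfl fun k _ => ?_
    rw [← map_smul]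
  conv_rhs => rw [h u, h w, polar_sum_right]
  rw [polar, Finset.sum_comm]
  refine Finset.sum_congr rfl fun l _ => ?_
  rw [polar_smul_right, polar_comm, polar_sum_right, Finset.mul_sum]
  refine Finset.sum_congr rfl fun k _ => ?_
  rw [polar_smul_right, polar_comm S]
  simp only [pullQuadric, LinearMap.coe_mk, AddHom.coe_mk, Sym2.lift_mk]
  ring

theorem quadric_ext [DecidableEq κ] {S T : Sym2 κ → L} (h : ∀ u w, polar S u w = polar T u w) :
    S = T := by
  ext z
  induction z with
  | _ k l =>
    have := h (Pi.single k 1) (Pi.single l 1)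
    simpa [polar_single_single] using this

theorem finrank_apolar_linearEquiv [DecidableEq κ] (g : (κ → L) ≃ₗ[L] (κ → L)) :
    Module.finrank L (apolar (fun i => g (v i)) A) = Module.finrank L (apolar v A) := by
  let e : (Sym2 κ → L) ≃ₗ[L] (Sym2 κ → L) :=
    LinearEquiv.ofLinearMap (pullQuadric g.toLinearMap) (pullQuadric g.symm.toLinearMap)
      (LinearMap.ext fun S => quadric_ext fun u w => by simp [polar_pullQuadric])
      (LinearMap.ext fun S => quadric_ext fun u w => by simp [polar_pullQuadric])
  have : apolar (fun i => g (v i)) A = (apolar v A).map e.symm.toLinearMap := by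
    rw [← Submodule.comap_equiv_eq_map_symm]
    ext S
    simp [mem_apolar, e, polar_pullQuadric]
  rw [this, LinearEquiv.finrank_map_eq]

theorem finrank_apolar_map {E : Type*} [Field E] [DecidableEq κ] (f g : E →+* L)
    (u : ι → κ → E) (A : Set (ι × ι)) :
    Module.finrank L (apolar (fun i k => f (u i k)) A) =
      Module.finrank L (apolar (fun i k => g (u i k)) A) := by
  -- The conditions are linear in S, with coefficients that are sums of products of coordinates in
  -- E; hence `f` and `g` act on one common coefficient matrix over E.
  let c : A → Sym2 κ → E := fun p t =>
    ∑ k, ∑ l, if s(k, l) = t then u p.1.1 k * u p.1.2 l else 0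
  have h : ∀ f : E →+* L, apolar (fun i k => f (u i k)) A = solutionSpace fun p t => f (c p t) := by
    intro f
    ext S
    rw [mem_solutionSpace, mem_apolar]
    simp only [Subtype.forall, Prod.forall]
    refine forall_congr' fun i => forall_congr' fun j => forall_congr' fun hij => ?_
    have : ∑ t, f (c ⟨(i, j), hij⟩ t) * S t = polar S (fun k => f (u i k)) (fun k => f (u j k)) := by
      simp only [c, map_sum, Finset.sum_mul, polar]
      rw [Finset.sum_comm]
      refine Finset.sum_congr rfl fun k _ => ?_
      rw [Finset.sum_comm]
      refine Finset.sum_congr rfl fun l _ => ?_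
      rw [Finset.sum_eq_single s(k, l)]
      · simp [mul_comm]
      · intro t _ ht
        simp [ht.symm]
      · simp
    rw [this]
  rw [h f, h g]
  exact finrank_solutionSpace_map f g c

end apolar

/-! ### Galois symmetry of the points -/

/-- If the Galois group of the normal closure of `F / K` in `L` is the full symmetric group on the
`K`-embeddings `F → L`, then every permutation of these embeddings is realized by an
automorphism of the normal closure. -/
theorem exists_aut_realizing_perm {k F L : Type*} [Field k] [Field F] [Field L] [Algebra k F]
    [Algebra k L] {d : ℕ}
    (φ : (IntermediateField.normalClosure k F L ≃ₐ[k] IntermediateField.normalClosure k F L) ≃*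
      Equiv.Perm (Fin d)) (e : Fin d ≃ (F →ₐ[k] L)) (σ : Equiv.Perm (Fin d)) :
    ∃ τ : IntermediateField.normalClosure k F L ≃ₐ[k] IntermediateField.normalClosure k F L,
      ∀ (i : Fin d) (x : F),
        ((τ ((normalClosure.algHomEquiv k F L).symm (e i) x) :
          IntermediateField.normalClosure k F L) : L) = e (σ i) x := by
  let c := normalClosure.algHomEquiv k F L
  have hc : ∀ f x, ((c.symm f x : IntermediateField.normalClosure k F L) : L) = f x :=
    fun f x => rfl
  let ψ : (IntermediateField.normalClosure k F L ≃ₐ[k] IntermediateField.normalClosure k F L) →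
      Fin d → Fin d := fun τ i => e.symm (c (τ.toAlgHom.comp (c.symm (e i))))
  have hψ : ∀ τ i x, ((τ (c.symm (e i) x) : IntermediateField.normalClosure k F L) : L) =
      e (ψ τ i) x := by
    intro τ i x
    simp only [ψ, Equiv.apply_symm_apply]
    rfl
  have hψinj : ∀ τ, Function.Injective (ψ τ) := by
    intro τ i j hij
    have h1 := c.injective (e.symm.injective hij)
    apply e.injective
    apply c.symm.injective
    ext1 x
    exact τ.injective (DFunLike.congr_fun h1 x)
  let Ψ : (IntermediateField.normalClosure k F L ≃ₐ[k] IntermediateField.normalClosure k F L) →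
      Equiv.Perm (Fin d) := fun τ =>
    Equiv.ofBijective (ψ τ) (Finite.injective_iff_bijective.mp (hψinj τ))
  have hΨ : Function.Injective Ψ := by
    intro τ τ' h
    have h' : ∀ i, ψ τ i = ψ τ' i := fun i => DFunLike.congr_fun h i
    -- The normal closure is generated by the images of the embeddings, so an automorphism fixing
    -- all embeddings is trivial: the action is faithful.
    have hadj : IntermediateField.normalClosure k F L =
        IntermediateField.adjoin k (⋃ f : F →ₐ[k] L, (f.fieldRange : Set L)) := by
      rw [IntermediateField.adjoin_iUnion]
      exact iSup_congr fun f => (IntermediateField.adjoin_self k f.fieldRange).symm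
    have h2 : (τ : IntermediateField.normalClosure k F L →ₐ[k]
        IntermediateField.normalClosure k F L) = τ' := by
      refine IntermediateField.algHom_ext_of_eq_adjoin _ hadj fun x hx => ?_
      obtain ⟨f, y, rfl⟩ := Set.mem_iUnion.mp hx
      apply Subtype.ext
      have h3 := hψ τ (e.symm f) y
      have h4 := hψ τ' (e.symm f) y
      rw [← h', ← h3, e.apply_symm_apply] at h4
      exact h4.symm
    ext x
    exact congrArg Subtype.val (DFunLike.congr_fun h2 x)
  -- A faithful action on d letters of a group with d! elements realizes every permutation. The
  -- isomorphism `φ` serves only for this count; it need not be the action itself.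
  have : Finite (IntermediateField.normalClosure k F L ≃ₐ[k]
      IntermediateField.normalClosure k F L) := Finite.of_equiv _ φ.symm.toEquiv
  obtain ⟨τ, hτ⟩ := (hΨ.bijective_of_nat_card_le (Nat.card_congr φ.symm.toEquiv).le).2 σ
  refine ⟨τ, fun i x => ?_⟩
  rw [← hτ]
  exact hψ τ i x

/-- With τ realizing σ, the permuted points are the original ones viewed through the embedding `f ∘
τ` of the normal closure instead of `f`. The change of coordinates `g` and the choice of
representatives do not affect dimensions. -/
theorem finrank_apolar_comp_perm {L : Type*} [Field L] {n d : ℕ}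
    {Γ : Fin d → ℙ L (Fin (n + 1) → L)} {g : (Fin (n + 1) → L) ≃ₗ[L] (Fin (n + 1) → L)}
    (hsym : InSymmetricPosition fun i => changeCoords g (Γ i)) (σ : Equiv.Perm (Fin d))
    (A : Set (Fin d × Fin d)) :
    Module.finrank L (apolar (coordVec Γ ∘ σ) A) = Module.finrank L (apolar (coordVec Γ) A) := by
  obtain ⟨-, K, F, y, -, -, -, -, ⟨φ⟩, e, he⟩ := hsym
  obtain ⟨τ, hτ⟩ := exists_aut_realizing_perm φ e σ
  have hc : ∀ i, ∃ a : L, a ≠ 0 ∧ g (coordVec Γ i) = a • fun k => e i (y k) := by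
    intro i
    obtain ⟨h0, h⟩ := he i
    beta_reduce at h
    rw [← Projectivization.mk_rep (Γ i), changeCoords, Projectivization.map_mk,
      Projectivization.mk_eq_mk_iff] at h
    obtain ⟨a, ha⟩ := h
    exact ⟨a, a.ne_zero, ha.symm⟩
  choose a ha hga using hc
  let u : Fin d → Fin (n + 1) → IntermediateField.normalClosure K F L :=
    fun i k => (normalClosure.algHomEquiv K F L).symm (e i) (y k)
  let f : IntermediateField.normalClosure K F L →+* L := (IntermediateField.val _).toRingHom
  have h1 : ∀ σ : Equiv.Perm (Fin d), Module.finrank L (apolar (coordVec Γ ∘ σ) A) =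
      Module.finrank L (apolar (fun i k => e (σ i) (y k)) A) := by
    intro σ
    rw [← finrank_apolar_linearEquiv g,
      ← apolar_smul (v := fun i k => e (σ i) (y k)) (fun i => a (σ i)) fun i => ha (σ i)]
    have : coordVec Γ ∘ σ = fun i => coordVec Γ (σ i) := rfl
    rw [this]
    have h : (fun i => a (σ i) • fun k => e (σ i) (y k)) = fun i => g (coordVec Γ (σ i)) :=
      funext fun i => (hga (σ i)).symm
    rw [h]
  have h2 : Module.finrank L (apolar (coordVec Γ) A) =
      Module.finrank L (apolar (fun i k => e i (y k)) A) := h1 1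
  rw [h1 σ, h2]
  have h3 := finrank_apolar_map f (f.comp (τ : _ →+* _)) u A
  have h4 : (fun i k => (f.comp (τ : _ →+* _)) (u i k)) = fun i k => e (σ i) (y k) := by
    funext i k
    exact hτ i (y k)
  rw [h4] at h3
  exact h3.symm

/-! ### Symmetric families of subspaces -/

section SymmetricFamilies

variable {L V W : Type*} [Field L] [AddCommGroup V] [Module L V] [FiniteDimensional L V]
  [AddCommGroup W] [Module L W] [FiniteDimensional L W]

theorem finrank_le_finrank_inf_ker_add (K : Submodule L V) (f : V →ₗ[L] W) :
    Module.finrank L K ≤ Module.finrank L (K ⊓ LinearMap.ker f : Submodule L V) +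
      Module.finrank L W := by
  have h := (f.domRestrict K).finrank_range_add_finrank_ker
  have h2 : Module.finrank L (LinearMap.ker (f.domRestrict K)) =
      Module.finrank L (K ⊓ LinearMap.ker f : Submodule L V) := by
    rw [← Submodule.map_comap_subtype, Submodule.finrank_map_subtype_eq]
    rfl
  have h3 := Submodule.finrank_le (LinearMap.range (f.domRestrict K))
  omega

theorem finrank_le_finrank_inf_ker_functional (K : Submodule L V) (f : V →ₗ[L] L) :
    Module.finrank L K ≤ Module.finrank L (K ⊓ LinearMap.ker f : Submodule L V) + 1 := by
  simpa using finrank_le_finrank_inf_ker_add K f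

/-- A family of subspaces indexed by finite sets, turning unions into intersections, whose
dimensions depend on cardinalities only, has convex dimension function. -/
theorem exists_convex_finrank {α : Type*} [DecidableEq α] (K : Finset α → Submodule L V)
    (hinf : ∀ S T, K (S ∪ T) = K S ⊓ K T) (J : Finset α)
    (hsym : ∀ T ⊆ J, ∀ T' ⊆ J, T.card = T'.card →
      Module.finrank L (K T) = Module.finrank L (K T')) :
    ∃ δ : ℕ → ℕ, (∀ T ⊆ J, Module.finrank L (K T) = δ T.card) ∧
      (∀ a b, a ≤ b → b ≤ J.card → δ b ≤ δ a) ∧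
      ∀ a b, a ≤ b → b + 1 ≤ J.card → δ b + δ (a + 1) ≤ δ a + δ (b + 1) := by
  classical
  have hanti : ∀ S T, S ⊆ T → K T ≤ K S := by
    intro S T h
    have := hinf S T
    rw [Finset.union_eq_right.mpr h] at this
    rw [this]; exact inf_le_left
  choose! c hc using fun t (ht : t ≤ J.card) => Finset.exists_subset_card_eq ht
  have hδ : ∀ T ⊆ J, Module.finrank L (K T) = Module.finrank L (K (c T.card)) := fun T hT =>
    hsym T hT _ (hc _ (Finset.card_le_card hT)).1 (hc _ (Finset.card_le_card hT)).2.symm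
  refine ⟨fun t => Module.finrank L (K (c t)), hδ, ?_, ?_⟩
  · intro a b hab hb
    obtain ⟨T, hT, rfl⟩ := Finset.exists_subset_card_eq hb
    obtain ⟨S, hS, rfl⟩ := Finset.exists_subset_card_eq hab
    beta_reduce
    rw [← hδ T hT, ← hδ S (hS.trans hT)]
    exact Submodule.finrank_mono (hanti S T hS)
  · intro a b hab hb
    obtain ⟨T', hT', hT'c⟩ := Finset.exists_subset_card_eq hb
    obtain ⟨x, hx⟩ : T'.Nonempty := Finset.card_pos.mp (by omega)
    have hTc : (T'.erase x).card = b := by rw [Finset.card_erase_of_mem hx]; omega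
    obtain ⟨S, hS, hSc⟩ := Finset.exists_subset_card_eq (hab.trans hTc.ge)
    have hxS : x ∉ S := fun h => by simpa using hS h
    have hT : T'.erase x ⊆ J := (Finset.erase_subset _ _).trans hT'
    have hxSJ : insert x S ⊆ J := Finset.insert_subset (hT' hx) (hS.trans hT)
    have h1 := hδ _ hT
    have h2 := hδ _ hT'
    have h3 := hδ _ (hS.trans hT)
    have h4 := hδ _ hxSJ
    rw [hTc] at h1
    rw [hT'c] at h2
    rw [hSc] at h3
    rw [Finset.card_insert_of_notMem hxS, hSc] at h4
    beta_reduce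
    rw [← h1, ← h2, ← h3, ← h4]
    -- Submodularity: `K (T' \ x)` and `K (S ∪ x)` meet in `K T'` and both lie in `K S`.
    have hun : T'.erase x ∪ insert x S = T' := by
      rw [Finset.union_insert, Finset.union_eq_left.mpr hS, Finset.insert_erase hx]
    have h5 := Submodule.finrank_sup_add_finrank_inf_eq (K (T'.erase x)) (K (insert x S))
    rw [← hinf, hun] at h5
    have h6 : K (T'.erase x) ⊔ K (insert x S) ≤ K S :=
      sup_le (hanti _ _ hS) (hanti _ _ (Finset.subset_insert _ _))
    have := Submodule.finrank_mono h6
    omega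

/-- A symmetric family of functionals has uniform matroid. -/
theorem finrank_of_symmetric_functionals {α : Type*} [DecidableEq α] (K : Finset α → Submodule L V)
    (hinf : ∀ S T, K (S ∪ T) = K S ⊓ K T) (J : Finset α)
    (hsym : ∀ T ⊆ J, ∀ T' ⊆ J, T.card = T'.card →
      Module.finrank L (K T) = Module.finrank L (K T'))
    (hdrop : ∀ a, ∀ T, Module.finrank L (K T) ≤ Module.finrank L (K (insert a T)) + 1)
    {T : Finset α} (hT : T ⊆ J) :
    Module.finrank L (K T) = Module.finrank L (K ∅) -
      min T.card (Module.finrank L (K ∅) - Module.finrank L (K J)) := by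
  obtain ⟨δ, hδ, hanti, hconv⟩ := exists_convex_finrank K hinf J hsym
  have hd : ∀ s, s + 1 ≤ J.card → δ s ≤ δ (s + 1) + 1 := by
    intro s hs
    obtain ⟨T', hT', hT'c⟩ := Finset.exists_subset_card_eq hs
    obtain ⟨x, hx⟩ : T'.Nonempty := Finset.card_pos.mp (by omega)
    have hTc : (T'.erase x).card = s := by rw [Finset.card_erase_of_mem hx]; omega
    have h := hdrop x (T'.erase x)
    rwa [Finset.insert_erase hx, hδ _ hT', hδ _ ((Finset.erase_subset _ _).trans hT'), hTc,
      hT'c] at h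
  -- Each added index lowers δ by 0 or 1, and by convexity a step of 0 is followed only by steps of
  -- 0. So δ decreases by one per step until it reaches its final value.
  have key : ∀ s, s ≤ J.card → δ s + s = δ 0 ∨ (δ s = δ J.card ∧ δ 0 ≤ δ s + s) := by
    intro s
    induction s with
    | zero => simp
    | succ s ih =>
      intro hs
      have h1 := hd s hs
      have h2 := hanti s (s + 1) (by omega) hs
      have h3 := hanti (s + 1) J.card hs le_rfl
      rcases Nat.lt_or_ge (δ (s + 1)) (δ s) with h | h
      · rcases ih (by omega) with h4 | h4 <;> omega
      · right
        have h5 : ∀ t, s + 1 + t ≤ J.card → δ (s + 1) ≤ δ (s + 1 + t) := by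
          intro t
          induction t with
          | zero => simp
          | succ t iht =>
            intro ht
            have := iht (by omega)
            have := hconv s (s + 1 + t) (by omega) (by omega)
            rw [← add_assoc]
            omega
        have := h5 (J.card - (s + 1)) (by omega)
        rw [Nat.add_sub_cancel' hs] at this
        omega
  have hc := Finset.card_le_card hT
  rw [hδ T hT, hδ ∅ (Finset.empty_subset _), hδ J subset_rfl, Finset.card_empty]
  have := hanti _ _ hc le_rfl
  have := hanti 0 _ (Nat.zero_le _) hc
  rcases key _ hc with h | h <;> omega

end SymmetricFamilies

/-- Two finite sets of the same size are exchanged by a permutation that fixes the points outside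
of both. -/
theorem exists_perm_fixing {α : Type*} [DecidableEq α] {T T' : Finset α} (h : T.card = T'.card) :
    ∃ σ : Equiv.Perm α, (∀ x, x ∈ T ↔ σ x ∈ T') ∧ ∀ x, x ∉ T → x ∉ T' → σ x = x := by
  obtain ⟨σ, hσ⟩ := Equiv.Perm.exists_extending_pair (β := {x // x ∈ T ∪ T'})
    (fun x : T => ⟨x, Finset.mem_union_left _ x.2⟩)
    (fun x : T => ⟨T.equivOfCardEq h x, Finset.mem_union_right _ (T.equivOfCardEq h x).2⟩)
    (fun x y hxy => Subtype.ext (congrArg (fun z : {x // x ∈ T ∪ T'} => (z : α)) hxy))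
    (fun x y hxy => (T.equivOfCardEq h).injective
      (Subtype.ext (congrArg (fun z : {x // x ∈ T ∪ T'} => (z : α)) hxy)))
  have h1 : ∀ x ∈ T, Equiv.Perm.ofSubtype σ x ∈ T' := by
    intro x hx
    rw [Equiv.Perm.ofSubtype_apply_of_mem σ (Finset.mem_union_left _ hx), hσ ⟨x, hx⟩]
    exact (T.equivOfCardEq h ⟨x, hx⟩).2
  refine ⟨Equiv.Perm.ofSubtype σ, fun x => ⟨h1 x, fun hx => ?_⟩, fun x hx hx' => ?_⟩
  · have h2 : T.map (Equiv.Perm.ofSubtype σ).toEmbedding = T' := by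
      refine Finset.eq_of_subset_of_card_le (fun y hy => ?_) (by simp [h])
      obtain ⟨z, hz, rfl⟩ := Finset.mem_map.mp hy
      exact h1 z hz
    obtain ⟨z, hz, hzx⟩ := Finset.mem_map.mp (h2.ge hx)
    rwa [← (Equiv.Perm.ofSubtype σ).injective hzx]
  · exact Equiv.Perm.ofSubtype_apply_of_not_mem σ (by simp [hx, hx'])

/-! ### Symmetric configurations of vectors -/

/-- A family of vectors whose apolarity relations are invariant under all permutations and that
starts with multiples of the vectors of the standard basis. -/
structure SymmetricFrame {L : Type*} [Field L] {n d : ℕ} (v : Fin d → Fin (n + 1) → L) : Prop where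
  lt : n < d
  perm : ∀ (σ : Equiv.Perm (Fin d)) (A : Set (Fin d × Fin d)),
    Module.finrank L (apolar (v ∘ σ) A) = Module.finrank L (apolar v A)
  vert : ∀ i : Fin (n + 1), ∃ c : L, c ≠ 0 ∧ v (Fin.castLE lt i) = Pi.single i c

/-- The quadrics that contain all the points `v i`, are singular at the points of `Z`, and for
which the points of `B` are conjugate to those of `C`. -/
def quadrics {L : Type*} [Field L] {n d : ℕ} (v : Fin d → Fin (n + 1) → L)
    (Z B C : Finset (Fin d)) : Submodule L (Sym2 (Fin (n + 1)) → L) :=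
  apolar v {p | p.1 = p.2 ∨ p.1 ∈ Z ∨ (p.1 ∈ B ∧ p.2 ∈ C)}

/-- The first `k` indices. -/
def firstIndices (d k : ℕ) : Finset (Fin d) := Finset.univ.filter fun i => (i : ℕ) < k

@[simp] theorem mem_firstIndices {d k : ℕ} {i : Fin d} : i ∈ firstIndices d k ↔ (i : ℕ) < k := by
  simp [firstIndices]

theorem card_firstIndices {d k : ℕ} (h : k ≤ d) : (firstIndices d k).card = k := by
  have : firstIndices d k = (Finset.range k).attachFin fun m hm => by
      have := Finset.mem_range.mp hm; omega := by
    ext; simp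
  rw [this, Finset.card_attachFin, Finset.card_range]

/-- The dimension of the space of quadrics containing all the points and singular at the first
`k`. -/
def coneRank {L : Type*} [Field L] {n d : ℕ} (v : Fin d → Fin (n + 1) → L) (k : ℕ) : ℕ :=
  Module.finrank L (quadrics v (firstIndices d k) ∅ ∅)

section quadrics

variable {L : Type*} [Field L] {n d : ℕ} {v : Fin d → Fin (n + 1) → L} {Z B C : Finset (Fin d)}
  {S : Sym2 (Fin (n + 1)) → L}

theorem mem_quadrics : S ∈ quadrics v Z B C ↔ (∀ i, polar S (v i) (v i) = 0) ∧
    (∀ i ∈ Z, ∀ j, polar S (v i) (v j) = 0) ∧ ∀ i ∈ B, ∀ j ∈ C, polar S (v i) (v j) = 0 := by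
  simp only [quadrics, mem_apolar, Set.mem_ofPred_eq]
  constructor
  · exact fun h => ⟨fun i => h i i (Or.inl rfl), fun i hi j => h i j (Or.inr (Or.inl hi)),
      fun i hi j hj => h i j (Or.inr (Or.inr ⟨hi, hj⟩))⟩
  · rintro ⟨h1, h2, h3⟩ i j (rfl | h | h)
    exacts [h1 i, h2 i h j, h3 i h.1 j h.2]

theorem mem_quadrics_empty : S ∈ quadrics v Z ∅ ∅ ↔ (∀ i, polar S (v i) (v i) = 0) ∧
    ∀ i ∈ Z, ∀ j, polar S (v i) (v j) = 0 := by
  simp [mem_quadrics]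

end quadrics

namespace SymmetricFrame

variable {L : Type*} [Field L] {n d : ℕ} {v : Fin d → Fin (n + 1) → L}

theorem finrank_apolar_eq (hv : SymmetricFrame v) {A B : Set (Fin d × Fin d)}
    (σ : Equiv.Perm (Fin d)) (h : ∀ i j, (i, j) ∈ A ↔ (σ i, σ j) ∈ B) :
    Module.finrank L (apolar v A) = Module.finrank L (apolar v B) := by
  rw [← hv.perm σ A, apolar_comp]
  suffices Prod.map σ σ '' A = B by rw [this]
  ext ⟨i, j⟩
  simp only [Set.mem_image, Prod.exists, Prod.map_apply, Prod.mk.injEq]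
  constructor
  · rintro ⟨i', j', hA, rfl, rfl⟩
    exact (h _ _).mp hA
  · intro hB
    exact ⟨σ.symm i, σ.symm j, (h _ _).mpr (by simpa using hB), by simp, by simp⟩

theorem finrank_quadrics_eq (hv : SymmetricFrame v) {Z B C Z' B' C' : Finset (Fin d)}
    (σ : Equiv.Perm (Fin d)) (hZ : ∀ i, i ∈ Z ↔ σ i ∈ Z') (hB : ∀ i, i ∈ B ↔ σ i ∈ B')
    (hC : ∀ i, i ∈ C ↔ σ i ∈ C') :
    Module.finrank L (quadrics v Z B C) = Module.finrank L (quadrics v Z' B' C') :=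
  hv.finrank_apolar_eq σ fun i j => by simp [hZ, hB, hC]

theorem polar_vert (hv : SymmetricFrame v) (S : Sym2 (Fin (n + 1)) → L) (i j : Fin (n + 1)) :
    polar S (v (Fin.castLE hv.lt i)) (v (Fin.castLE hv.lt j)) = 0 ↔ S s(i, j) = 0 := by
  obtain ⟨a, ha, hi⟩ := hv.vert i
  obtain ⟨b, hb, hj⟩ := hv.vert j
  rw [hi, hj, polar_single_single]
  simp [ha, hb]

theorem polar_vert_left (hv : SymmetricFrame v) (S : Sym2 (Fin (n + 1)) → L) (i : Fin (n + 1)) :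
    (∀ j, polar S (v (Fin.castLE hv.lt i)) (v j) = 0) ↔ ∀ k, S s(i, k) = 0 := by
  refine ⟨fun h k => (hv.polar_vert S i k).mp (h _), fun h j => ?_⟩
  obtain ⟨a, ha, hi⟩ := hv.vert i
  rw [hi, polar_comm, polar_single_right]
  simp [Sym2.eq_swap, h]

theorem finrank_quadrics (hv : SymmetricFrame v) (Z : Finset (Fin d)) :
    Module.finrank L (quadrics v Z ∅ ∅) = coneRank v Z.card := by
  obtain ⟨σ, hσ, -⟩ := exists_perm_fixing (T := Z) (T' := firstIndices d Z.card)
    (by rw [card_firstIndices]; simpa using Finset.card_le_univ Z)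
  exact hv.finrank_quadrics_eq σ hσ (by simp) (by simp)

/-- Linear general position. -/
theorem linearIndependent_of_card (hv : SymmetricFrame v) {A : Finset (Fin d)}
    (hA : A.card = n + 1) {f : Fin (n + 1) → L} (hf : ∀ i ∈ A, ∑ k, f k * v i k = 0) : f = 0 := by
  obtain ⟨σ, hσ, -⟩ := exists_perm_fixing (T := firstIndices d (n + 1)) (T' := A)
    (by rw [card_firstIndices hv.lt, hA])
  have h1 := hv.finrank_apolar_eq (A := {p | p.1 ∈ firstIndices d (n + 1) ∧
    p.2 ∈ firstIndices d (n + 1)}) (B := {p | p.1 ∈ A ∧ p.2 ∈ A}) σ (by simp [hσ])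
  have h2 : apolar v {p | p.1 ∈ firstIndices d (n + 1) ∧ p.2 ∈ firstIndices d (n + 1)} = ⊥ := by
    rw [eq_bot_iff]
    intro S hS
    rw [Submodule.mem_bot]
    ext z
    induction z with
    | _ k l => exact (hv.polar_vert S k l).mp (hS _ _
      (by simp [Nat.lt_succ_iff.mp k.2, Nat.lt_succ_iff.mp l.2]))
  rw [h2, finrank_bot] at h1
  have h3 := Submodule.finrank_eq_zero.mp h1.symm
  -- If `f` vanishes on A, its square is a quadric for which all pairs in A are conjugate. For n + 1
  -- vertices only the zero quadric has this property, and symmetry transfers this to A.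
  let S : Sym2 (Fin (n + 1)) → L := Sym2.lift ⟨fun k l => f k * f l, fun k l => mul_comm _ _⟩
  have hS : ∀ u w, polar S u w = (∑ k, f k * u k) * ∑ k, f k * w k := by
    intro u w
    rw [Finset.sum_mul_sum, polar]
    refine Finset.sum_congr rfl fun k _ => Finset.sum_congr rfl fun l _ => ?_
    simp only [S, Sym2.lift_mk]
    ring
  have h4 : S ∈ apolar v {p | p.1 ∈ A ∧ p.2 ∈ A} := by
    intro i j hij
    rw [hS, hf i hij.1, zero_mul]
  rw [h3, Submodule.mem_bot] at h4
  ext k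
  have := congrFun h4 s(k, k)
  simpa [S] using this

/-- On the quadrics singular at the first i points, the coefficients of x_i x_j for j > i are
functionals permuted by the symmetries fixing the indices up to i. They form a uniform matroid whose
rank is the drop of `coneRank` at i, since their joint vanishing means singularity at p_i too. -/
theorem finrank_rowQuadrics (hv : SymmetricFrame v) (i : Fin (n + 1)) {T : Finset (Fin (n + 1))}
    (hT : ∀ j ∈ T, i < j) :
    Module.finrank L (quadrics v (firstIndices d i) {Fin.castLE hv.lt i}
        (T.map (Fin.castLEEmb hv.lt))) =
      coneRank v i - min T.card (coneRank v i - coneRank v (i + 1)) := by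
  classical
  let K : Finset (Fin d) → Submodule L (Sym2 (Fin (n + 1)) → L) := fun T =>
    quadrics v (firstIndices d i) {Fin.castLE hv.lt i} T
  let J := (Finset.Ioi i).map (Fin.castLEEmb hv.lt)
  have hJ : ∀ j ∈ J, (i : ℕ) < j := by
    intro j hj
    obtain ⟨k, hk, rfl⟩ := Finset.mem_map.mp hj
    simpa using hk
  have hK0 : K ∅ = quadrics v (firstIndices d i) ∅ ∅ := by
    ext S; simp [K, mem_quadrics]
  have hKJ : K J = quadrics v (firstIndices d (i + 1)) ∅ ∅ := by
    ext S
    simp only [K, mem_quadrics, mem_firstIndices, Finset.mem_singleton, forall_eq]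
    constructor
    · rintro ⟨h1, h2, h3⟩
      refine ⟨h1, fun l hl => ?_, by simp⟩
      rcases Nat.lt_succ_iff_lt_or_eq.mp hl with h | h
      · exact h2 l h
      · obtain rfl : l = Fin.castLE hv.lt i := Fin.ext h
        rw [hv.polar_vert_left]
        intro k
        rcases lt_trichotomy i k with hk | rfl | hk
        · exact (hv.polar_vert S i k).mp (h3 _ (Finset.mem_map.mpr ⟨k, by simpa using hk, rfl⟩))
        · exact (hv.polar_vert S _ _).mp (h1 _)
        · rw [Sym2.eq_swap]
          exact (hv.polar_vert S k i).mp (h2 _ (by simpa using hk) _)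
    · rintro ⟨h1, h2, -⟩
      exact ⟨h1, fun l hl => h2 l (by omega), fun j _ => h2 _ (by simp) j⟩
  have h := finrank_of_symmetric_functionals K (fun S T => ?_) J (fun T hT T' hT' hc => ?_)
    (fun a T => ?_) (T := T.map (Fin.castLEEmb hv.lt))
    (Finset.map_subset_map.mpr fun j hj => by simpa using hT j hj)
  · rw [hK0, hKJ, Finset.card_map] at h
    exact h
  · ext S'
    simp only [K, mem_quadrics, Submodule.mem_inf, Finset.mem_union]
    grind
  · obtain ⟨σ, hσ, hσ'⟩ := exists_perm_fixing hc
    have hfix : ∀ l : Fin d, (l : ℕ) ≤ i → σ l = l := fun l hl =>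
      hσ' l (fun h => by have := hJ _ (hT h); omega) (fun h => by have := hJ _ (hT' h); omega)
    have hfix' : ∀ l : Fin d, (σ l : ℕ) ≤ i → σ l = l := fun l hl => σ.injective (hfix _ hl)
    refine hv.finrank_quadrics_eq σ (fun l => ?_) (fun l => ?_) hσ
    · simp only [mem_firstIndices]
      constructor
      · intro h; rwa [hfix l h.le]
      · intro h; rwa [← hfix' l h.le]
    · simp only [Finset.mem_singleton]
      constructor
      · rintro rfl; exact hfix _ le_rfl
      · intro h; rw [← hfix' l (by rw [h]; simp), h]
  · have h2 := finrank_le_finrank_inf_ker_functional (K T)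
      (polarAt (v (Fin.castLE hv.lt i)) (v a))
    refine h2.trans (Nat.add_le_add_right (Submodule.finrank_mono fun S hS => ?_) 1)
    simp only [K, Submodule.mem_inf, mem_quadrics, LinearMap.mem_ker, polarAt_apply] at hS ⊢
    refine ⟨hS.1.1, hS.1.2.1, fun l hl j hj => ?_⟩
    rcases Finset.mem_insert.mp hj with rfl | hj
    · rw [Finset.mem_singleton.mp hl]; exact hS.2
    · exact hS.1.2.2 l hl j hj

end SymmetricFrame

/-! ### Strict convexity of the dimensions of cones -/

namespace SymmetricFrame

variable {L : Type*} [Field L] {n d : ℕ} {v : Fin d → Fin (n + 1) → L}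

theorem coneRank_anti {k l : ℕ} (h : k ≤ l) : coneRank v l ≤ coneRank v k := by
  refine Submodule.finrank_mono fun S hS => ?_
  rw [mem_quadrics_empty] at hS ⊢
  exact ⟨hS.1, fun i hi => hS.2 i (by simp at hi ⊢; omega)⟩

theorem coneRank_last (hv : SymmetricFrame v) : coneRank v n = 0 := by
  rw [coneRank, Submodule.finrank_eq_zero, eq_bot_iff]
  intro S hS
  rw [mem_quadrics_empty] at hS
  have h1 : ∀ k l : Fin (n + 1), (k : ℕ) < n → S s(k, l) = 0 := fun k l hk =>
    (hv.polar_vert S k l).mp (hS.2 _ (by simpa using hk) _)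
  rw [Submodule.mem_bot]
  ext z
  induction z with
  | _ k l =>
    rcases Nat.lt_succ_iff_lt_or_eq.mp k.2 with hk | hk
    · exact h1 k l hk
    · rcases Nat.lt_succ_iff_lt_or_eq.mp l.2 with hl | hl
      · rw [Sym2.eq_swap]; exact h1 l k hl
      · obtain rfl : k = l := Fin.ext (hk.trans hl.symm)
        exact (hv.polar_vert S k k).mp (hS.1 _)

/-- If singularity at one further point is automatic, then by symmetry it is automatic at all of
them, and a quadric singular at every point is zero. -/
theorem coneRank_eq_zero (hv : SymmetricFrame v) {k : ℕ} (hk : k < d)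
    (h : coneRank v k = coneRank v (k + 1)) : coneRank v k = 0 := by
  rw [coneRank, Submodule.finrank_eq_zero, eq_bot_iff]
  have h1 : ∀ j : Fin d, k ≤ j → quadrics v (firstIndices d k) ∅ ∅ ≤
      quadrics v (insert j (firstIndices d k)) ∅ ∅ := by
    intro j hj
    refine (Submodule.eq_of_le_of_finrank_eq (fun S hS => ?_) ?_).ge
    · rw [mem_quadrics_empty] at hS ⊢
      exact ⟨hS.1, fun i hi => hS.2 i (Finset.mem_insert_of_mem hi)⟩
    · rw [hv.finrank_quadrics, hv.finrank_quadrics, Finset.card_insert_of_notMem (by simpa using hj),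
        card_firstIndices hk.le, h]
  intro S hS
  rw [Submodule.mem_bot]
  have h2 : ∀ i j, polar S (v i) (v j) = 0 := by
    intro i j
    rcases lt_or_ge (i : ℕ) k with hi | hi
    · exact (mem_quadrics_empty.mp hS).2 i (by simpa using hi) j
    · exact (mem_quadrics_empty.mp (h1 i hi hS)).2 i (Finset.mem_insert_self _ _) j
  ext z
  induction z with
  | _ k l => exact (hv.polar_vert S k l).mp (h2 _ _)

/-- The quadrics singular at p_k and those singular at p_{k+1} both lie in the space where p_k and
p_{k+1} are conjugate. By uniformity this is a proper hyperplane when the drop is positive, which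
improves submodularity by one. -/
theorem coneRank_convex (hv : SymmetricFrame v) {k : ℕ} (hk : k + 1 ≤ n)
    (h : coneRank v (k + 1) < coneRank v k) :
    2 * coneRank v (k + 1) + 1 ≤ coneRank v k + coneRank v (k + 2) := by
  have hlt := hv.lt
  have h1 := hv.finrank_rowQuadrics ⟨k, by omega⟩ (T := {(⟨k + 1, by omega⟩ : Fin (n + 1))})
    (by simp [Fin.lt_def])
  rw [Finset.map_singleton, Finset.card_singleton] at h1
  let X := quadrics v (insert ⟨k + 1, by omega⟩ (firstIndices d k)) ∅ ∅
  let Y := quadrics v (firstIndices d (k + 1)) ∅ ∅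
  have hX : Module.finrank L X = coneRank v (k + 1) := by
    rw [hv.finrank_quadrics, Finset.card_insert_of_notMem (by simp), card_firstIndices (by omega)]
  have hXY : Module.finrank L (X ⊓ Y : Submodule L _) ≤ coneRank v (k + 2) := by
    refine Submodule.finrank_mono fun S hS => ?_
    rw [Submodule.mem_inf] at hS
    have h1 := mem_quadrics_empty.mp hS.1
    have h2 := mem_quadrics_empty.mp hS.2
    rw [mem_quadrics_empty]
    refine ⟨h1.1, fun i hi => ?_⟩
    rcases Nat.lt_succ_iff_lt_or_eq.mp (mem_firstIndices.mp hi) with hi | hi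
    · exact h2.2 i (by simpa using hi)
    · exact h1.2 i (by rw [Finset.mem_insert]; exact Or.inl (Fin.ext hi))
  have hle := Submodule.finrank_mono (show X ⊔ Y ≤ quadrics v (firstIndices d k)
      {Fin.castLE hv.lt ⟨k, by omega⟩} {Fin.castLE hv.lt ⟨k + 1, by omega⟩} by
    refine sup_le (fun S hS => ?_) (fun S hS => ?_)
    · have h1 := mem_quadrics_empty.mp hS
      refine mem_quadrics.mpr ⟨h1.1, fun i hi => h1.2 i (Finset.mem_insert_of_mem hi), ?_⟩
      simp only [Finset.mem_singleton]
      rintro _ rfl _ rfl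
      rw [polar_comm]
      exact h1.2 _ (Finset.mem_insert_self _ _) _
    · have h1 := mem_quadrics_empty.mp hS
      refine mem_quadrics.mpr ⟨h1.1, fun i hi => h1.2 i (by simp at hi ⊢; omega), ?_⟩
      simp only [Finset.mem_singleton]
      rintro _ rfl _ rfl
      exact h1.2 _ (by simp) _)
  have hsum := Submodule.finrank_sup_add_finrank_inf_eq X Y
  have hY : Module.finrank L Y = coneRank v (k + 1) := rfl
  have hle' := hle.trans_eq h1
  dsimp only at hle'
  omega

/-- A quadric containing as many of the points as the points impose conditions on quadrics
contains all of them. -/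
theorem mem_quadrics_of_card_le (hv : SymmetricFrame v) {h : ℕ}
    (hh : (n + 2).choose 2 ≤ coneRank v 0 + h) {A : Finset (Fin d)} (hA : h ≤ A.card)
    {S : Sym2 (Fin (n + 1)) → L} (hS : ∀ i ∈ A, polar S (v i) (v i) = 0) (i : Fin d) :
    polar S (v i) (v i) = 0 := by
  classical
  let K : Finset (Fin d) → Submodule L (Sym2 (Fin (n + 1)) → L) := fun T =>
    apolar v {p | p.1 = p.2 ∧ p.1 ∈ T}
  have hK : ∀ T S, S ∈ K T ↔ ∀ i ∈ T, polar S (v i) (v i) = 0 := by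
    intro T S
    simp only [K, mem_apolar, Set.mem_ofPred_eq]
    exact ⟨fun h i hi => h i i ⟨rfl, hi⟩, by rintro h i _ ⟨rfl, hi⟩; exact h i hi⟩
  -- The evaluations at the points form a uniform matroid of rank at most h, so any h of them
  -- already cut out the quadrics through all points.
  have hdim := fun (T : Finset (Fin d)) => finrank_of_symmetric_functionals K
    (fun S T => by ext; simp only [hK, Submodule.mem_inf, Finset.mem_union]; grind) Finset.univ
    (fun T _ T' _ hc => by
      obtain ⟨σ, hσ, -⟩ := exists_perm_fixing hc
      exact hv.finrank_apolar_eq σ fun i j => by simp [hσ])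
    (fun a T => by
      refine (finrank_le_finrank_inf_ker_functional (K T) (polarAt (v a) (v a))).trans
        (Nat.add_le_add_right (Submodule.finrank_mono fun S hS => ?_) 1)
      rw [Submodule.mem_inf, hK, LinearMap.mem_ker, polarAt_apply] at hS
      rw [hK]
      intro i hi
      rcases Finset.mem_insert.mp hi with rfl | hi
      exacts [hS.2, hS.1 i hi])
    (Finset.subset_univ T)
  have h0 : Module.finrank L (K ∅) = (n + 2).choose 2 := by
    have : K ∅ = ⊤ := by ext; simp [hK]
    rw [this, finrank_top, Module.finrank_fintype_fun_eq_card, Sym2.card, Fintype.card_fin]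
  have h1 : Module.finrank L (K Finset.univ) = coneRank v 0 := by
    have : K Finset.univ = quadrics v (firstIndices d 0) ∅ ∅ := by
      ext S
      rw [hK, mem_quadrics_empty]
      simp
    rw [this]; rfl
  have h2 := hdim A
  have h3 : K Finset.univ ≤ K A := fun S hS => (hK _ _).mpr fun i _ => (hK _ _).mp hS i (by simp)
  have h4 : K Finset.univ = K A := Submodule.eq_of_le_of_finrank_le h3 (by rw [h2, h0, h1]; omega)
  exact (hK _ _).mp (h4.ge ((hK _ _).mpr hS)) i (by simp)

end SymmetricFrame

/-! ### Quadrics containing a codimension-two coordinate subspace -/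

/-- The product of two linear forms, doubled. -/
def prodForm {L κ : Type*} [Field L] (f g : κ → L) : Sym2 κ → L :=
  Sym2.lift ⟨fun k l => f k * g l + f l * g k, fun k l => by ring⟩

theorem polar_prodForm {L κ : Type*} [Field L] [Fintype κ] (f g u : κ → L) :
    polar (prodForm f g) u u = 2 * ((∑ k, f k * u k) * ∑ k, g k * u k) := by
  have h1 : polar (prodForm f g) u u =
      (∑ k, ∑ l, f k * u k * (g l * u l)) + ∑ k, ∑ l, f l * u l * (g k * u k) := by
    rw [polar, ← Finset.sum_add_distrib]
    refine Finset.sum_congr rfl fun k _ => ?_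
    rw [← Finset.sum_add_distrib]
    refine Finset.sum_congr rfl fun l _ => ?_
    simp only [prodForm, Sym2.lift_mk]
    ring
  rw [h1, Finset.sum_comm (f := fun k l => f l * u l * (g k * u k)), ← Finset.sum_mul_sum]
  ring

section CodimensionTwo

variable {L κ : Type*} [Field L] [Fintype κ] [DecidableEq κ] (p q : κ)

/-- For a quadric `S` containing the subspace `x_p = x_q = 0`, written as
`x_p * f + x_q * g` up to a constant, the coefficients of `f`. -/
def leftForm (S : Sym2 κ → L) (k : κ) : L := 2 * S s(k, p) - if k = q then S s(p, q) else 0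

variable {p q}

/-- The term in x_p x_q, with coefficient 2 `S s(p, q)`, is shared equally between the two linear
forms; this is the purpose of the subtraction in `leftForm`. -/
theorem polar_self_eq_of_codim_two (hpq : p ≠ q) {S : Sym2 κ → L}
    (hS : ∀ k l, k ≠ p → k ≠ q → l ≠ p → l ≠ q → S s(k, l) = 0) (hp : S s(p, p) = 0)
    (hq : S s(q, q) = 0) (u : κ → L) :
    polar S u u = u p * (∑ k, leftForm p q S k * u k) + u q * ∑ k, leftForm q p S k * u k := by
  have h1 : ∀ k l, S s(k, l) = (if k = p then S s(p, l) else 0) + (if k = q then S s(q, l) else 0) +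
      (if l = p then S s(k, p) else 0) + (if l = q then S s(k, q) else 0) -
      (if k = p then if l = q then S s(p, q) else 0 else 0) -
      (if k = q then if l = p then S s(p, q) else 0 else 0) := by
    intro k l
    by_cases hkp : k = p
    · subst hkp
      by_cases hlp : l = k
      · subst hlp; simp [hpq, hp]
      · by_cases hlq : l = q
        · subst hlq; simp [hpq, Ne.symm hpq]
        · simp [hpq, hlp, hlq]
    · by_cases hkq : k = q
      · subst hkq
        by_cases hlp : l = p
        · subst hlp; simp [hkp, Ne.symm hkp, Sym2.eq_swap]
        · by_cases hlq : l = k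
          · subst hlq; simp [hkp, hq]
          · simp [hkp, hlp, hlq]
      · by_cases hlp : l = p
        · subst hlp; simp [hkp, hkq, hpq]
        · by_cases hlq : l = q
          · subst hlq; simp [hkp, hkq, Ne.symm hpq]
          · simp [hkp, hkq, hlp, hlq, hS]
  have h2 : polar S u u = ∑ k, ∑ l, ((if k = p then S s(p, l) * (u p * u l) else 0) +
      (if k = q then S s(q, l) * (u q * u l) else 0) +
      (if l = p then S s(k, p) * (u k * u p) else 0) +
      (if l = q then S s(k, q) * (u k * u q) else 0) -
      (if k = p then if l = q then S s(p, q) * (u p * u q) else 0 else 0) -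
      (if k = q then if l = p then S s(p, q) * (u q * u p) else 0 else 0)) := by
    refine Finset.sum_congr rfl fun k _ => Finset.sum_congr rfl fun l _ => ?_
    rw [h1 k l]
    split_ifs <;> subst_vars <;> ring
  have h3 : ∀ p q, u p * ∑ k, leftForm p q S k * u k =
      2 * (∑ k, S s(k, p) * (u k * u p)) - S s(p, q) * (u p * u q) := by
    intro p q
    simp only [leftForm, sub_mul, Finset.sum_sub_distrib, mul_sub, ite_mul, zero_mul,
      Finset.sum_ite_eq', Finset.mem_univ, if_true, Finset.mul_sum]
    congr 1
    · exact Finset.sum_congr rfl fun k _ => by ring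
    · ring
  have h4 : ∀ p, ∑ l, S s(p, l) * (u p * u l) = ∑ k, S s(k, p) * (u k * u p) := fun p =>
    Finset.sum_congr rfl fun k _ => by rw [Sym2.eq_swap, mul_comm (u p)]
  rw [h2, h3, h3]
  have h5 : ∀ (p : κ) (f : κ → L), (∑ k, ∑ l, if k = p then f l else 0) = ∑ l, f l := by
    intro p f
    rw [Finset.sum_comm]
    simp
  simp only [Finset.sum_sub_distrib, Finset.sum_add_distrib, h5, Finset.sum_ite_eq',
    Finset.mem_univ, if_true, h4]
  rw [Sym2.eq_swap (a := q) (b := p)]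
  ring

end CodimensionTwo

/-- The numerical contradiction behind `SymmetricFrame.exists_quadric_singular_along`. -/
theorem convex_drop_contradiction {μ : ℕ → ℕ} {c m z e N : ℕ} (hm : 1 ≤ m) (hN : N = c + m + 1)
    (hz : z ≤ c) (hconv : ∀ a b, a ≤ b → b + 1 ≤ N → μ b + μ (a + 1) ≤ μ a + μ (b + 1))
    (h0 : c + 2 ≤ μ 0) (hz1 : μ (z + 1) = 0) (he : e = min (z + 1) (N - z))
    (h : μ 0 ≤ μ e + (c - z) + e) : False := by
  rcases Nat.lt_or_ge (N - z) (z + 1) with hlt | hge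
  · have he' : e = N - z := by omega
    have he1 : 1 ≤ e := by omega
    -- If the last step into e drops by at least two, convexity gives μ 0 ≥ μ e + 2e. Then e ≤ c -
    -- z, against e = N - z and N > c.
    rcases Nat.lt_or_ge (μ e + 1) (μ (e - 1)) with hD | hD
    · have h2 : ∀ s, s ≤ e → μ e + 2 * s ≤ μ (e - s) := by
        intro s
        induction s with
        | zero => simp
        | succ s ih =>
          intro hs
          have h3 := ih (by omega)
          have h4 := hconv (e - (s + 1)) (e - 1) (by omega) (by omega)
          rw [show e - (s + 1) + 1 = e - s by omega, show e - 1 + 1 = e by omega] at h4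
          omega
      have := h2 e le_rfl
      rw [Nat.sub_self] at this
      omega
    -- Otherwise all steps from e on drop by at most one, so μ e ≤ z + 1 - e and μ 0 ≤ c + 1.
    · have h2 : ∀ s, e + s ≤ z + 1 → μ e ≤ μ (e + s) + s := by
        intro s
        induction s with
        | zero => simp
        | succ s ih =>
          intro hs
          have h3 := ih (by omega)
          have h4 := hconv (e - 1) (e + s) (by omega) (by omega)
          rw [show e - 1 + 1 = e by omega] at h4
          have h5 : μ (e + (s + 1)) = μ (e + s + 1) := rfl
          omega
      have := h2 (z + 1 - e) (by omega)
      rw [show e + (z + 1 - e) = z + 1 by omega] at this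
      omega
  · have he' : e = z + 1 := by omega
    rw [he', hz1] at h
    omega

namespace SymmetricFrame

variable {L : Type*} [Field L] {n d : ℕ} {v : Fin d → Fin (n + 1) → L}

/-- The minor formed from the coefficients of `x_j x_p` and `x_j x_q` in two quadrics. -/
def rowMinor (j p q : Fin (n + 1)) (S T : Sym2 (Fin (n + 1)) → L) : L :=
  S s(j, p) * T s(j, q) - T s(j, p) * S s(j, q)

/-- Of the last two coordinates of a point outside the first `n - 1` points one is nonzero. -/
theorem last_coords_ne_zero (hv : SymmetricFrame v) {p q : Fin (n + 1)}
    (hp : (p : ℕ) = n - 1) (hq : (q : ℕ) = n) (hn : 1 ≤ n) {i : Fin d} (hi : n - 1 ≤ i) :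
    v i p ≠ 0 ∨ v i q ≠ 0 := by
  by_contra! h
  have hpq : p ≠ q := fun h => by rw [h] at hp; omega
  obtain ⟨b, hb, hqv⟩ := hv.vert q
  by_cases hiq : i = Fin.castLE hv.lt q
  · rw [hiq, hqv] at h
    simp [hb] at h
  · have hcard : (insert i (insert (Fin.castLE hv.lt q) (firstIndices d (n - 1)))).card = n + 1 := by
      rw [Finset.card_insert_of_notMem, Finset.card_insert_of_notMem, card_firstIndices]
      · omega
      · have := hv.lt; omega
      · simp; omega
      · rw [Finset.mem_insert]; simp [hiq]; omega
    -- If both coordinates vanished at point i, the form x_p would vanish at n + 1 points: the first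
    -- n - 1, the vertex q and point i.
    have := hv.linearIndependent_of_card hcard (f := Pi.single p 1) (fun j hj => by
      have hs : ∑ k, (Pi.single p 1 : Fin (n + 1) → L) k * v j k = v j p := by
        simp [Pi.single_apply]
      rw [hs]
      rw [Finset.mem_insert, Finset.mem_insert, mem_firstIndices] at hj
      rcases hj with rfl | rfl | hj
      · exact h.1
      · rw [hqv]; simp [hpq]
      · obtain ⟨c, -, hc⟩ := hv.vert ⟨j, by omega⟩
        have : j = Fin.castLE hv.lt ⟨j, by omega⟩ := rfl
        rw [this, hc, Pi.single_eq_of_ne]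
        intro h'
        rw [h'] at hp
        simp at hp
        omega)
    simpa using congrFun this p

/-- Write S = x_p f + x_q g and T = x_p f' + x_q g'. Where both vanish and (x_p, x_q) ≠ 0, the
quadric f g' - f' g vanishes as well; its value at a vertex p_j with j < n - 1 is a nonzero multiple
of the minor in row j. Containing enough points, this quadric contains all of Γ. -/
theorem rowMinor_eq_zero [CharZero L] (hv : SymmetricFrame v) {m : ℕ} (hn : 1 ≤ n) (hmn : m + 2 ≤ n)
    (hd : 2 * n + 2 * m + 1 ≤ d)
    (hw : (n + 2).choose 2 ≤ coneRank v 0 + (2 * n + m)) {p q : Fin (n + 1)}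
    (hp : (p : ℕ) = n - 1) (hq : (q : ℕ) = n) {S T : Sym2 (Fin (n + 1)) → L}
    (hS : S ∈ quadrics v ∅ (firstIndices d (n - 1)) (firstIndices d (n - 1)))
    (hT : T ∈ quadrics v ∅ (firstIndices d (n - 1)) (firstIndices d (n - 1)))
    (h : ∀ j : Fin (n + 1), (j : ℕ) < n - m - 2 → rowMinor j p q S T = 0) (j : Fin (n + 1))
    (hj : (j : ℕ) < n - 1) : rowMinor j p q S T = 0 := by
  have hpq : p ≠ q := fun h => by rw [h] at hp; omega
  have hself : ∀ S ∈ quadrics v ∅ (firstIndices d (n - 1)) (firstIndices d (n - 1)),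
      ∀ u, polar S u u =
        u p * (∑ k, leftForm p q S k * u k) + u q * ∑ k, leftForm q p S k * u k := by
    intro S hS u
    rw [mem_quadrics] at hS
    refine polar_self_eq_of_codim_two hpq (fun k l hkp hkq hlp hlq => ?_)
      ((hv.polar_vert S p p).mp (hS.1 _)) ((hv.polar_vert S q q).mp (hS.1 _)) u
    refine (hv.polar_vert S k l).mp (hS.2.2 _ ?_ _ ?_)
    · rw [mem_firstIndices, Fin.val_castLE]
      have h1 : (k : ℕ) ≠ p := fun h => hkp (Fin.ext h)
      have h2 : (k : ℕ) ≠ q := fun h => hkq (Fin.ext h)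
      omega
    · rw [mem_firstIndices, Fin.val_castLE]
      have h1 : (l : ℕ) ≠ p := fun h => hlp (Fin.ext h)
      have h2 : (l : ℕ) ≠ q := fun h => hlq (Fin.ext h)
      omega
  let D : Sym2 (Fin (n + 1)) → L :=
    prodForm (leftForm p q S) (leftForm q p T) - prodForm (leftForm p q T) (leftForm q p S)
  have hD : ∀ u, polar D u u = 2 * ((∑ k, leftForm p q S k * u k) * (∑ k, leftForm q p T k * u k) -
      (∑ k, leftForm p q T k * u k) * ∑ k, leftForm q p S k * u k) := by
    intro u
    have : polar D u u = polar (prodForm (leftForm p q S) (leftForm q p T)) u u -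
        polar (prodForm (leftForm p q T) (leftForm q p S)) u u := map_sub (polarAt u u) _ _
    rw [this, polar_prodForm, polar_prodForm]
    ring
  have hDv : ∀ j : Fin (n + 1), (j : ℕ) < n - 1 →
      (polar D (v (Fin.castLE hv.lt j)) (v (Fin.castLE hv.lt j)) = 0 ↔ rowMinor j p q S T = 0) := by
    intro j hj
    obtain ⟨c, hc, hjv⟩ := hv.vert j
    have hjp : j ≠ p := fun h => by rw [h] at hj; omega
    have hjq : j ≠ q := fun h => by rw [h] at hj; omega
    have hs : ∀ f : Fin (n + 1) → L,
        ∑ k, f k * (Pi.single j c : Fin (n + 1) → L) k = f j * c := by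
      intro f; simp [Pi.single_apply]
    have : polar D (v (Fin.castLE hv.lt j)) (v (Fin.castLE hv.lt j)) =
        (8 * c ^ 2) * rowMinor j p q S T := by
      rw [hD, hjv]
      simp only [hs, leftForm, if_neg hjp, if_neg hjq, rowMinor]
      ring
    rw [this, mul_eq_zero]
    simp [hc]
  rw [← hDv j hj]
  have hlt := hv.lt
  -- The count is (n - m - 2) + (d - n + 1) = d - m - 1 ≥ 2n + m; here the bound on d enters.
  refine hv.mem_quadrics_of_card_le hw
    (A := firstIndices d (n - m - 2) ∪ (firstIndices d (n - 1))ᶜ) ?_ ?_ _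
  · rw [Finset.card_union_of_disjoint, card_firstIndices (by omega), Finset.card_compl,
      card_firstIndices (by omega), Fintype.card_fin]
    · omega
    · rw [Finset.disjoint_left]
      intro i hi
      simp at hi ⊢
      omega
  · intro i hi
    rw [Finset.mem_union, Finset.mem_compl, mem_firstIndices, mem_firstIndices, not_lt] at hi
    rcases hi with hi | hi
    · exact (hDv ⟨i, by omega⟩ (by simp; omega)).mpr (h _ hi)
    · rw [hD]
      have h1 := (mem_quadrics.mp hS).1 i
      have h2 := (mem_quadrics.mp hT).1 i
      rw [hself S hS] at h1
      rw [hself T hT] at h2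
      rcases hv.last_coords_ne_zero hp hq hn hi with h3 | h3
      · have : v i p * ((∑ k, leftForm p q S k * v i k) * (∑ k, leftForm q p T k * v i k) -
            (∑ k, leftForm p q T k * v i k) * ∑ k, leftForm q p S k * v i k) = 0 := by
          linear_combination (∑ k, leftForm q p T k * v i k) * h1 -
            (∑ k, leftForm q p S k * v i k) * h2
        rw [(mul_eq_zero.mp this).resolve_left h3, mul_zero]
      · have : v i q * ((∑ k, leftForm p q S k * v i k) * (∑ k, leftForm q p T k * v i k) -
            (∑ k, leftForm p q T k * v i k) * ∑ k, leftForm q p S k * v i k) = 0 := by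
          linear_combination (∑ k, leftForm p q S k * v i k) * h2 -
            (∑ k, leftForm p q T k * v i k) * h1
        rw [(mul_eq_zero.mp this).resolve_left h3, mul_zero]

/-- A lower bound for the dimension of the space of quadrics that contain all the points and the
span of the first `n - 1` points. -/
theorem le_finrank_quadrics_codim_two (hv : SymmetricFrame v) {m : ℕ} (hmn : m + 2 ≤ n)
    (hw : (n + 2).choose 2 ≤ coneRank v 0 + (2 * n + m)) :
    n - m ≤ Module.finrank L
      (quadrics v ∅ (firstIndices d (n - 1)) (firstIndices d (n - 1))) := by
  let f : (Sym2 (Fin (n + 1)) → L) →ₗ[L] ({z : Sym2 (Fin (n - 1)) // ¬ z.IsDiag} → L) :=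
    LinearMap.funLeft L L fun z => z.1.map (Fin.castLE (by omega))
  have h1 := finrank_le_finrank_inf_ker_add (quadrics v (firstIndices d 0) ∅ ∅) f
  rw [Module.finrank_fintype_fun_eq_card, Sym2.card_subtype_not_diag, Fintype.card_fin] at h1
  have h2 : quadrics v (firstIndices d 0) ∅ ∅ ⊓ LinearMap.ker f ≤
      quadrics v ∅ (firstIndices d (n - 1)) (firstIndices d (n - 1)) := by
    intro S hS
    rw [Submodule.mem_inf, mem_quadrics_empty, LinearMap.mem_ker] at hS
    rw [mem_quadrics]
    refine ⟨hS.1.1, by simp, fun i hi j hj => ?_⟩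
    rw [mem_firstIndices] at hi hj
    by_cases hij : i = j
    · rw [hij]; exact hS.1.1 j
    · refine (hv.polar_vert S ⟨i, by omega⟩ ⟨j, by omega⟩).mpr ?_
      exact congrFun hS.2 ⟨s(⟨i, hi⟩, ⟨j, hj⟩), by simpa [Fin.ext_iff] using hij⟩
  have h3 := Submodule.finrank_mono h2
  -- Containing the span costs one condition for each pair of the first n - 1 vertices; this leaves
  -- at least C(n+2,2) - (2n + m) - C(n-1,2) = n - m.
  have h4 : (n + 2).choose 2 = (n - 1).choose 2 + 3 * n := by
    obtain ⟨k, rfl⟩ : ∃ k, n = k + 1 := ⟨n - 1, by omega⟩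
    simp only [Nat.add_sub_cancel]
    rw [show k + 1 + 2 = (k + 2) + 1 by ring, Nat.choose_succ_succ' (k + 2) 1,
      show k + 2 = (k + 1) + 1 by ring, Nat.choose_succ_succ' (k + 1) 1,
      Nat.choose_succ_succ' k 1]
    simp
    ring
  have h5 : coneRank v 0 = Module.finrank L (quadrics v (firstIndices d 0) ∅ ∅) := rfl
  omega

/-- There is a quadric through all the points, singular at the first `n - m - 1` of them, that
contains the span of the first `n - 1` points. -/
theorem exists_quadric_singular_along [CharZero L] (hv : SymmetricFrame v) {m : ℕ} (hm : 1 ≤ m)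
    (hmn : m + 2 ≤ n) (hd : 2 * n + 2 * m + 1 ≤ d)
    (hw : (n + 2).choose 2 ≤ coneRank v 0 + (2 * n + m)) :
    Module.finrank L (quadrics v (firstIndices d (n - m - 1)) (firstIndices d (n - 1))
      (firstIndices d (n - 1))) ≠ 0 := by
  intro hzero
  have hlt := hv.lt
  let J := firstIndices d (n - 1)
  have hJ : J.card = n - 1 := card_firstIndices (by omega)
  let K : Finset (Fin d) → Submodule L (Sym2 (Fin (n + 1)) → L) := fun Z => quadrics v Z J J
  obtain ⟨μ, hμ, -, hconv⟩ := exists_convex_finrank K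
    (fun S T => by
      ext
      simp only [K, mem_quadrics, Submodule.mem_inf, Finset.mem_union]
      grind) J (fun T hT T' hT' hc => by
      obtain ⟨σ, hσ, hσ'⟩ := exists_perm_fixing hc
      have hσJ : ∀ i, i ∈ J ↔ σ i ∈ J := by
        intro i
        by_cases h1 : i ∈ T
        · simp [hT h1, hT' ((hσ i).mp h1)]
        · by_cases h2 : i ∈ T'
          · simp only [hT' h2, true_iff]
            by_cases h3 : σ i ∈ T
            · exact hT h3
            · by_contra h4
              have h5 := hσ' (σ i) h3 fun h => h4 (hT' h)
              exact h4 (by rw [σ.injective h5]; exact hT' h2)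
          · rw [hσ' i h1 h2]
      exact hv.finrank_quadrics_eq σ hσ hσJ hσJ)
  have hμ' : ∀ k, k ≤ n - 1 → Module.finrank L (K (firstIndices d k)) = μ k := by
    intro k hk
    rw [hμ _ (fun i hi => by simp [J] at hi ⊢; omega), card_firstIndices (by omega)]
  have hμ0 : n - m ≤ μ 0 := by
    have h0 := hμ ∅ (by simp)
    rw [Finset.card_empty] at h0
    rw [← h0]
    exact hv.le_finrank_quadrics_codim_two hmn hw
  have hμc : μ (n - m - 1) = 0 := by rw [← hμ' _ (by omega)]; exact hzero
  -- z is the largest number of points of J at which a nonzero quadric of this kind can be singular;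
  -- Q below attains it, so its rows beyond z cannot vanish.
  obtain ⟨z, hzc, hz, hz1⟩ : ∃ z, z ≤ n - m - 2 ∧ μ z ≠ 0 ∧ μ (z + 1) = 0 := by
    have hex : ∃ k, μ k = 0 := ⟨_, hμc⟩
    have h1 := Nat.find_spec hex
    have h2 := Nat.find_min' hex hμc
    have h3 : Nat.find hex ≠ 0 := fun h => by rw [h] at h1; omega
    refine ⟨Nat.find hex - 1, by omega, Nat.find_min hex (by omega), ?_⟩
    rwa [Nat.sub_add_cancel (by omega)]
  rw [← hμ' z (by omega), Ne, Submodule.finrank_eq_zero] at hz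
  obtain ⟨Q, hQ, hQ0⟩ := Submodule.exists_mem_ne_zero_of_ne_bot hz
  have hQM : Q ∈ K ∅ := by
    rw [mem_quadrics] at hQ ⊢
    exact ⟨hQ.1, by simp, hQ.2.2⟩
  let p : Fin (n + 1) := ⟨n - 1, by omega⟩
  let q : Fin (n + 1) := ⟨n, by omega⟩
  -- a quadric in `K ∅` is singular at a vertex in `J` if two coefficients vanish
  have hrow : ∀ S ∈ K ∅, ∀ j : Fin (n + 1), (j : ℕ) < n - 1 → S s(j, p) = 0 → S s(j, q) = 0 →
      ∀ i, polar S (v (Fin.castLE hv.lt j)) (v i) = 0 := by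
    intro S hS j hj hjp hjq
    rw [hv.polar_vert_left]
    intro k
    rcases lt_trichotomy (k : ℕ) (n - 1) with hk | hk | hk
    · exact (hv.polar_vert S j k).mp ((mem_quadrics.mp hS).2.2 _ (by simpa [J] using hj) _
        (by simpa [J] using hk))
    · rwa [show k = p from Fin.ext hk]
    · rwa [show k = q from Fin.ext (by simp only [q]; omega)]
  have hQrow : ∀ j : Fin (n + 1), z ≤ (j : ℕ) → (j : ℕ) < n - 1 →
      ¬ (Q s(j, p) = 0 ∧ Q s(j, q) = 0) := by
    rintro j hzj hj ⟨h1, h2⟩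
    have h3 : Q ∈ K (insert (Fin.castLE hv.lt j) (firstIndices d z)) := by
      rw [mem_quadrics] at hQ ⊢
      refine ⟨hQ.1, fun i hi => ?_, hQ.2.2⟩
      rcases Finset.mem_insert.mp hi with rfl | hi
      · exact hrow Q hQM j hj h1 h2
      · exact hQ.2.1 i hi
    have h4 : Module.finrank L (K (insert (Fin.castLE hv.lt j) (firstIndices d z))) = 0 := by
      rw [hμ, Finset.card_insert_of_notMem (by simpa using hzj), card_firstIndices (by omega), hz1]
      intro i hi
      rcases Finset.mem_insert.mp hi with rfl | hi
      · simpa [J] using hj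
      · simp [J] at hi ⊢; omega
    rw [Submodule.finrank_eq_zero] at h4
    rw [h4, Submodule.mem_bot] at h3
    exact hQ0 h3
  have hQZ : ∀ j : Fin (n + 1), (j : ℕ) < z → ∀ k, Q s(j, k) = 0 := by
    intro j hj
    rw [← hv.polar_vert_left]
    exact (mem_quadrics.mp hQ).2.1 _ (by simpa using hj)
  -- Singularity at z + 1 points would already force zero, while J offers only n - 1 - z vertices
  -- from index z on.
  let e := min (z + 1) (n - 1 - z)
  -- Vanishing minors with Q in rows z, ..., n - m - 3 are n - m - 2 - z conditions on T. The rows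
  -- before z cost nothing because Q is zero there, so `rowMinor_eq_zero` makes every row of T in J
  -- proportional to that of Q.
  let f₁ : (Sym2 (Fin (n + 1)) → L) →ₗ[L] (Fin (n - m - 2 - z) → L) :=
    { toFun := fun T j => rowMinor ⟨z + j, by omega⟩ p q Q T
      map_add' := fun S T => by ext j; simp [rowMinor]; ring
      map_smul' := fun a T => by ext j; simp [rowMinor]; ring }
  -- Once row z + j of T is proportional to the nonzero row of Q, one entry decides whether it
  -- vanishes: the entry at p if Q is nonzero there, otherwise the entry at q.
  let f₂ : (Sym2 (Fin (n + 1)) → L) →ₗ[L] (Fin e → L) := LinearMap.funLeft L L fun j : Fin e =>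
    open Classical in
    if Q s((⟨z + j, by omega⟩ : Fin (n + 1)), p) = 0 then s((⟨z + j, by omega⟩ : Fin (n + 1)), q)
    else s((⟨z + j, by omega⟩ : Fin (n + 1)), p)
  have h1 := finrank_le_finrank_inf_ker_add (K ∅) f₁
  have h2 := finrank_le_finrank_inf_ker_add (K ∅ ⊓ LinearMap.ker f₁) f₂
  rw [Module.finrank_fin_fun] at h1 h2
  let E := (firstIndices d (z + e)) \ firstIndices d z
  have hE : E.card = e := by
    rw [Finset.card_sdiff_of_subset (fun i hi => by simp at hi ⊢; omega),
      card_firstIndices (by omega), card_firstIndices (by omega)]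
    omega
  have h3 : (K ∅ ⊓ LinearMap.ker f₁) ⊓ LinearMap.ker f₂ ≤ K E := by
    rintro T ⟨⟨hT, hT1⟩, hT2⟩
    have hminor : ∀ j : Fin (n + 1), (j : ℕ) < n - 1 → rowMinor j p q Q T = 0 := by
      refine hv.rowMinor_eq_zero (by omega) hmn hd hw rfl rfl hQM hT fun j hj => ?_
      rcases lt_or_ge (j : ℕ) z with hjz | hjz
      · simp [rowMinor, hQZ j hjz]
      · have : rowMinor ⟨z + (j - z), by omega⟩ p q Q T = 0 := congrFun hT1 ⟨j - z, by omega⟩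
        convert this using 2
        exact Fin.ext (by simp; omega)
    refine mem_quadrics.mpr ⟨(mem_quadrics.mp hT).1, fun i hi => ?_, (mem_quadrics.mp hT).2.2⟩
    simp only [E, Finset.mem_sdiff, mem_firstIndices, not_lt] at hi
    have hj : (i : ℕ) < n - 1 := by omega
    have h4 := hminor ⟨i, by omega⟩ hj
    have h5 := hQrow ⟨i, by omega⟩ hi.2 hj
    have h6 := congrFun hT2 ⟨i - z, by omega⟩
    have h7 : (⟨z + (i - z), by omega⟩ : Fin (n + 1)) = ⟨i, by omega⟩ :=
      Fin.ext (by simp; omega)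
    simp only [f₂, LinearMap.funLeft_apply, h7, Pi.zero_apply] at h6
    rw [rowMinor] at h4
    split_ifs at h6 with h8 <;> rw [h7] at h8
    · refine hrow T hT ⟨i, by omega⟩ hj ?_ h6
      rw [h8, h6] at h4
      have h9 : Q s(⟨i, by omega⟩, q) ≠ 0 := fun h => h5 ⟨h8, h⟩
      simpa [h9] using h4
    · refine hrow T hT ⟨i, by omega⟩ hj h6 ?_
      rw [h6] at h4
      simpa [h8] using h4
  -- Altogether μ 0 ≤ (n - m - 2 - z) + e + μ e, which is incompatible with μ 0 ≥ n - m.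
  have h4 := Submodule.finrank_mono h3
  rw [hμ E (fun i hi => by simp [E, J] at hi ⊢; omega), hE] at h4
  have h5 : Module.finrank L (K ∅) = μ 0 := by simpa using hμ ∅ (by simp)
  exact convex_drop_contradiction (c := n - m - 2) (m := m) (N := n - 1) (e := e) hm (by omega) hzc
    (by rwa [hJ] at hconv) (by omega) hz1 rfl (by omega)

end SymmetricFrame

/-! ### Arithmetic of sequences with strictly decreasing drops -/

section Numerics

theorem choose_succ_two (n : ℕ) : (n + 1).choose 2 = n.choose 2 + n := by
  rw [Nat.choose_succ_succ' n 1, Nat.choose_one_right, add_comm]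

theorem choose_two_eq {n : ℕ} (hn : 1 ≤ n) : n.choose 2 = (n - 1).choose 2 + (n - 1) := by
  rw [← choose_succ_two, Nat.sub_add_cancel hn]

theorem choose_add_two_two (n : ℕ) : (n + 2).choose 2 = n.choose 2 + 2 * n + 1 := by
  rw [choose_succ_two, choose_succ_two]
  ring

variable {w : ℕ → ℕ} {n : ℕ}

/-- With truncated subtraction, the hypothesis `hr` says that the drops decrease strictly until they
reach 0 and then remain 0. -/
theorem drop_add_le (hr : ∀ k, k + 1 ≤ n → w (k + 1) - w (k + 2) ≤ w k - w (k + 1) - 1) (k j : ℕ)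
    (h : k + j ≤ n) : w (k + j) - w (k + j + 1) ≤ w k - w (k + 1) - j := by
  induction j with
  | zero => simp
  | succ j ih =>
    have h1 := ih (by omega)
    have h2 := hr (k + j) (by omega)
    rw [show k + (j + 1) = k + j + 1 by ring, show k + j + 1 + 1 = k + j + 2 by ring]
    omega

/-- From k on the drops are at most a, a - 1, ..., 1, and the sequence ends at 0, so w k is at most
their sum. -/
theorem le_choose_of_drop_le (hr : ∀ k, k + 1 ≤ n → w (k + 1) - w (k + 2) ≤ w k - w (k + 1) - 1)
    (hz : ∀ k, k ≤ n → w k = w (k + 1) → w k = 0) (hanti : ∀ k, w (k + 1) ≤ w k) (hn : w n = 0)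
    (a k : ℕ) (hk : k ≤ n) (h : w k - w (k + 1) ≤ a) : w k ≤ (a + 1).choose 2 := by
  induction a generalizing k with
  | zero =>
    have h1 := hanti k
    rw [hz k hk (by omega)]
    exact Nat.zero_le _
  | succ a ih =>
    rcases Nat.lt_or_ge k n with hkn | hkn
    · have h1 := ih (k + 1) hkn (by have := hr k hkn; rw [show k + 1 + 1 = k + 2 by ring]; omega)
      have h2 := hanti k
      rw [choose_succ_two (a + 1)]
      omega
    · rw [show k = n by omega, hn]
      exact Nat.zero_le _

/-- Going backwards from a drop of at least a, the k preceding drops are at least a + 1, ..., a + k.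
The condition 1 ≤ a prevents truncation from hiding a zero drop. -/
theorem add_choose_le_of_le_drop
    (hr : ∀ k, k + 1 ≤ n → w (k + 1) - w (k + 2) ≤ w k - w (k + 1) - 1)
    (s k a : ℕ) (hk : s + k ≤ n) (ha : 1 ≤ a) (h : a ≤ w (s + k) - w (s + k + 1)) :
    w (s + k) + (a + k + 1).choose 2 ≤ w s + (a + 1).choose 2 := by
  induction k generalizing a with
  | zero => simp
  | succ k ih =>
    have h1 := hr (s + k) (by omega)
    rw [show s + (k + 1) = s + k + 1 by ring] at h ⊢
    rw [show s + k + 1 + 1 = s + k + 2 by ring] at h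
    have h2 := ih (a + 1) (by omega) (by omega) (by omega)
    have h3 := choose_succ_two (a + 1)
    rw [show a + 1 + k + 1 = a + (k + 1) + 1 by ring] at h2
    omega

/-- The first k drops are at most c + k, ..., c + 1. -/
theorem le_add_choose_of_drop_le
    (hr : ∀ k, k + 1 ≤ n → w (k + 1) - w (k + 2) ≤ w k - w (k + 1) - 1)
    (c k : ℕ) (hk : k ≤ n) (h : w 0 - w 1 ≤ c + k) :
    w 0 + (c + 1).choose 2 ≤ w k + (c + k + 1).choose 2 := by
  induction k generalizing c with
  | zero => simp
  | succ k ih =>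
    have h1 := ih (c + 1) (by omega) (by omega)
    have h2 := drop_add_le hr 0 k (by omega)
    simp only [zero_add] at h2
    have h3 := choose_succ_two (c + 1)
    rw [show c + 1 + k + 1 = c + (k + 1) + 1 by ring] at h1
    omega

end Numerics

/-! ### The values of the cone dimensions -/

namespace SymmetricFrame

variable {L : Type*} [Field L] {n d : ℕ} {v : Fin d → Fin (n + 1) → L}

theorem coneRank_drop (hv : SymmetricFrame v) {k : ℕ} (hk : k + 1 ≤ n) :
    coneRank v (k + 1) - coneRank v (k + 2) ≤ coneRank v k - coneRank v (k + 1) - 1 := by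
  have hlt := hv.lt
  have h1 := coneRank_anti (v := v) (Nat.le_succ k)
  have h2 := coneRank_anti (v := v) (Nat.le_succ (k + 1))
  simp only [Nat.succ_eq_add_one] at h1 h2
  rcases h1.lt_or_eq with h | h
  · have := hv.coneRank_convex hk h
    omega
  · have := hv.coneRank_eq_zero (by omega) h.symm
    omega

/-- A lower bound for the number of leading monomials `x_k x_j`, `k = n - m - 1`. -/
theorem le_coneRank_sub [CharZero L] (hv : SymmetricFrame v) {m : ℕ} (hm : 1 ≤ m)
    (hmn : m + 2 ≤ n) (hd : 2 * n + 2 * m + 1 ≤ d)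
    (hw : (n + 2).choose 2 ≤ coneRank v 0 + (2 * n + m)) :
    m ≤ coneRank v (n - m - 1) - coneRank v (n - m) := by
  by_contra! hlt
  refine hv.exists_quadric_singular_along hm hmn hd hw ?_
  rw [Submodule.finrank_eq_zero, eq_bot_iff]
  intro S hS
  -- In row i = n - m - 1 + j the quadric S has zero coefficients at the m - 1 - j columns strictly
  -- between i and n - 1. If the initial drop were below m, the drop at i would be at most m - 1 -
  -- j, so uniformity kills the whole row; by induction S is singular at the first n points.
  have key : ∀ j, n - m - 1 + j ≤ n → S ∈ quadrics v (firstIndices d (n - m - 1 + j)) ∅ ∅ := by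
    intro j
    induction j with
    | zero =>
      intro _
      rw [mem_quadrics] at hS
      exact mem_quadrics_empty.mpr ⟨hS.1, hS.2.1⟩
    | succ j ih =>
      intro hj
      have h1 := ih (by omega)
      have h2 := drop_add_le (fun k hk => hv.coneRank_drop hk) (n - m - 1) j (by omega)
      rw [show n - m - 1 + 1 = n - m by omega] at h2
      let i : Fin (n + 1) := ⟨n - m - 1 + j, by omega⟩
      let T : Finset (Fin (n + 1)) := Finset.Ioo i ⟨n - 1, by omega⟩
      have hT : T.card = n - 1 - (n - m - 1 + j) - 1 := Fin.card_Ioo _ _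
      have h3 := hv.finrank_rowQuadrics i (T := T) (fun k hk => (Finset.mem_Ioo.mp hk).1)
      have h4 : (i : ℕ) = n - m - 1 + j := rfl
      rw [hT, h4, Nat.min_eq_right (by omega)] at h3
      have h5 := coneRank_anti (v := v) (Nat.le_succ (n - m - 1 + j))
      simp only [Nat.succ_eq_add_one] at h5
      rw [Nat.sub_sub_self h5] at h3
      have h6 : quadrics v (firstIndices d (n - m - 1 + j + 1)) ∅ ∅ =
          quadrics v (firstIndices d (n - m - 1 + j)) {Fin.castLE hv.lt i}
            (T.map (Fin.castLEEmb hv.lt)) := by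
        refine Submodule.eq_of_le_of_finrank_eq (fun S hS => ?_) h3.symm
        rw [mem_quadrics_empty] at hS
        refine mem_quadrics.mpr ⟨hS.1, fun l hl => hS.2 l ?_, fun l hl k _ => hS.2 l ?_ k⟩
        · rw [mem_firstIndices] at hl ⊢; omega
        · rw [Finset.mem_singleton.mp hl]; simp [i]
      rw [← add_assoc, h6]
      rw [mem_quadrics_empty] at h1
      refine mem_quadrics.mpr ⟨h1.1, h1.2, fun l hl k hk => ?_⟩
      obtain ⟨k', hk', rfl⟩ := Finset.mem_map.mp hk
      rw [Finset.mem_singleton.mp hl]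
      refine (mem_quadrics.mp hS).2.2 _ ?_ _ ?_
      · have := Finset.mem_Ioo.mp hk'
        have h7 := this.1.trans this.2
        simpa [Fin.lt_def] using h7
      · have := (Finset.mem_Ioo.mp hk').2
        simpa [Fin.lt_def] using this
  have h1 := key (m + 1) (by omega)
  rw [show n - m - 1 + (m + 1) = n by omega] at h1
  have h2 := hv.coneRank_last
  rw [coneRank, Submodule.finrank_eq_zero] at h2
  rwa [h2] at h1

/-- A smaller drop would give w_0 ≤ (n - 2) + ... + 1 = C(n-1,2), while w_0 = C(n-1,2) + n - m. -/
theorem le_coneRank_drop_zero (hv : SymmetricFrame v) {m : ℕ} (hmn : m + 2 ≤ n)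
    (hw : coneRank v 0 + (2 * n + m) = (n + 2).choose 2) :
    n ≤ coneRank v 0 - coneRank v 1 + 1 := by
  by_contra! h
  have hlt := hv.lt
  have h1 := le_choose_of_drop_le (fun k hk => hv.coneRank_drop hk)
    (fun k hk => hv.coneRank_eq_zero (by omega)) (fun k => coneRank_anti (Nat.le_succ k))
    hv.coneRank_last (n - 2) 0 (by omega) (by simp only [zero_add]; omega)
  have h2 := choose_add_two_two n
  have h3 := choose_two_eq (n := n) (by omega)
  rw [show n - 2 + 1 = n - 1 by omega] at h1
  omega

theorem coneRank_drop_lt (hv : SymmetricFrame v) (h : coneRank v 0 - coneRank v 1 = n - 1)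
    {i : ℕ} (hi : i < n) : coneRank v i - coneRank v (i + 1) < n - i := by
  have := drop_add_le (fun k hk => hv.coneRank_drop hk) 0 i (by omega)
  simp only [zero_add] at this
  omega

/-- The upper bounds n - 1, n - 2, ... on the drops meet the lower bounds propagated back from the
drop m at n - m - 1, so w_0 - w_{n-m-1} = C(n,2) - C(m+1,2) exactly. -/
theorem coneRank_of_drop_eq [CharZero L] (hv : SymmetricFrame v) {m : ℕ} (hm : 1 ≤ m)
    (hmn : m + 2 ≤ n) (hd : 2 * n + 2 * m + 1 ≤ d)
    (hw : coneRank v 0 + (2 * n + m) = (n + 2).choose 2)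
    (h : coneRank v 0 - coneRank v 1 = n - 1) :
    coneRank v (n - m - 1) = m.choose 2 + 1 ∧ coneRank v (n - m) = (m - 1).choose 2 := by
  have hr : ∀ k, k + 1 ≤ n → coneRank v (k + 1) - coneRank v (k + 2) ≤
    coneRank v k - coneRank v (k + 1) - 1 := fun k hk => hv.coneRank_drop hk
  have h1 := hv.le_coneRank_sub hm hmn hd hw.ge
  have h2 := add_choose_le_of_le_drop hr 0 (n - m - 1) m (by omega) hm
    (by rwa [zero_add, show n - m - 1 + 1 = n - m by omega])
  have h3 := le_add_choose_of_drop_le hr m (n - m - 1) (by omega) (by omega)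
  rw [zero_add] at h2
  rw [show m + (n - m - 1) + 1 = n by omega] at h2 h3
  have h4 := choose_add_two_two n
  have h5 := choose_two_eq (n := m + 1) (by omega)
  have h6 := choose_two_eq hm
  have h7 := hv.coneRank_drop_lt h (i := n - m - 1) (by omega)
  rw [show n - m - 1 + 1 = n - m by omega] at h7
  simp only [Nat.add_sub_cancel] at h5
  have h8 := coneRank_anti (v := v) (show n - m - 1 ≤ n - m by omega)
  omega

/-- Here the first drop is at least n, and the drops at 1, ..., n - m - 2 are still at least n - 2,
..., m + 1; this leaves at least one dimension less than in `coneRank_of_drop_eq`. -/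
theorem coneRank_of_drop_ne [CharZero L] (hv : SymmetricFrame v) {m : ℕ} (hm : 1 ≤ m)
    (hmn : m + 2 ≤ n) (hd : 2 * n + 2 * m + 1 ≤ d)
    (hw : coneRank v 0 + (2 * n + m) = (n + 2).choose 2)
    (h : coneRank v 0 - coneRank v 1 ≠ n - 1) :
    coneRank v (n - m - 1) ≤ m.choose 2 ∧ coneRank v (n - m) + 1 ≤ (m - 1).choose 2 := by
  have hr : ∀ k, k + 1 ≤ n → coneRank v (k + 1) - coneRank v (k + 2) ≤
    coneRank v k - coneRank v (k + 1) - 1 := fun k hk => hv.coneRank_drop hk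
  have h0 := hv.le_coneRank_drop_zero hmn hw
  have h1 := hv.le_coneRank_sub hm hmn hd hw.ge
  have h2 := add_choose_le_of_le_drop hr 1 (n - m - 2) m (by omega) hm
    (by rwa [show 1 + (n - m - 2) = n - m - 1 by omega, show n - m - 1 + 1 = n - m by omega])
  rw [show 1 + (n - m - 2) = n - m - 1 by omega, show m + (n - m - 2) + 1 = n - 1 by omega] at h2
  have h4 := choose_add_two_two n
  have h5 := choose_two_eq (n := m + 1) (by omega)
  have h6 := choose_two_eq hm
  have h7 := choose_two_eq (n := n) (by omega)
  simp only [Nat.add_sub_cancel] at h5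
  have h8 := coneRank_anti (v := v) (show n - m - 1 ≤ n - m by omega)
  omega

end SymmetricFrame

/-! ### Quadratic forms as polynomials -/

/-- The quadratic form with symmetric bilinear form `polar S`. -/
def quadPoly {L κ : Type*} [Field L] [Fintype κ] : (Sym2 κ → L) →ₗ[L] MvPolynomial κ L where
  toFun S := ∑ k, ∑ l, C (S s(k, l)) * (X k * X l)
  map_add' S T := by simp [add_mul, Finset.sum_add_distrib]
  map_smul' a S := by simp [Finset.smul_sum, smul_eq_C_mul, mul_assoc]

theorem single_add_single_eq_iff {κ : Type*} {k l a b : κ} :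
    (Finsupp.single k 1 + Finsupp.single l 1 : κ →₀ ℕ) = Finsupp.single a 1 + Finsupp.single b 1 ↔
      s(k, l) = s(a, b) := by
  classical
  rw [Sym2.eq_iff]
  constructor
  · intro h
    have h1 := DFunLike.congr_fun h k
    have h2 := DFunLike.congr_fun h l
    have h3 := DFunLike.congr_fun h a
    have h4 := DFunLike.congr_fun h b
    simp only [Finsupp.add_apply, Finsupp.single_apply] at h1 h2 h3 h4
    by_cases hka : k = a
    · subst hka
      have : (Finsupp.single l 1 : κ →₀ ℕ) = Finsupp.single b 1 := add_left_cancel h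
      exact Or.inl ⟨rfl, Finsupp.single_left_injective one_ne_zero this⟩
    · by_cases hkb : k = b
      · subst hkb
        rw [add_comm (Finsupp.single a 1)] at h
        have : (Finsupp.single l 1 : κ →₀ ℕ) = Finsupp.single a 1 := add_left_cancel h
        exact Or.inr ⟨rfl, Finsupp.single_left_injective one_ne_zero this⟩
      · simp [Ne.symm hka, Ne.symm hkb] at h1
  · rintro (⟨rfl, rfl⟩ | ⟨rfl, rfl⟩)
    · rfl
    · exact add_comm _ _

theorem exists_single_add_single {κ : Type*} {t : κ →₀ ℕ} (ht : t.degree = 2) :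
    ∃ k l, t = Finsupp.single k 1 + Finsupp.single l 1 := by
  classical
  obtain ⟨k, hk⟩ : ∃ k, t k ≠ 0 := by
    by_contra! h
    have : t = 0 := by ext; simp [h]
    simp [this] at ht
  obtain ⟨s, rfl⟩ : ∃ s, t = Finsupp.single k 1 + s :=
    ⟨t - Finsupp.single k 1, (add_tsub_cancel_of_le (by
      rw [Finsupp.single_le_iff]; omega)).symm⟩
  have hs : s.degree = 1 := by
    rw [map_add, Finsupp.degree_single] at ht
    omega
  obtain ⟨l, hl⟩ : ∃ k, s k ≠ 0 := by
    by_contra! h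
    have : s = 0 := by ext; simp [h]
    simp [this] at hs
  obtain ⟨r, rfl⟩ : ∃ r, s = Finsupp.single l 1 + r :=
    ⟨s - Finsupp.single l 1, (add_tsub_cancel_of_le (by
      rw [Finsupp.single_le_iff]; omega)).symm⟩
  have hr : r.degree = 0 := by
    rw [map_add, Finsupp.degree_single] at hs
    omega
  rw [Finsupp.degree_eq_zero_iff] at hr
  exact ⟨k, l, by rw [hr, add_zero]⟩

section quadPoly

variable {L κ : Type*} [Field L] [Fintype κ] (S : Sym2 κ → L)

theorem quadPoly_apply : quadPoly S = ∑ k, ∑ l, C (S s(k, l)) * (X k * X l) := rfl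

theorem aeval_quadPoly (u : κ → L) : aeval u (quadPoly S) = polar S u u := by
  simp [quadPoly_apply, polar]

theorem quadPoly_isHomogeneous : (quadPoly S).IsHomogeneous 2 :=
  IsHomogeneous.sum _ _ _ fun k _ => IsHomogeneous.sum _ _ _ fun l _ =>
    ((isHomogeneous_X L k).mul (isHomogeneous_X L l)).C_mul _

theorem coeff_quadPoly [DecidableEq κ] (a b : κ) :
    coeff (Finsupp.single a 1 + Finsupp.single b 1) (quadPoly S) =
      (if a = b then 1 else 2) * S s(a, b) := by
  have hX : ∀ k l : κ, coeff (Finsupp.single a 1 + Finsupp.single b 1)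
      (C (S s(k, l)) * (X k * X l) : MvPolynomial κ L) =
      if s(k, l) = s(a, b) then S s(a, b) else 0 := by
    intro k l
    rw [coeff_C_mul, X, X, monomial_mul, coeff_monomial, one_mul]
    simp only [single_add_single_eq_iff]
    split_ifs with h
    · rw [h, mul_one]
    · rw [mul_zero]
  simp only [quadPoly_apply, coeff_sum, hX]
  by_cases hab : a = b
  · subst hab
    have : ∀ k l, (if s(k, l) = s(a, a) then S s(a, a) else 0) =
        if k = a then if l = a then S s(a, a) else 0 else 0 := by
      intro k l
      simp only [Sym2.eq_iff, or_self]
      split_ifs <;> simp_all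
    simp only [this]
    rw [Finset.sum_eq_single a (fun k _ hk => by simp [hk]) (by simp),
      Finset.sum_eq_single a (fun k _ hk => by simp [hk]) (by simp)]
    simp
  · have : ∀ k l, (if s(k, l) = s(a, b) then S s(a, b) else 0) =
        (if k = a then if l = b then S s(a, b) else 0 else 0) +
        if k = b then if l = a then S s(a, b) else 0 else 0 := by
      intro k l
      simp only [Sym2.eq_iff]
      by_cases h1 : k = a
      · subst h1; by_cases h2 : l = b
        · subst h2; simp [hab]
        · simp [h2, hab]
      · by_cases h3 : k = b
        · subst h3; simp [h1]
        · simp [h1, h3]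
    simp only [this, Finset.sum_add_distrib]
    simp [hab]
    ring

theorem mem_quadricsThrough {ι : Type*} {N : ℕ} {v : ι → Fin N → L} {S : Sym2 (Fin N) → L} :
    quadPoly S ∈ quadricsThrough v ↔ ∀ i, polar S (v i) (v i) = 0 := by
  simp [quadricsThrough, mem_homogeneousSubmodule, quadPoly_isHomogeneous, aeval_quadPoly]

variable [CharZero L]

theorem quadPoly_injective : Function.Injective (quadPoly : (Sym2 κ → L) →ₗ[L] _) := by
  classical
  rw [injective_iff_map_eq_zero]
  intro S hS
  ext z
  induction z with
  | _ a b =>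
    have := coeff_quadPoly S a b
    rw [hS, coeff_zero, eq_comm, mul_eq_zero] at this
    refine this.resolve_left ?_
    split_ifs <;> norm_num

theorem range_quadPoly : LinearMap.range (quadPoly : (Sym2 κ → L) →ₗ[L] _) =
    homogeneousSubmodule κ L 2 := by
  classical
  apply le_antisymm
  · rintro _ ⟨S, rfl⟩
    exact quadPoly_isHomogeneous S
  · intro f hf
    refine ⟨Sym2.lift ⟨fun k l => (if k = l then 1 else 2)⁻¹ *
      coeff (Finsupp.single k 1 + Finsupp.single l 1) f, fun k l => by
        simp only [add_comm (Finsupp.single k 1), eq_comm (a := k)]⟩, ?_⟩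
    ext t
    by_cases ht : t.degree = 2
    · obtain ⟨k, l, rfl⟩ := exists_single_add_single ht
      rw [coeff_quadPoly, Sym2.lift_mk]
      simp only
      split_ifs <;> simp
    · rw [(quadPoly_isHomogeneous _).coeff_eq_zero ht, hf.coeff_eq_zero ht]

theorem exists_quadPoly_eq {ι : Type*} {N : ℕ} {v : ι → Fin N → L} {f : MvPolynomial (Fin N) L}
    (hf : f ∈ quadricsThrough v) : ∃ S, quadPoly S = f ∧ ∀ i, polar S (v i) (v i) = 0 := by
  obtain ⟨S, rfl⟩ : f ∈ LinearMap.range (quadPoly : (Sym2 (Fin N) → L) →ₗ[L] _) := by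
    rw [range_quadPoly]; exact hf.1
  exact ⟨S, rfl, mem_quadricsThrough.mp hf⟩

end quadPoly

section hilbert

variable {L : Type*} [Field L] [CharZero L] {n d : ℕ}

theorem hilbertFunction_two_add_coneRank (Γ : Fin d → ℙ L (Fin (n + 1) → L)) :
    coneRank (coordVec Γ) 0 + hilbertFunction Γ 2 = (n + 2).choose 2 := by
  let e : (Sym2 (Fin (n + 1)) → L) ≃ₗ[L] homogeneousSubmodule (Fin (n + 1)) L 2 :=
    (LinearEquiv.ofInjective quadPoly quadPoly_injective).trans
      (LinearEquiv.ofEq _ _ range_quadPoly)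
  let f := ((LinearMap.pi fun i : Fin d =>
      (aeval (Γ i).rep : MvPolynomial (Fin (n + 1)) L →ₐ[L] L).toLinearMap) ∘ₗ
        (homogeneousSubmodule (Fin (n + 1)) L 2).subtype)
  have h1 := (f ∘ₗ e.toLinearMap).finrank_range_add_finrank_ker
  rw [LinearMap.range_comp_of_range_eq_top _ (LinearEquiv.range e),
    Module.finrank_fintype_fun_eq_card, Sym2.card, Fintype.card_fin] at h1
  have h2 : LinearMap.ker (f ∘ₗ e.toLinearMap) = quadrics (coordVec Γ) (firstIndices d 0) ∅ ∅ := by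
    ext S
    have : ∀ i, (f ∘ₗ e.toLinearMap) S i = polar S (coordVec Γ i) (coordVec Γ i) := fun i =>
      aeval_quadPoly S _
    rw [LinearMap.mem_ker, mem_quadrics_empty, funext_iff]
    simp [this]
  rw [h2] at h1
  rw [add_comm]
  exact h1

end hilbert

/-! ### Leading monomials -/

section Leading

variable {L σ : Type*} [Field L] (o : MonomialOrder σ)

theorem MonomialOrder.degree_eq_of_forall_le {f : MvPolynomial σ L} {t : σ →₀ ℕ}
    (ht : coeff t f ≠ 0) (h : ∀ c, coeff c f ≠ 0 → o.toSyn c ≤ o.toSyn t) : o.degree f = t := by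
  apply o.toSyn.injective
  refine le_antisymm (o.degree_le_iff.mpr fun c hc => h c (mem_support_iff.mp hc)) ?_
  exact o.le_degree (mem_support_iff.mpr ht)

/-- The leading monomials of the nonzero elements of a space of polynomials. -/
def leadingExponents (V : Submodule L (MvPolynomial σ L)) : Set (σ →₀ ℕ) :=
  {t | ∃ f ∈ V, f ≠ 0 ∧ o.degree f = t}

/-- One element of V for each leading exponent gives a basis of V: distinct leading terms make the
family independent, and well-founded reduction of leading terms makes it span. -/
theorem finrank_span_leadingExponents (V : Submodule L (MvPolynomial σ L)) :
    Module.finrank L (Submodule.span L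
      ((fun t => monomial t (1 : L)) '' leadingExponents o V)) = Module.finrank L V := by
  classical
  choose! b hbV hb0 hbd using fun t (ht : t ∈ leadingExponents o V) => ht
  have hli : LinearIndependent L fun t : leadingExponents o V => b t := by
    rw [linearIndependent_iff']
    intro s g hg i hi
    by_contra hgi
    obtain ⟨t, ht, hmax⟩ := Finset.exists_max_image (s.filter fun t => g t ≠ 0)
      (fun t => o.toSyn (t : σ →₀ ℕ)) ⟨i, by simp [hi, hgi]⟩
    rw [Finset.mem_filter] at ht
    have h1 := congrArg (coeff (t : σ →₀ ℕ)) hg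
    rw [coeff_sum, Finset.sum_eq_single t, coeff_smul, coeff_zero, smul_eq_mul, mul_eq_zero] at h1
    · refine h1.elim ht.2 fun h2 => ?_
      have := o.coeff_degree_ne_zero_iff.mpr (hb0 _ t.2)
      rw [hbd _ t.2] at this
      exact this h2
    · intro u hu hut
      rw [coeff_smul]
      by_cases hgu : g u = 0
      · rw [hgu, zero_smul]
      · rw [o.coeff_eq_zero_of_lt, smul_zero]
        rw [hbd _ u.2]
        refine lt_of_le_of_ne (hmax u (by simp [hu, hgu])) fun h => hut ?_
        exact Subtype.ext (o.toSyn.injective h)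
    · exact fun h => absurd ht.1 h
  have hspan : Submodule.span L (Set.range fun t : leadingExponents o V => b t) = V := by
    apply le_antisymm
    · rw [Submodule.span_le]
      rintro _ ⟨t, rfl⟩
      exact hbV _ t.2
    · have key : ∀ s : o.syn, ∀ f ∈ V, o.toSyn (o.degree f) = s →
          f ∈ Submodule.span L (Set.range fun t : leadingExponents o V => b t) := by
        intro s
        induction s using WellFoundedLT.induction with
        | _ s ih =>
          intro f hf hs
          by_cases hf0 : f = 0
          · rw [hf0]; exact Submodule.zero_mem _
          have ht : o.degree f ∈ leadingExponents o V := ⟨f, hf, hf0, rfl⟩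
          set t := o.degree f with ht'
          set c := coeff t f / coeff t (b t) with hc
          have hbt : coeff t (b t) ≠ 0 := by
            have := o.coeff_degree_ne_zero_iff.mpr (hb0 _ ht)
            rwa [hbd _ ht] at this
          have hmem : b t ∈ Submodule.span L (Set.range fun t : leadingExponents o V => b t) :=
            Submodule.subset_span ⟨⟨t, ht⟩, rfl⟩
          have hsub : f - c • b t ∈
              Submodule.span L (Set.range fun t : leadingExponents o V => b t) := by
            by_cases h0 : f - c • b t = 0
            · rw [h0]; exact Submodule.zero_mem _
            refine ih _ ?_ _ (V.sub_mem hf (V.smul_mem _ (hbV _ ht))) rfl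
            rw [← hs]
            have h1 := o.coeff_degree_ne_zero_iff.mpr h0
            refine lt_of_le_of_ne ?_ fun h => ?_
            · rw [coeff_sub, coeff_smul] at h1
              by_cases h2 : coeff (o.degree (f - c • b t)) f = 0
              · have h3 : coeff (o.degree (f - c • b t)) (b t) ≠ 0 := by
                  intro h3; rw [h2, h3] at h1; simp at h1
                have := o.le_degree (mem_support_iff.mpr h3)
                rwa [hbd _ ht] at this
              · exact o.le_degree (mem_support_iff.mpr h2)
            · rw [o.toSyn.injective h, coeff_sub, coeff_smul, hc, smul_eq_mul,
                div_mul_cancel₀ _ hbt, sub_self] at h1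
              exact h1 rfl
          have := Submodule.add_mem _ hsub (Submodule.smul_mem _ c hmem)
          rwa [sub_add_cancel] at this
      exact fun f hf => key _ f hf rfl
  have hmon : LinearIndependent L fun t : leadingExponents o V => monomial (t : σ →₀ ℕ) (1 : L) := by
    have := (basisMonomials σ L).linearIndependent
    rw [coe_basisMonomials] at this
    exact this.comp _ Subtype.val_injective
  have h1 := Module.finrank_eq_nat_card_basis (Module.Basis.span hli)
  have h2 := Module.finrank_eq_nat_card_basis (Module.Basis.span hmon)
  rw [hspan] at h1
  rw [Set.image_eq_range, h1, h2]

end Leading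

theorem degLex_lt_of_support {N k : ℕ} {a b : Fin N →₀ ℕ} (hdeg : a.degree = b.degree)
    (ha : ∀ j : Fin N, (j : ℕ) < k → a j = 0) {i : Fin N} (hi : (i : ℕ) < k) (hb : b i ≠ 0) :
    MonomialOrder.degLex.toSyn a < MonomialOrder.degLex.toSyn b := by
  rw [MonomialOrder.degLex_lt_iff, Finsupp.DegLex.lt_iff]
  refine Or.inr ⟨hdeg, ?_⟩
  have hex : ∃ j : Fin N, b j ≠ 0 ∧ ∀ l < j, b l = 0 := by
    classical
    obtain ⟨j, hj, hmin⟩ := Finset.exists_min_image (Finset.univ.filter fun j => b j ≠ 0) id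
      ⟨i, by simpa using hb⟩
    simp only [Finset.mem_filter, Finset.mem_univ, true_and, id] at hj hmin
    exact ⟨j, hj, fun l hl => by_contra fun h => absurd (hmin l h) (not_le.mpr hl)⟩
  obtain ⟨j, hj, hmin⟩ := hex
  have hji : j ≤ i := not_lt.mp fun h => hb (hmin i h)
  have hjk : (j : ℕ) < k := lt_of_le_of_lt hji hi
  refine ⟨j, fun l hl => ?_, ?_⟩
  · have h1 := ha l (lt_trans hl hjk)
    have h2 := hmin l hl
    change a l = b l
    rw [h1, h2]
  · change a j < b j
    rw [ha j hjk]
    omega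

/-! ### The initial ideal in degree two -/

section InitialIdeal

variable {L : Type*} [Field L] {n d : ℕ} {Γ : Fin d → ℙ L (Fin (n + 1) → L)}

theorem initialIdeal_eq_span_image (I : Ideal (MvPolynomial (Fin (n + 1)) L)) :
    initialIdeal I = Ideal.span ((fun s => monomial s (1 : L)) ''
      {s | ∃ f ∈ I, f ≠ 0 ∧ MonomialOrder.degLex.degree f = s}) := by
  unfold initialIdeal
  congr 1
  ext p
  constructor
  · rintro ⟨f, hf, hf0, rfl⟩
    exact ⟨_, ⟨f, hf, hf0, rfl⟩, rfl⟩
  · rintro ⟨_, ⟨f, hf, hf0, rfl⟩, rfl⟩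
    exact ⟨f, hf, hf0, rfl⟩

theorem monomial_mem_initialIdeal_iff {I : Ideal (MvPolynomial (Fin (n + 1)) L)}
    {t : Fin (n + 1) →₀ ℕ} : monomial t 1 ∈ initialIdeal I ↔
      ∃ f ∈ I, f ≠ 0 ∧ MonomialOrder.degLex.degree f = t := by
  constructor
  · intro h
    rw [initialIdeal_eq_span_image, mem_ideal_span_monomial_image] at h
    obtain ⟨_, ⟨f, hf, hf0, rfl⟩, hle⟩ := h t (by simp)
    have h1 : (monomial (t - MonomialOrder.degLex.degree f) (1 : L)) ≠ 0 := by simp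
    refine ⟨monomial (t - MonomialOrder.degLex.degree f) 1 * f, I.mul_mem_left _ hf,
      mul_ne_zero h1 hf0, ?_⟩
    classical
    rw [MonomialOrder.degree_mul h1 hf0, MonomialOrder.degree_monomial, if_neg one_ne_zero,
      tsub_add_cancel_of_le hle]
  · rintro ⟨f, hf, hf0, rfl⟩
    exact Ideal.subset_span ⟨f, hf, hf0, rfl⟩

theorem homogeneousComponent_mem_homogeneousIdeal {f : MvPolynomial (Fin (n + 1)) L}
    (hf : f ∈ homogeneousIdeal Γ) (l : ℕ) : homogeneousComponent l f ∈ homogeneousIdeal Γ := by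
  let : GradedAlgebra (homogeneousSubmodule (Fin (n + 1)) L) := MvPolynomial.gradedAlgebra
  have h : (homogeneousIdeal Γ).IsHomogeneous (homogeneousSubmodule (Fin (n + 1)) L) :=
    Ideal.homogeneous_span (homogeneousSubmodule (Fin (n + 1)) L) _ fun f hf => hf.1
  have := h l hf
  rwa [← decomposition.decompose'_apply]

theorem eval_eq_zero_of_mem_homogeneousIdeal {f : MvPolynomial (Fin (n + 1)) L}
    (hf : f ∈ homogeneousIdeal Γ) (i : Fin d) : eval (coordVec Γ i) f = 0 := by
  have : homogeneousIdeal Γ ≤ RingHom.ker (eval (coordVec Γ i)) :=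
    Ideal.span_le.mpr fun f hf => hf.2 i
  exact this hf

/-- The ideal is homogeneous, so the degree-two component of an element with leading exponent t
remains in it and keeps that leading term. -/
theorem monomial_mem_initialIdeal_homogeneousIdeal_iff {t : Fin (n + 1) →₀ ℕ}
    (ht : t.degree = 2) : monomial t 1 ∈ initialIdeal (homogeneousIdeal Γ) ↔
      ∃ f ∈ quadricsThrough (coordVec Γ), f ≠ 0 ∧ MonomialOrder.degLex.degree f = t := by
  rw [monomial_mem_initialIdeal_iff]
  constructor
  · rintro ⟨f, hf, hf0, hft⟩
    have hc : coeff t (homogeneousComponent 2 f) ≠ 0 := by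
      rw [coeff_homogeneousComponent, if_pos ht, ← hft]
      exact MonomialOrder.degLex.coeff_degree_ne_zero_iff.mpr hf0
    refine ⟨homogeneousComponent 2 f, ⟨homogeneousComponent_mem 2 f, ?_⟩, ?_, ?_⟩
    · simp only [Submodule.mem_iInf, LinearMap.mem_ker, AlgHom.toLinearMap_apply, SetLike.mem_coe]
      intro i
      rw [aeval_eq_eval]
      exact eval_eq_zero_of_mem_homogeneousIdeal (homogeneousComponent_mem_homogeneousIdeal hf 2) i
    · intro h; rw [h] at hc; exact hc (coeff_zero _)
    · refine MonomialOrder.degree_eq_of_forall_le _ hc fun c hc' => ?_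
      rw [coeff_homogeneousComponent] at hc'
      rw [← hft]
      exact MonomialOrder.degLex.le_degree (mem_support_iff.mpr fun h => hc' (by simp [h]))
  · rintro ⟨f, hf, hf0, hft⟩
    refine ⟨f, Ideal.subset_span ⟨⟨2, hf.1⟩, fun i => ?_⟩, hf0, hft⟩
    have := hf.2
    simp only [Submodule.mem_iInf, LinearMap.mem_ker, AlgHom.toLinearMap_apply,
      SetLike.mem_coe] at this
    rw [← aeval_eq_eval]
    exact this i

theorem X_mul_X_eq (a b : Fin (n + 1)) : (X a * X b : MvPolynomial (Fin (n + 1)) L) =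
    monomial (Finsupp.single a 1 + Finsupp.single b 1) 1 := by
  rw [X, X, monomial_mul, one_mul]

variable [CharZero L]

theorem coeff_quadPoly_ne_zero {S : Sym2 (Fin (n + 1)) → L} {a b : Fin (n + 1)} :
    coeff (Finsupp.single a 1 + Finsupp.single b 1) (quadPoly S) ≠ 0 ↔ S s(a, b) ≠ 0 := by
  rw [coeff_quadPoly, mul_ne_zero_iff]
  refine and_iff_right ?_
  split_ifs <;> norm_num

/-- A quadric without monomials `x_i x_j`, `i < k`, in its leading term has none at all. -/
theorem eq_zero_of_lt_leading {S : Sym2 (Fin (n + 1)) → L} {k : ℕ} {t : Fin (n + 1) →₀ ℕ}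
    (ht : MonomialOrder.degLex.degree (quadPoly S) = t) (htd : t.degree = 2)
    (htk : ∀ j : Fin (n + 1), (j : ℕ) < k → t j = 0) {i : Fin (n + 1)} (hi : (i : ℕ) < k)
    (l : Fin (n + 1)) : S s(i, l) = 0 := by
  by_contra h
  have h1 := MonomialOrder.degLex.le_degree (mem_support_iff.mpr (coeff_quadPoly_ne_zero.mpr h))
  rw [ht] at h1
  refine absurd h1 (not_le.mpr (degLex_lt_of_support (i := i) ?_ htk hi ?_))
  · rw [htd, map_add, Finsupp.degree_single, Finsupp.degree_single]
  · simp

/-- If the leading monomial avoids x_0, ..., x_{k-1}, so does the whole quadric by the lexicographic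
order, which makes it a cone with vertices p_0, ..., p_{k-1}. Hence these monomials are counted by
the cone dimension. -/
theorem finrank_initialQuadricsFrom (hv : SymmetricFrame (coordVec Γ)) {k : ℕ} (hk : k ≤ n) :
    Module.finrank L (initialQuadricsFrom (homogeneousIdeal Γ) k) = coneRank (coordVec Γ) k := by
  classical
  set V := (quadrics (coordVec Γ) (firstIndices d k) ∅ ∅).map
    (quadPoly : (Sym2 (Fin (n + 1)) → L) →ₗ[L] _) with hV
  have h1 : Module.finrank L V = coneRank (coordVec Γ) k :=
    (Submodule.equivMapOfInjective quadPoly quadPoly_injective _).finrank_eq.symm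
  rw [← h1, ← finrank_span_leadingExponents MonomialOrder.degLex V]
  suffices initialQuadricsFrom (homogeneousIdeal Γ) k = Submodule.span L
      ((fun t => monomial t (1 : L)) '' leadingExponents MonomialOrder.degLex V) by rw [this]
  apply le_antisymm
  · intro p hp
    obtain ⟨⟨hp1, hp2⟩, hp3⟩ := hp
    rw [p.as_sum]
    refine Submodule.sum_mem _ fun t ht => ?_
    have ht2 : t.degree = 2 := by
      by_contra h
      exact (mem_support_iff.mp ht) (IsHomogeneous.coeff_eq_zero hp2 h)
    have htk : ∀ j : Fin (n + 1), (j : ℕ) < k → t j = 0 := by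
      intro j hj
      by_contra h
      have h2 := (mem_supported.mp hp3)
        (mem_vars_iff_mem_support j |>.mpr ⟨t, ht, Finsupp.mem_support_iff.mpr h⟩)
      exact absurd h2 (not_le.mpr hj)
    have hmem : monomial t 1 ∈ initialIdeal (homogeneousIdeal Γ) := by
      have hp1' : p ∈ initialIdeal (homogeneousIdeal Γ) := hp1
      rw [initialIdeal_eq_span_image, mem_ideal_span_monomial_image] at hp1' ⊢
      intro s hs
      have : s = t := by simpa using support_monomial_subset hs
      rw [this]
      exact hp1' t ht
    obtain ⟨f, hf, hf0, hft⟩ := (monomial_mem_initialIdeal_homogeneousIdeal_iff ht2).mp hmem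
    obtain ⟨S, rfl, hS⟩ := exists_quadPoly_eq hf
    have hSV : S ∈ quadrics (coordVec Γ) (firstIndices d k) ∅ ∅ := by
      refine mem_quadrics_empty.mpr ⟨hS, fun i hi => ?_⟩
      rw [mem_firstIndices] at hi
      exact (hv.polar_vert_left S ⟨i, by omega⟩).mpr (eq_zero_of_lt_leading hft ht2 htk hi)
    have h3 : monomial t (coeff t p) = coeff t p • monomial t (1 : L) := by
      rw [smul_monomial, smul_eq_mul, mul_one]
    rw [h3]
    exact Submodule.smul_mem _ _
      (Submodule.subset_span ⟨t, ⟨quadPoly S, ⟨S, hSV, rfl⟩, hf0, hft⟩, rfl⟩)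
  · rw [Submodule.span_le]
    rintro _ ⟨t, ⟨_, ⟨S, hS, rfl⟩, hf0, hft⟩, rfl⟩
    have hSV := mem_quadrics_empty.mp hS
    have hct := MonomialOrder.degLex.coeff_degree_ne_zero_iff.mpr hf0
    rw [hft] at hct
    have ht2 : t.degree = 2 := by
      by_contra h
      exact hct ((quadPoly_isHomogeneous S).coeff_eq_zero h)
    refine ⟨⟨(monomial_mem_initialIdeal_homogeneousIdeal_iff ht2).mpr
      ⟨_, mem_quadricsThrough.mpr hSV.1, hf0, hft⟩, isHomogeneous_monomial _ ht2⟩, ?_⟩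
    obtain ⟨a, b, rfl⟩ := exists_single_add_single ht2
    rw [coeff_quadPoly_ne_zero] at hct
    have hrow : ∀ i : Fin (n + 1), (i : ℕ) < k → ∀ l, S s(i, l) = 0 := fun i hi =>
      (hv.polar_vert_left S i).mp (hSV.2 _ (by simpa using hi))
    refine mem_supported.mpr fun j hj => ?_
    have hj' : j = a ∨ j = b := by
      have h2 := vars_monomial (s := Finsupp.single a 1 + Finsupp.single b 1) (one_ne_zero (α := L))
      rw [h2] at hj
      have h3 := Finsupp.support_add hj
      simpa using (Finset.mem_union.mp h3).imp (fun h => Finsupp.support_single_subset h)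
        (fun h => Finsupp.support_single_subset h)
    by_contra hjk
    have hjk' : (j : ℕ) < k := not_le.mp hjk
    rcases hj' with rfl | rfl
    · exact hct (hrow _ hjk' _)
    · exact hct (by rw [Sym2.eq_swap]; exact hrow _ hjk' _)

/-- A quadric with this leading term would be singular at the first i points, with no x_i x_j for i
< j < n. These n - i - 1 coefficients are at least as many as the matroid rank, so they force the
coefficient of x_i x_n to vanish. For i = n the monomial x_n² is excluded by p_n. -/
theorem X_mul_X_last_notMem (hv : SymmetricFrame (coordVec Γ)) {i : Fin (n + 1)}
    (hr : (i : ℕ) < n → coneRank (coordVec Γ) i - coneRank (coordVec Γ) (i + 1) < n - i) :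
    (X i * X (Fin.last n) : MvPolynomial (Fin (n + 1)) L) ∉ initialIdeal (homogeneousIdeal Γ) := by
  rw [X_mul_X_eq, monomial_mem_initialIdeal_homogeneousIdeal_iff
    (by rw [map_add, Finsupp.degree_single, Finsupp.degree_single])]
  rintro ⟨f, hf, hf0, hft⟩
  obtain ⟨S, rfl, hS⟩ := exists_quadPoly_eq hf
  have hct := MonomialOrder.degLex.coeff_degree_ne_zero_iff.mpr hf0
  rw [hft, coeff_quadPoly_ne_zero] at hct
  rcases (Fin.le_last i).lt_or_eq with hi | rfl
  · have hin : (i : ℕ) < n := hi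
    have hr := hr hin
    have hS1 : ∀ j : Fin (n + 1), (j : ℕ) < i → ∀ l, S s(j, l) = 0 := by
      intro j hj
      refine eq_zero_of_lt_leading hft
        (by rw [map_add, Finsupp.degree_single, Finsupp.degree_single]) (fun l hl => ?_) hj
      have h1 : i ≠ l := fun h => by rw [h] at hl; exact lt_irrefl _ hl
      have h2 : Fin.last n ≠ l := fun h => by
        rw [← h] at hl; simp at hl; omega
      simp [h1, h2]
    have hS2 : ∀ b : Fin (n + 1), i < b → b < Fin.last n → S s(i, b) = 0 := by
      intro b _ hb
      by_contra h
      have h1 := MonomialOrder.degLex.le_degree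
        (mem_support_iff.mpr (coeff_quadPoly_ne_zero.mpr h))
      rw [hft, map_add, map_add] at h1
      exact absurd (le_of_add_le_add_left h1)
        (not_le.mpr (MonomialOrder.degLex_single_lt_iff.mpr hb))
    have h1 := hv.finrank_rowQuadrics i (T := Finset.Ioo i (Fin.last n))
      (fun j hj => (Finset.mem_Ioo.mp hj).1)
    have h2 := hv.finrank_rowQuadrics i (T := Finset.Ioi i) (fun j hj => Finset.mem_Ioi.mp hj)
    rw [Fin.card_Ioo, Fin.val_last] at h1
    rw [Fin.card_Ioi] at h2
    rw [Nat.min_eq_right (by omega)] at h1 h2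
    have h3 : quadrics (coordVec Γ) (firstIndices d i) {Fin.castLE hv.lt i}
        ((Finset.Ioi i).map (Fin.castLEEmb hv.lt)) =
        quadrics (coordVec Γ) (firstIndices d i) {Fin.castLE hv.lt i}
        ((Finset.Ioo i (Fin.last n)).map (Fin.castLEEmb hv.lt)) := by
      refine Submodule.eq_of_le_of_finrank_eq (fun T hT => ?_) (h2.trans h1.symm)
      rw [mem_quadrics] at hT ⊢
      refine ⟨hT.1, hT.2.1, fun l hl j hj => hT.2.2 l hl j ?_⟩
      obtain ⟨j', hj', rfl⟩ := Finset.mem_map.mp hj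
      exact Finset.mem_map.mpr ⟨j', Finset.mem_Ioi.mpr (Finset.mem_Ioo.mp hj').1, rfl⟩
    have h4 : S ∈ quadrics (coordVec Γ) (firstIndices d i) {Fin.castLE hv.lt i}
        ((Finset.Ioo i (Fin.last n)).map (Fin.castLEEmb hv.lt)) := by
      refine mem_quadrics.mpr ⟨hS, fun l hl => ?_, fun l hl j hj => ?_⟩
      · rw [mem_firstIndices] at hl
        exact (hv.polar_vert_left S ⟨l, by omega⟩).mpr (hS1 _ hl)
      · obtain ⟨j', hj', rfl⟩ := Finset.mem_map.mp hj
        rw [Finset.mem_singleton.mp hl]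
        exact (hv.polar_vert S i j').mpr
          (hS2 j' (Finset.mem_Ioo.mp hj').1 (Finset.mem_Ioo.mp hj').2)
    rw [← h3, mem_quadrics] at h4
    exact hct ((hv.polar_vert S i (Fin.last n)).mp (h4.2.2 _ (Finset.mem_singleton_self _) _
      (Finset.mem_map.mpr ⟨Fin.last n, Finset.mem_Ioi.mpr hi, rfl⟩)))
  · exact hct ((hv.polar_vert S _ _).mp (hS _))

/-- All n coefficients of x_0 x_j, j > 0, are independent here, so some quadric through Γ has x_0
x_n as its only monomial involving x_0. -/
theorem X_zero_mul_X_last_mem (hv : SymmetricFrame (coordVec Γ)) (hn : 1 ≤ n)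
    (hr : n ≤ coneRank (coordVec Γ) 0 - coneRank (coordVec Γ) 1) :
    (X 0 * X (Fin.last n) : MvPolynomial (Fin (n + 1)) L) ∈ initialIdeal (homogeneousIdeal Γ) := by
  rw [X_mul_X_eq, monomial_mem_initialIdeal_homogeneousIdeal_iff
    (by rw [map_add, Finsupp.degree_single, Finsupp.degree_single])]
  have h1 := hv.finrank_rowQuadrics 0 (T := Finset.Ioo 0 (Fin.last n))
    (fun j hj => (Finset.mem_Ioo.mp hj).1)
  have h2 := hv.finrank_rowQuadrics 0 (T := Finset.Ioi 0) (fun j hj => Finset.mem_Ioi.mp hj)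
  rw [Fin.card_Ioo, Fin.val_last, Fin.val_zero] at h1
  rw [Fin.card_Ioi, Fin.val_zero] at h2
  rw [zero_add, Nat.min_eq_left (by omega)] at h1 h2
  obtain ⟨S, hS, hS'⟩ : ∃ S ∈ quadrics (coordVec Γ) (firstIndices d 0) {Fin.castLE hv.lt 0}
      ((Finset.Ioo 0 (Fin.last n)).map (Fin.castLEEmb hv.lt)),
      S ∉ quadrics (coordVec Γ) (firstIndices d 0) {Fin.castLE hv.lt 0}
      ((Finset.Ioi 0).map (Fin.castLEEmb hv.lt)) := by
    by_contra! h
    have h3 := Submodule.finrank_mono (show _ ≤ _ from h)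
    omega
  rw [mem_quadrics] at hS hS'
  have h3 : ∀ b : Fin (n + 1), b ≠ Fin.last n → S s(0, b) = 0 := by
    intro b hb
    refine (hv.polar_vert S 0 b).mp ?_
    rcases eq_or_ne b 0 with rfl | hb0
    · exact hS.1 _
    · exact hS.2.2 _ (Finset.mem_singleton_self _) _ (Finset.mem_map.mpr ⟨b, Finset.mem_Ioo.mpr
        ⟨Fin.pos_iff_ne_zero.mpr hb0, lt_of_le_of_ne (Fin.le_last b) hb⟩, rfl⟩)
  have h4 : S s(0, Fin.last n) ≠ 0 := by
    intro h
    refine hS' ⟨hS.1, hS.2.1, fun l hl j hj => ?_⟩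
    obtain ⟨j', hj', rfl⟩ := Finset.mem_map.mp hj
    rw [Finset.mem_singleton.mp hl]
    refine (hv.polar_vert S 0 j').mpr ?_
    rcases eq_or_ne j' (Fin.last n) with rfl | hj''
    exacts [h, h3 _ hj'']
  have h5 := coeff_quadPoly_ne_zero.mpr h4
  refine ⟨quadPoly S, mem_quadricsThrough.mpr hS.1, fun h => ?_,
    MonomialOrder.degree_eq_of_forall_le _ h5 fun c hc => ?_⟩
  · rw [h] at h5
    exact h5 (coeff_zero _)
  · have hc2 : c.degree = 2 := by
      by_contra h
      exact hc ((quadPoly_isHomogeneous S).coeff_eq_zero h)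
    obtain ⟨a, b, rfl⟩ := exists_single_add_single hc2
    rw [coeff_quadPoly_ne_zero] at hc
    by_cases ha : a = 0
    · subst ha
      rw [show b = Fin.last n from by_contra fun h => hc (h3 b h)]
    · by_cases hb : b = 0
      · subst hb
        rw [Sym2.eq_swap] at hc
        rw [show a = Fin.last n from by_contra fun h => hc (h3 a h)]
        exact (congrArg _ (add_comm _ _)).le
      · refine (degLex_lt_of_support (k := 1) (i := 0) ?_ (fun j hj => ?_) one_pos ?_).le
        · rw [hc2, map_add, Finsupp.degree_single, Finsupp.degree_single]
        · obtain rfl : j = 0 := Fin.ext (by simpa using hj)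
          simp [ha, hb]
        · simp

end InitialIdeal

/-! ### Zariski tangent spaces -/

section Gradient

variable {L κ : Type*} [Field L] (a : κ → L)

theorem X_sub_C_mem_ker_eval (k : κ) : X k - C (a k) ∈ RingHom.ker (eval a) := by
  simp [RingHom.mem_ker]

/-- The polyGradient of a polynomial at a point. -/
def polyGradient : MvPolynomial κ L →ₗ[L] (κ → L) :=
  LinearMap.pi fun k => (aeval a : MvPolynomial κ L →ₐ[L] L).toLinearMap ∘ₗ
    (pderiv k : Derivation L (MvPolynomial κ L) (MvPolynomial κ L)).toLinearMap

theorem polyGradient_apply (f : MvPolynomial κ L) (k : κ) :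
    polyGradient a f k = eval a (pderiv k f) := by
  simp [polyGradient, aeval_eq_eval]

theorem polyGradient_mul (f g : MvPolynomial κ L) :
    polyGradient a (f * g) = eval a f • polyGradient a g + eval a g • polyGradient a f := by
  ext k
  simp [polyGradient_apply, Derivation.leibniz]

theorem polyGradient_X_sub_C [DecidableEq κ] (j : κ) (c : L) :
    polyGradient a (X j - C c) = Pi.single j 1 := by
  ext k
  simp only [polyGradient_apply, map_sub, pderiv_C, sub_zero]
  rw [pderiv_X]
  by_cases h : k = j
  · subst h; simp
  · simp [h, Ne.symm h]

theorem map_gradient_span {G : Set (MvPolynomial κ L)} (hG : G ⊆ RingHom.ker (eval a)) :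
    ((Ideal.span G).restrictScalars L).map (polyGradient a) =
      Submodule.span L (polyGradient a '' G) := by
  apply le_antisymm
  · rintro _ ⟨f, hf, rfl⟩
    refine Submodule.span_induction (fun x hx => Submodule.subset_span ⟨x, hx, rfl⟩) ?_
      (fun x y _ _ hx hy => ?_) (fun b x hx h => ?_) (show f ∈ Submodule.span _ G from hf)
    · rw [map_zero]; exact Submodule.zero_mem _
    · rw [map_add]; exact Submodule.add_mem _ hx hy
    · have hx' : eval a x = 0 := RingHom.mem_ker.mp (Ideal.span_le.mpr hG hx)
      rw [smul_eq_mul, polyGradient_mul, hx', zero_smul, add_zero]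
      exact Submodule.smul_mem _ _ h
  · rw [Submodule.span_le]
    rintro _ ⟨f, hf, rfl⟩
    exact ⟨f, Ideal.subset_span hf, rfl⟩

variable [Fintype κ]

/-- First-order Taylor expansion at the point; it identifies the square of the maximal ideal with
the functions whose value and gradient vanish. -/
theorem taylor_mem_ker_eval_sq (f : MvPolynomial κ L) :
    f - C (eval a f) - ∑ k, C (polyGradient a f k) * (X k - C (a k)) ∈ RingHom.ker (eval a) ^ 2 := by
  classical
  induction f using MvPolynomial.induction_on with
  | C c => simp [polyGradient_apply]
  | add f g hf hg =>
    convert Ideal.add_mem _ hf hg using 1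
    simp only [map_add, Pi.add_apply, add_mul, Finset.sum_add_distrib]
    ring
  | mul_X f j hf =>
    have hl : ∑ k, C (polyGradient a f k) * (X k - C (a k)) ∈ RingHom.ker (eval a) :=
      Ideal.sum_mem _ fun k _ => Ideal.mul_mem_left _ _ (X_sub_C_mem_ker_eval a k)
    have h1 := Ideal.mul_mem_mul hl (X_sub_C_mem_ker_eval a j)
    rw [← pow_two] at h1
    have hX : polyGradient a (X j) = Pi.single j 1 := by
      have := polyGradient_X_sub_C a j 0
      rwa [map_zero, sub_zero] at this
    have h2 : ∑ k, C (polyGradient a (f * X j) k) * (X k - C (a k)) =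
        C (eval a f) * (X j - C (a j)) +
          C (a j) * ∑ k, C (polyGradient a f k) * (X k - C (a k)) := by
      rw [polyGradient_mul, hX]
      simp only [Pi.add_apply, Pi.smul_apply, smul_eq_mul, map_add, map_mul, add_mul,
        Finset.sum_add_distrib, Finset.mul_sum, eval_X, mul_assoc]
      congr 1
      rw [Finset.sum_eq_single j] <;> simp +contextual
    rw [h2]
    convert Ideal.add_mem _ (Ideal.mul_mem_right (X j) _ hf) h1 using 1
    simp only [map_mul, eval_X]
    ring

theorem mem_ker_eval_sq_iff {f : MvPolynomial κ L} (hf : f ∈ RingHom.ker (eval a)) :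
    f ∈ RingHom.ker (eval a) ^ 2 ↔ polyGradient a f = 0 := by
  constructor
  · intro h
    rw [pow_two] at h
    refine Submodule.mul_induction_on h (fun x hx y hy => ?_) fun x y hx hy => ?_
    · rw [polyGradient_mul, RingHom.mem_ker.mp hx, RingHom.mem_ker.mp hy]
      simp
    · rw [map_add, hx, hy, add_zero]
  · intro h
    have := taylor_mem_ker_eval_sq a f
    rw [h, RingHom.mem_ker.mp hf] at this
    simpa using this

/-- The cotangent space of the subscheme defined by the equations `G` at a rational point. -/
theorem finrank_cotangent_add {G : Set (MvPolynomial κ L)} (hG : G ⊆ RingHom.ker (eval a)) :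
    Module.finrank L ((RingHom.ker (eval a)).map (Ideal.Quotient.mk (Ideal.span G))).Cotangent +
      Module.finrank L (Submodule.span L (polyGradient a '' G)) = Fintype.card κ := by
  classical
  set M := RingHom.ker (eval a) with hM
  set J := Ideal.span G with hJ
  have hJM : J ≤ M := Ideal.span_le.mpr hG
  set W := Submodule.span L (polyGradient a '' G) with hW
  let φ : M.restrictScalars L →ₗ[L] (M.map (Ideal.Quotient.mk J)).Cotangent :=
    { toFun := fun f => (M.map (Ideal.Quotient.mk J)).toCotangent
        ⟨Ideal.Quotient.mk J f.1, Ideal.mem_map_of_mem _ f.2⟩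
      map_add' := fun f g => by rw [← map_add]; rfl
      map_smul' := fun c f => by
        rw [RingHom.id_apply, ← algebraMap_smul (MvPolynomial κ L ⧸ J) c ((M.map
          (Ideal.Quotient.mk J)).toCotangent _), ← LinearMap.map_smul]
        refine congrArg _ (Subtype.ext ?_)
        change Ideal.Quotient.mk J (c • f.1) = algebraMap L (MvPolynomial κ L ⧸ J) c * _
        rw [Algebra.smul_def, map_mul]
        rfl }
  let ψ : M.restrictScalars L →ₗ[L] (κ → L) ⧸ W :=
    W.mkQ ∘ₗ polyGradient a ∘ₗ (M.restrictScalars L).subtype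
  have hφ : Function.Surjective φ := by
    intro y
    obtain ⟨⟨y, hy⟩, rfl⟩ := Ideal.toCotangent_surjective _ y
    obtain ⟨f, hf, rfl⟩ := (Ideal.mem_map_iff_of_surjective _ Ideal.Quotient.mk_surjective).mp hy
    exact ⟨⟨f, hf⟩, rfl⟩
  have hψ : Function.Surjective ψ := by
    intro y
    obtain ⟨u, rfl⟩ := W.mkQ_surjective y
    refine ⟨⟨∑ k, C (u k) * (X k - C (a k)),
      Ideal.sum_mem _ fun k _ => Ideal.mul_mem_left _ _ (X_sub_C_mem_ker_eval a k)⟩, ?_⟩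
    change W.mkQ (polyGradient a (∑ k, C (u k) * (X k - C (a k)))) = W.mkQ u
    congr 1
    rw [map_sum]
    calc _ = ∑ k, Pi.single k (u k) := by
          refine Finset.sum_congr rfl fun k _ => ?_
          rw [← smul_eq_C_mul, map_smul, polyGradient_X_sub_C, ← Pi.single_smul, smul_eq_mul,
            mul_one]
      _ = u := Finset.univ_sum_single u
  -- A function f in M dies in the cotangent space of the quotient iff f ∈ M² + J, that is, iff its
  -- gradient lies in the span of the gradients of G. The cotangent space is thus `κ → L` modulo
  -- that span.
  have hker : LinearMap.ker φ = LinearMap.ker ψ := by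
    ext ⟨f, hf⟩
    have hf' : f ∈ M := hf
    rw [LinearMap.mem_ker, LinearMap.mem_ker]
    change Ideal.toCotangent _ _ = 0 ↔ W.mkQ (polyGradient a f) = 0
    rw [Ideal.toCotangent_eq_zero, Submodule.mkQ_apply, Submodule.Quotient.mk_eq_zero, hW,
      ← map_gradient_span a hG, ← Ideal.map_pow,
      Ideal.mem_map_iff_of_surjective _ Ideal.Quotient.mk_surjective]
    constructor
    · rintro ⟨x, hx, hxf⟩
      have h1 : f - x ∈ J := Ideal.Quotient.eq.mp hxf.symm
      refine ⟨f - x, h1, ?_⟩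
      rw [map_sub, (mem_ker_eval_sq_iff a (Ideal.pow_le_self two_ne_zero hx)).mp hx, sub_zero]
    · rintro ⟨x, hx, hxf⟩
      refine ⟨f - x, (mem_ker_eval_sq_iff a (M.sub_mem hf' (hJM hx))).mpr ?_,
        Ideal.Quotient.eq.mpr ?_⟩
      · rw [map_sub, hxf, sub_self]
      · rw [sub_sub_cancel_left]
        exact J.neg_mem hx
  have h1 := (φ.quotKerEquivOfSurjective hφ).finrank_eq
  have h2 := (ψ.quotKerEquivOfSurjective hψ).finrank_eq
  rw [hker] at h1
  rw [← h1, h2, Submodule.finrank_quotient_add_finrank, Module.finrank_fintype_fun_eq_card]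

theorem polyGradient_quadPoly [DecidableEq κ] (S : Sym2 κ → L) (k : κ) :
    polyGradient a (quadPoly S) k = 2 * polar S (Pi.single k 1) a := by
  have h : ∀ i j : κ, eval a (pderiv k (C (S s(i, j)) * (X i * X j))) =
      S s(i, j) * ((Pi.single k 1 : κ → L) i * a j) +
        S s(i, j) * (a i * (Pi.single k 1 : κ → L) j) := by
    intro i j
    simp only [Derivation.leibniz, pderiv_C, pderiv_X, smul_eq_mul, mul_zero, add_zero, map_mul,
      map_add, eval_C, eval_X]
    have : ∀ l : κ, eval a ((Pi.single k 1 : κ → MvPolynomial κ L) l) =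
        (Pi.single k 1 : κ → L) l := fun l => by
      by_cases hl : l = k
      · subst hl; simp
      · simp [hl]
    simp only [this]
    ring
  rw [polyGradient_apply, quadPoly_apply, map_sum, map_sum]
  simp only [map_sum, h, Finset.sum_add_distrib]
  rw [two_mul]
  nth_rewrite 2 [polar_comm]
  rfl

end Gradient

theorem SymmetricFrame.forall_polar_iff {L : Type*} [Field L] {n d : ℕ}
    {v : Fin d → Fin (n + 1) → L} (hv : SymmetricFrame v)
    (S : Sym2 (Fin (n + 1)) → L) (u : Fin (n + 1) → L) :
    (∀ j, polar S u (v j) = 0) ↔ ∀ k, polar S (Pi.single k 1) u = 0 := by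
  constructor
  · intro h k
    obtain ⟨c, hc, hk⟩ := hv.vert k
    have h1 := h (Fin.castLE hv.lt k)
    have h2 : (Pi.single k c : Fin (n + 1) → L) = c • Pi.single k 1 := by
      rw [← Pi.single_smul, smul_eq_mul, mul_one]
    rw [hk, h2, polar_smul_right, polar_comm] at h1
    exact (mul_eq_zero.mp h1).resolve_left hc
  · intro h j
    have h2 : v j = ∑ k, v j k • Pi.single k 1 := by
      rw [← Finset.univ_sum_single (v j)]
      refine Finset.sum_congr rfl fun k _ => ?_
      rw [← Pi.single_smul, smul_eq_mul, mul_one, Finset.univ_sum_single]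
    rw [h2, polar_sum_right]
    refine Finset.sum_eq_zero fun k _ => ?_
    rw [polar_smul_right, polar_comm, h k, mul_zero]

section WeakConjecture

variable {L : Type*} [Field L] [CharZero L] {n d : ℕ} {Γ : Fin d → ℙ L (Fin (n + 1) → L)}

/-- The gradient of a quadric at p_i vanishes exactly when the quadric is singular there, so the
gradients span w_0 - w_1 dimensions; the chart equation x_j = 1 contributes one more. -/
theorem finrank_baseLocusTangentSpace_add (hv : SymmetricFrame (coordVec Γ)) (i : Fin d)
    (j : Fin (n + 1)) (hj : (Γ i).rep j ≠ 0) :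
    Module.finrank L (BaseLocusTangentSpace (quadricsThrough (coordVec Γ) : Set _) j (Γ i)) +
      coneRank (coordVec Γ) 0 = n + coneRank (coordVec Γ) 1 := by
  classical
  set c := (Γ i).rep j with hc
  set a : Fin (n + 1) → L := fun k => (Γ i).rep k / c with ha
  have hav : a = c⁻¹ • coordVec Γ i := by
    ext k; simp [ha, coordVec, div_eq_inv_mul]
  have haj : a j = 1 := div_self hj
  let D : (Sym2 (Fin (n + 1)) → L) →ₗ[L] (Fin (n + 1) → L) := polyGradient a ∘ₗ quadPoly
  have hD : ∀ S, D S = 0 ↔ ∀ l, polar S (coordVec Γ i) (coordVec Γ l) = 0 := by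
    intro S
    rw [hv.forall_polar_iff, _root_.funext_iff]
    refine forall_congr' fun k => ?_
    change polyGradient a (quadPoly S) k = 0 ↔ _
    rw [polyGradient_quadPoly, hav, polar_smul_right]
    simp [hj]
  set A := quadrics (coordVec Γ) ∅ ∅ ∅ with hA
  have hmemA : ∀ S, S ∈ A ↔ ∀ l, polar S (coordVec Γ l) (coordVec Γ l) = 0 := fun S => by
    rw [hA, mem_quadrics_empty]; simp
  have hG : (quadricsThrough (coordVec Γ) : Set (MvPolynomial (Fin (n + 1)) L)) ∪ {X j - 1} ⊆
      RingHom.ker (eval a) := by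
    rintro f (hf | rfl)
    · obtain ⟨S, rfl, hS⟩ := exists_quadPoly_eq hf
      change quadPoly S ∈ RingHom.ker (eval a)
      rw [RingHom.mem_ker, ← aeval_eq_eval, aeval_quadPoly, hav, polar_smul_left,
        polar_smul_right, hS]
      simp
    · change _ ∈ RingHom.ker (eval a)
      simp [RingHom.mem_ker, haj]
  have hspan : Submodule.span L (polyGradient a '' ((quadricsThrough (coordVec Γ) :
      Set (MvPolynomial (Fin (n + 1)) L)) ∪ {X j - 1})) =
      A.map D ⊔ Submodule.span L {Pi.single j 1} := by
    have h1 : polyGradient a ''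
        (quadricsThrough (coordVec Γ) : Set (MvPolynomial (Fin (n + 1)) L)) =
        (A.map D : Set (Fin (n + 1) → L)) := by
      ext u
      constructor
      · rintro ⟨f, hf, rfl⟩
        obtain ⟨S, rfl, hS⟩ := exists_quadPoly_eq hf
        exact ⟨S, (hmemA S).mpr hS, rfl⟩
      · rintro ⟨S, hS, rfl⟩
        exact ⟨quadPoly S, mem_quadricsThrough.mpr ((hmemA S).mp hS), rfl⟩
    rw [Set.image_union, Submodule.span_union, h1, Submodule.span_eq, Set.image_singleton]
    congr 3
    exact polyGradient_X_sub_C a j 1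
  -- Euler's relation: the gradient of a quadric through the point pairs to zero with `a`, whereas
  -- the gradient of x_j - 1 pairs to one.
  have hinf : A.map D ⊓ Submodule.span L {Pi.single j 1} = ⊥ := by
    rw [eq_bot_iff]
    rintro u ⟨⟨S, hS, rfl⟩, h2⟩
    obtain ⟨b, hb⟩ := Submodule.mem_span_singleton.mp h2
    have h3 : ∑ k, D S k * a k = 0 := by
      change ∑ k, polyGradient a (quadPoly S) k * a k = 0
      have h4 : a = ∑ k, a k • Pi.single k 1 := by
        rw [← Finset.univ_sum_single a]
        refine Finset.sum_congr rfl fun k _ => ?_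
        rw [← Pi.single_smul, smul_eq_mul, mul_one, Finset.univ_sum_single]
      have h5 : polar S a a = 0 := by
        rw [hav, polar_smul_left, polar_smul_right, (hmemA S).mp hS]; simp
      have h6 : polar S a a = ∑ k, a k * polar S (Pi.single k 1) a := by
        conv_lhs => rw [polar_comm]; arg 3; rw [h4]
        rw [polar_sum_right]
        exact Finset.sum_congr rfl fun k _ => by rw [polar_smul_right, polar_comm]
      calc _ = 2 * ∑ k, a k * polar S (Pi.single k 1) a := by
            rw [Finset.mul_sum]
            refine Finset.sum_congr rfl fun k _ => ?_
            rw [polyGradient_quadPoly]; ring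
        _ = 0 := by rw [← h6, h5, mul_zero]
    rw [← hb] at h3 ⊢
    rw [Finset.sum_eq_single j (fun k _ hk => by simp [hk]) (by simp)] at h3
    have hb0 : b = 0 := by simpa [haj] using h3
    rw [hb0, zero_smul]
    exact Submodule.zero_mem _
  have h1 := Submodule.finrank_sup_add_finrank_inf_eq (A.map D)
    (Submodule.span L {(Pi.single j 1 : Fin (n + 1) → L)})
  rw [hinf, finrank_bot, finrank_span_singleton (by simp)] at h1
  have h2 := finrank_cotangent_add a hG
  rw [add_zero] at h1
  rw [hspan, h1, Fintype.card_fin] at h2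
  have h3 := LinearMap.finrank_range_add_finrank_ker (D.domRestrict A)
  rw [LinearMap.range_domRestrict] at h3
  have h4 : Module.finrank L (LinearMap.ker (D.domRestrict A)) = coneRank (coordVec Γ) 1 := by
    have := hv.finrank_quadrics {i}
    rw [Finset.card_singleton] at this
    rw [← this, LinearMap.ker_domRestrict]
    have h5 : quadrics (coordVec Γ) {i} ∅ ∅ = (Submodule.comap A.subtype (LinearMap.ker D)).map
        A.subtype := by
      ext S
      rw [Submodule.map_comap_subtype, Submodule.mem_inf, hmemA, LinearMap.mem_ker, hD,
        mem_quadrics_empty]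
      simp
    rw [h5]
    exact (Submodule.equivMapOfInjective A.subtype A.injective_subtype _).finrank_eq
  have h5 : Module.finrank L A = coneRank (coordVec Γ) 0 := by
    rw [hA, hv.finrank_quadrics ∅, Finset.card_empty]
  rw [h4, h5] at h3
  rw [Subspace.dual_finrank_eq]
  change Module.finrank L ((RingHom.ker (eval a)).map (Ideal.Quotient.mk (Ideal.span
    ((quadricsThrough (coordVec Γ) : Set (MvPolynomial (Fin (n + 1)) L)) ∪
      {X j - 1})))).Cotangent + _ = _
  omega

theorem weakConjecture_iff (hv : SymmetricFrame (coordVec Γ)) (hn : 1 ≤ n) :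
    WeakConjecture Γ ↔ coneRank (coordVec Γ) 0 - coneRank (coordVec Γ) 1 = n - 1 := by
  have hanti : coneRank (coordVec Γ) 1 ≤ coneRank (coordVec Γ) 0 :=
    SymmetricFrame.coneRank_anti zero_le_one
  constructor
  · intro h
    let i : Fin d := ⟨0, lt_of_lt_of_le (Nat.succ_pos n) hv.lt⟩
    obtain ⟨j, hj⟩ := Function.ne_iff.mp (Γ i).rep_nonzero
    have h1 := finrank_baseLocusTangentSpace_add hv i j hj
    rw [h i j hj] at h1
    omega
  · intro h i j hj
    have h1 := finrank_baseLocusTangentSpace_add hv i j hj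
    omega

end WeakConjecture

/-! ### Projection from vertices and restriction to spans -/

theorem finrank_diagonal_zero (L : Type*) [Field L] (m : ℕ) :
    Module.finrank L (apolar (fun s : Fin m => (Pi.single s 1 : Fin m → L)) {p | p.1 = p.2}) =
      m.choose 2 := by
  classical
  let f : (Sym2 (Fin m) → L) →ₗ[L] ({z : Sym2 (Fin m) // z.IsDiag} → L) :=
    LinearMap.funLeft L L Subtype.val
  have hf : apolar (fun s : Fin m => (Pi.single s 1 : Fin m → L)) {p | p.1 = p.2} =
      LinearMap.ker f := by
    ext T
    rw [LinearMap.mem_ker, mem_apolar]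
    constructor
    · intro h
      ext ⟨z, hz⟩
      induction z with
      | _ s s' =>
        obtain rfl : s = s' := hz
        have := h s s rfl
        rw [polar_single_single, mul_one, mul_one] at this
        exact this
    · rintro h s s' (rfl : s = s')
      have := congrFun h ⟨s(s, s), rfl⟩
      rw [polar_single_single, mul_one, mul_one]
      exact this
  have h1 := LinearMap.finrank_range_add_finrank_ker f
  rw [LinearMap.range_eq_top.mpr (LinearMap.funLeft_surjective_of_injective L L _
    Subtype.val_injective), finrank_top, Module.finrank_fintype_fun_eq_card,
    Module.finrank_fintype_fun_eq_card, Sym2.card, Sym2.card_subtype_diag, Fintype.card_fin,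
    choose_succ_two] at h1
  rw [hf]
  omega

section Coordinates

variable (L : Type*) [Field L] {n k : ℕ} (hk : k ≤ n)

/-- The projection to the last `k + 1` coordinates. -/
def projCoords : (Fin (n + 1) → L) →ₗ[L] (Fin (k + 1) → L) :=
  LinearMap.funLeft L L fun s => ⟨(s : ℕ) + (n - k), by omega⟩

/-- The inclusion of the subspace of the last `k + 1` coordinates. -/
def inclCoords : (Fin (k + 1) → L) →ₗ[L] (Fin (n + 1) → L) where
  toFun t i := if n ≤ (i : ℕ) + k then t ⟨(i : ℕ) - (n - k), by omega⟩ else 0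
  map_add' t u := by
    ext i; by_cases h : n ≤ (i : ℕ) + k <;> simp [h]
  map_smul' c t := by
    ext i; by_cases h : n ≤ (i : ℕ) + k <;> simp [h]

variable {L}

theorem projCoords_inclCoords (t : Fin (k + 1) → L) :
    projCoords L hk (inclCoords L hk t) = t := by
  ext s
  have h : n ≤ (s : ℕ) + (n - k) + k := by omega
  simp [projCoords, inclCoords, LinearMap.funLeft_apply, h]

theorem inclCoords_projCoords_apply (u : Fin (n + 1) → L) {i : Fin (n + 1)} (hi : n - k ≤ i) :
    inclCoords L hk (projCoords L hk u) i = u i := by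
  have h : n ≤ (i : ℕ) + k := by omega
  simp [projCoords, inclCoords, LinearMap.funLeft_apply, h, hi]

theorem polar_congr_left {κ : Type*} [Fintype κ] {S : Sym2 κ → L} {u u' : κ → L}
    (h : ∀ i, u i = u' i ∨ ∀ j, S s(i, j) = 0) (w : κ → L) : polar S u w = polar S u' w := by
  refine Finset.sum_congr rfl fun i _ => Finset.sum_congr rfl fun j _ => ?_
  rcases h i with h | h
  · rw [h]
  · rw [h j, zero_mul, zero_mul]

theorem pullQuadric_projCoords_injective :
    Function.Injective (pullQuadric (projCoords L hk)) := by
  intro S T h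
  refine quadric_ext fun u w => ?_
  have := congrArg (fun S => polar S (inclCoords L hk u) (inclCoords L hk w)) h
  simpa [polar_pullQuadric, projCoords_inclCoords] using this

theorem exists_pullQuadric_projCoords_eq {S : Sym2 (Fin (n + 1)) → L}
    (hS : ∀ i : Fin (n + 1), (i : ℕ) < n - k → ∀ j, S s(i, j) = 0) :
    ∃ S', pullQuadric (projCoords L hk) S' = S := by
  refine ⟨pullQuadric (inclCoords L hk) S, quadric_ext fun u w => ?_⟩
  have h : ∀ u w, polar S (inclCoords L hk (projCoords L hk u)) w = polar S u w := fun u w =>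
    polar_congr_left (fun i : Fin (n + 1) => (le_or_gt (n - k) (i : ℕ)).imp
      (fun hi => inclCoords_projCoords_apply hk u hi) fun hi => hS i hi) w
  rw [polar_pullQuadric, polar_pullQuadric, h, polar_comm, h, polar_comm]

end Coordinates

/-- Enlarge A to n + 1 points; by general position, evaluation at them is an isomorphism on linear
forms. -/
theorem SymmetricFrame.exists_dual {L : Type*} [Field L] {n d : ℕ} {v : Fin d → Fin (n + 1) → L}
    (hv : SymmetricFrame v) {A : Finset (Fin d)} (hA : A.card ≤ n + 1) {i : Fin d} (hi : i ∈ A) :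
    ∃ f : Fin (n + 1) → L, ∑ k, f k * v i k = 1 ∧ ∀ j ∈ A, j ≠ i → ∑ k, f k * v j k = 0 := by
  classical
  obtain ⟨A', hAA', hA'⟩ := Finset.exists_superset_card_eq hA (by simpa using hv.lt)
  let φ : (Fin (n + 1) → L) →ₗ[L] (A' → L) :=
    LinearMap.pi fun j => dotProductBilin L L |>.flip (v j)
  have hφ : ∀ f j, φ f j = ∑ k, f k * v j k := fun f j => by simp [φ, dotProduct]
  have hinj : Function.Injective φ := by
    rw [injective_iff_map_eq_zero]
    intro f hf
    refine hv.linearIndependent_of_card hA' fun j hj => ?_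
    rw [← hφ f ⟨j, hj⟩, hf]
    rfl
  have hsurj : Function.Surjective φ := by
    refine (LinearMap.injective_iff_surjective_of_finrank_eq_finrank ?_).mp hinj
    simp [hA']
  obtain ⟨f, hf⟩ := hsurj (Pi.single ⟨i, hAA' hi⟩ 1)
  refine ⟨f, ?_, fun j hj hji => ?_⟩
  · rw [← hφ f ⟨i, hAA' hi⟩, hf, Pi.single_eq_same]
  · rw [← hφ f ⟨j, hAA' hj⟩, hf, Pi.single_eq_of_ne]
    exact fun h => hji (congrArg Subtype.val h)

section Restriction

variable {L : Type*} [Field L] {N e m : ℕ} (q : Fin e → Fin N → L) (a : Fin m → Fin e)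

/-- The parametrization of the span of the `q_{a_s}`. -/
def spanMap : (Fin m → L) →ₗ[L] (Fin N → L) where
  toFun := spanPoint q a
  map_add' t u := by ext k; simp [spanPoint, add_mul, Finset.sum_add_distrib]
  map_smul' c t := by ext k; simp [spanPoint, Finset.mul_sum, mul_assoc]

theorem spanMap_single (s : Fin m) : spanMap q a (Pi.single s 1) = q (a s) := by
  ext k
  simp [spanMap, spanPoint, Pi.single_apply]

theorem restrictToSpan_quadPoly [CharZero L] (S : Sym2 (Fin N) → L) :
    restrictToSpan q a (quadPoly S) = quadPoly (pullQuadric (spanMap q a) S) := by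
  refine MvPolynomial.funext fun t => ?_
  rw [← aeval_eq_eval, eval_restrictToSpan, aeval_quadPoly, aeval_quadPoly, polar_pullQuadric]
  rfl

theorem pullQuadric_spanMap_eq_zero {S : Sym2 (Fin N) → L} :
    pullQuadric (spanMap q a) S = 0 ↔ ∀ s s', polar S (q (a s)) (q (a s')) = 0 := by
  constructor
  · intro h s s'
    rw [← spanMap_single q a, ← spanMap_single q a, ← polar_pullQuadric, h, zero_polar]
  · intro h
    ext z
    induction z with
    | _ s s' =>
      have := polar_single_single (pullQuadric (spanMap q a) S) 1 s s' 1
      rw [polar_pullQuadric, spanMap_single, spanMap_single, h, mul_one, mul_one] at this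
      exact this.symm

end Restriction

section ProjectedPoints

variable {L : Type*} [Field L] {n d k : ℕ} {Γ : Fin d → ℙ L (Fin (n + 1) → L)}

/-- The index in `Γ` of a projected point. -/
def liftIndex (d n k : ℕ) : Fin (d - (n - k)) ↪ Fin d where
  toFun i := ⟨(i : ℕ) + (n - k), by omega⟩
  inj' i j h := by
    have := congrArg Fin.val h
    exact Fin.ext (by simpa using this)

theorem projCoords_coordVec (hk : k ≤ n) (i : Fin (d - (n - k))) :
    projCoords L hk (coordVec Γ (liftIndex d n k i)) = projectedPoints Γ k hk i := rfl

theorem liftIndex_notMem_firstIndices (i : Fin (d - (n - k))) :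
    liftIndex d n k i ∉ firstIndices d (n - k) := by
  rw [mem_firstIndices, not_lt]
  exact Nat.le_add_left _ _

theorem exists_liftIndex_eq {i : Fin d} (hi : i ∉ firstIndices d (n - k)) :
    ∃ j, liftIndex d n k j = i := by
  rw [mem_firstIndices, not_lt] at hi
  exact ⟨⟨(i : ℕ) - (n - k), by omega⟩, Fin.ext (Nat.sub_add_cancel hi)⟩

theorem SymmetricFrame.projCoords_eq_zero (hv : SymmetricFrame (coordVec Γ)) (hk : k ≤ n)
    {i : Fin d} (hi : i ∈ firstIndices d (n - k)) : projCoords L hk (coordVec Γ i) = 0 := by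
  rw [mem_firstIndices] at hi
  obtain ⟨c, -, hc⟩ := hv.vert ⟨i, by omega⟩
  ext s
  change coordVec Γ (Fin.castLE hv.lt ⟨i, by omega⟩) _ = 0
  rw [hc, Pi.single_eq_of_ne]
  intro h
  have := congrArg Fin.val h
  simp at this
  omega

/-- Quadrics through the projected points that contain the span of some of them correspond to
quadrics with vertex in the centre of projection. -/
theorem SymmetricFrame.map_pullQuadric_projCoords (hv : SymmetricFrame (coordVec Γ)) (hk : k ≤ n)
    (B : Finset (Fin (d - (n - k)))) :
    (apolar (projectedPoints Γ k hk) {p | p.1 = p.2 ∨ p.1 ∈ B ∧ p.2 ∈ B}).map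
      (pullQuadric (projCoords L hk)) =
    quadrics (coordVec Γ) (firstIndices d (n - k)) (B.map (liftIndex d n k))
      (B.map (liftIndex d n k)) := by
  ext S
  constructor
  · rintro ⟨S', hS', rfl⟩
    rw [SetLike.mem_coe, mem_apolar] at hS'
    rw [mem_quadrics]
    simp only [polar_pullQuadric]
    refine ⟨fun i => ?_, fun i hi j => ?_, fun i hi j hj => ?_⟩
    · by_cases hi : i ∈ firstIndices d (n - k)
      · rw [hv.projCoords_eq_zero hk hi, polar_zero_right]
      · obtain ⟨i, rfl⟩ := exists_liftIndex_eq hi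
        exact hS' i i (Or.inl rfl)
    · rw [hv.projCoords_eq_zero hk hi, polar_comm, polar_zero_right]
    · obtain ⟨i, hi', rfl⟩ := Finset.mem_map.mp hi
      obtain ⟨j, hj', rfl⟩ := Finset.mem_map.mp hj
      exact hS' i j (Or.inr ⟨hi', hj'⟩)
  · intro hS
    rw [mem_quadrics] at hS
    obtain ⟨S', rfl⟩ := exists_pullQuadric_projCoords_eq hk (S := S) fun i hi =>
      (hv.polar_vert_left S i).mp (hS.2.1 _ (by simpa using hi))
    simp only [polar_pullQuadric] at hS
    refine ⟨S', ?_, rfl⟩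
    rintro i j (h | ⟨hi, hj⟩)
    · obtain rfl : i = j := h
      exact hS.1 (liftIndex d n k i)
    · exact hS.2.2 _ (Finset.mem_map_of_mem _ hi) _ (Finset.mem_map_of_mem _ hj)

/-- The separation of projected points by linear forms. -/
theorem SymmetricFrame.exists_dual_projectedPoints (hv : SymmetricFrame (coordVec Γ)) (hk : k ≤ n)
    {A : Finset (Fin (d - (n - k)))} (hA : A.card ≤ k + 1) {i : Fin (d - (n - k))} (hi : i ∈ A) :
    ∃ f : (Fin (k + 1) → L) →ₗ[L] L, f (projectedPoints Γ k hk i) = 1 ∧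
      ∀ j ∈ A, j ≠ i → f (projectedPoints Γ k hk j) = 0 := by
  classical
  have hlt := hv.lt
  obtain ⟨f, hfi, hf⟩ := hv.exists_dual (A := firstIndices d (n - k) ∪ A.map (liftIndex d n k))
    (by
      refine (Finset.card_union_le _ _).trans ?_
      rw [card_firstIndices (by omega), Finset.card_map]
      omega) (Finset.mem_union_right _ (Finset.mem_map_of_mem _ hi))
  -- The n - k vertices of the centre were added to A, so the dual form vanishes on the centre and
  -- descends to the projection.
  have hf0 : ∀ l : Fin (n + 1), (l : ℕ) < n - k → f l = 0 := by
    intro l hl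
    obtain ⟨c, hc, hl'⟩ := hv.vert l
    have h1 : Fin.castLE hv.lt l ∈ firstIndices d (n - k) := by simpa using hl
    have h2 := hf _ (Finset.mem_union_left _ h1)
      fun h => liftIndex_notMem_firstIndices i (h ▸ h1)
    rw [hl'] at h2
    simpa [Pi.single_apply, hc] using h2
  let φ : (Fin (n + 1) → L) →ₗ[L] L := dotProductBilin L L f
  have key : ∀ u : Fin (n + 1) → L, φ (inclCoords L hk (projCoords L hk u)) =
      ∑ l, f l * u l := by
    intro u
    change ∑ l, f l * inclCoords L hk (projCoords L hk u) l = _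
    refine Finset.sum_congr rfl fun l _ => ?_
    rcases le_or_gt (n - k) (l : ℕ) with hl | hl
    · rw [inclCoords_projCoords_apply hk u hl]
    · rw [hf0 l hl, zero_mul, zero_mul]
  refine ⟨φ ∘ₗ inclCoords L hk, ?_, fun j hj hji => ?_⟩
  · rw [← projCoords_coordVec, LinearMap.comp_apply, key, hfi]
  · rw [← projCoords_coordVec, LinearMap.comp_apply, key]
    exact hf _ (Finset.mem_union_right _ (Finset.mem_map_of_mem _ hj))
      fun h => hji ((liftIndex d n k).injective h)

/-- A permutation fixing the centre carries B to the complement of the centre among the first n - 1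
points. Conjugacy with the points of the centre holds already by singularity. -/
theorem SymmetricFrame.finrank_quadrics_block {m : ℕ} (hv : SymmetricFrame (coordVec Γ))
    (hmn : m + 1 ≤ n)
    {B : Finset (Fin d)} (hB : B.card = m) (hBF : Disjoint (firstIndices d (n - (m + 1))) B) :
    Module.finrank L (quadrics (coordVec Γ) (firstIndices d (n - (m + 1))) B B) =
      Module.finrank L (quadrics (coordVec Γ) (firstIndices d (n - (m + 1)))
        (firstIndices d (n - 1)) (firstIndices d (n - 1))) := by
  classical
  have hlt := hv.lt
  set F := firstIndices d (n - (m + 1)) with hF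
  set E := firstIndices d (n - 1) with hE
  have hFE : F ⊆ E := fun i hi => by
    rw [hF, mem_firstIndices] at hi; rw [hE, mem_firstIndices]; omega
  have hcard : B.card = (E \ F).card := by
    rw [Finset.card_sdiff_of_subset hFE, hE, hF, card_firstIndices (by omega),
      card_firstIndices (by omega), hB]
    omega
  obtain ⟨σ, hσ, hσ'⟩ := exists_perm_fixing hcard
  have hfix : ∀ i, i ∈ F → σ i = i := fun i hi => hσ' i (Finset.disjoint_left.mp hBF hi)
    fun h => (Finset.mem_sdiff.mp h).2 hi
  have hσF : ∀ i, i ∈ F ↔ σ i ∈ F := by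
    refine fun i => ⟨fun hi => by rwa [hfix i hi], fun hi => ?_⟩
    have := hfix _ hi
    rwa [σ.injective this] at hi
  rw [hv.finrank_quadrics_eq σ hσF hσ hσ]
  suffices quadrics (coordVec Γ) F (E \ F) (E \ F) = quadrics (coordVec Γ) F E E by rw [this]
  ext S
  simp only [mem_quadrics]
  refine and_congr_right fun _ => and_congr_right fun hS => ⟨fun h i hi j hj => ?_,
    fun h i hi j hj => h i (Finset.sdiff_subset hi) j (Finset.sdiff_subset hj)⟩
  by_cases hiF : i ∈ F
  · exact hS i hiF j
  by_cases hjF : j ∈ F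
  · rw [polar_comm]; exact hS j hjF i
  exact h i (Finset.mem_sdiff.mpr ⟨hi, hiF⟩) j (Finset.mem_sdiff.mpr ⟨hj, hjF⟩)

variable [CharZero L] {m : ℕ}

/-- By general position the span of the m chosen points contains no other projected point, since m +
1 ≤ k + 1. Only the m square terms in the coordinates of the span are excluded. -/
theorem SymmetricFrame.finrank_spanQuadrics (hv : SymmetricFrame (coordVec Γ)) (hk : k ≤ n)
    (hmk : m ≤ k) (a : Fin m ↪o Fin (d - (n - k))) :
    Module.finrank L (spanQuadrics (projectedPoints Γ k hk) a) = m.choose 2 := by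
  classical
  rw [← finrank_diagonal_zero L m]
  set q := projectedPoints Γ k hk with hq
  suffices spanQuadrics q a = (apolar (fun s : Fin m => (Pi.single s 1 : Fin m → L))
      {p | p.1 = p.2}).map quadPoly by
    rw [this]
    exact (Submodule.equivMapOfInjective quadPoly quadPoly_injective _).finrank_eq.symm
  ext f
  constructor
  · intro hf
    obtain ⟨T, rfl, hT⟩ := exists_quadPoly_eq hf
    refine ⟨T, ?_, rfl⟩
    rintro s s' (rfl : s = s')
    exact hT ⟨Pi.single s 1, a s, 1, one_ne_zero, by
      rw [one_smul]; exact spanMap_single q a s⟩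
  · rintro ⟨T, hT, rfl⟩
    refine mem_quadricsThrough.mpr ?_
    rintro ⟨t, i, c, hc, h⟩
    have h' : ∀ g : (Fin (k + 1) → L) →ₗ[L] L, ∑ s, t s * g (q (a s)) = c * g (q i) := by
      intro g
      have h1 : spanPoint q a t = ∑ s, t s • q (a s) := by
        ext l; simp [spanPoint]
      have := congrArg g h
      rwa [h1, map_sum, map_smul, smul_eq_mul,
        Finset.sum_congr rfl fun s _ => by rw [map_smul, smul_eq_mul]] at this
    set A : Finset (Fin (d - (n - k))) := insert i (Finset.univ.map a.toEmbedding) with hA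
    have hAc : A.card ≤ k + 1 := by
      refine (Finset.card_insert_le _ _).trans ?_
      rw [Finset.card_map, Finset.card_univ, Fintype.card_fin]
      omega
    have haA : ∀ s, a s ∈ A := fun s => Finset.mem_insert_of_mem
      (Finset.mem_map_of_mem a.toEmbedding (Finset.mem_univ s))
    obtain ⟨s₁, rfl⟩ : ∃ s, a s = i := by
      by_contra! hi
      obtain ⟨g, hgi, hg⟩ := hv.exists_dual_projectedPoints hk hAc (Finset.mem_insert_self i _)
      have h1 := h' g
      rw [hgi, Finset.sum_eq_zero fun s _ => by rw [hg _ (haA s) (hi s), mul_zero], mul_one] at h1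
      exact hc h1.symm
    have ht : ∀ s, s ≠ s₁ → t s = 0 := by
      intro s hs
      obtain ⟨g, hgi, hg⟩ := hv.exists_dual_projectedPoints hk hAc (haA s)
      have h1 := h' g
      rw [hg _ (haA s₁) fun h => hs (a.injective h).symm, mul_zero,
        Finset.sum_eq_single s (fun s' _ hs' => by
          rw [hg _ (haA s') fun h => hs' (a.injective h), mul_zero]) (by simp), hgi, mul_one] at h1
      exact h1
    have ht' : t = t s₁ • Pi.single s₁ 1 := by
      ext s
      by_cases hs : s = s₁
      · subst hs; simp
      · simp [hs, ht s hs]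
    change polar T t t = 0
    rw [ht', polar_smul_left, polar_smul_right, hT s₁ s₁ rfl, mul_zero, mul_zero]

theorem SymmetricFrame.finrank_quadricsThrough_projectedPoints (hv : SymmetricFrame (coordVec Γ))
    (hk : k ≤ n) :
    Module.finrank L (quadricsThrough (projectedPoints Γ k hk)) = coneRank (coordVec Γ) (n - k) := by
  have h1 := hv.map_pullQuadric_projCoords hk ∅
  rw [Finset.map_empty] at h1
  rw [coneRank, ← h1, ← (Submodule.equivMapOfInjective _
    (pullQuadric_projCoords_injective hk) _).finrank_eq,
    (Submodule.equivMapOfInjective quadPoly quadPoly_injective _).finrank_eq]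
  suffices quadricsThrough (projectedPoints Γ k hk) = Submodule.map quadPoly _ by rw [this]
  ext f
  constructor
  · intro hf
    obtain ⟨S, rfl, hS⟩ := exists_quadPoly_eq hf
    refine ⟨S, ?_, rfl⟩
    rintro i j (h | h)
    · obtain rfl : i = j := h
      exact hS i
    · simp at h
  · rintro ⟨S, hS, rfl⟩
    exact mem_quadricsThrough.mpr fun i => hS i i (Or.inl rfl)

/-- The kernel consists of the quadrics containing the span; pulled back to ℙⁿ they become cones
over the centre of projection. -/
theorem SymmetricFrame.finrank_ker_rho (hv : SymmetricFrame (coordVec Γ)) (hk : k ≤ n)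
    (a : Fin m ↪o Fin (d - (n - k))) :
    Module.finrank L (LinearMap.ker (rho (projectedPoints Γ k hk) a)) =
      Module.finrank L (quadrics (coordVec Γ) (firstIndices d (n - k))
        ((Finset.univ.map a.toEmbedding).map (liftIndex d n k))
        ((Finset.univ.map a.toEmbedding).map (liftIndex d n k))) := by
  rw [← hv.map_pullQuadric_projCoords hk, ← (Submodule.equivMapOfInjective _
    (pullQuadric_projCoords_injective hk) _).finrank_eq,
    (Submodule.equivMapOfInjective quadPoly quadPoly_injective _).finrank_eq,
    (Submodule.equivMapOfInjective _ (Submodule.injective_subtype _) _).finrank_eq]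
  suffices (LinearMap.ker (rho (projectedPoints Γ k hk) a)).map (Submodule.subtype _) =
    Submodule.map quadPoly _ by rw [this]
  have hker : ∀ S : Sym2 (Fin (k + 1)) → L, ∀ hS : quadPoly S ∈ quadricsThrough _,
      (⟨quadPoly S, hS⟩ : quadricsThrough _) ∈ LinearMap.ker (rho (projectedPoints Γ k hk) a) ↔
      ∀ s s', polar S (projectedPoints Γ k hk (a s)) (projectedPoints Γ k hk (a s')) = 0 := by
    intro S hS
    rw [LinearMap.mem_ker, ← Subtype.coe_inj, ← pullQuadric_spanMap_eq_zero,
      ← quadPoly_injective.eq_iff, map_zero, ← restrictToSpan_quadPoly]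
    rfl
  ext f
  constructor
  · rintro ⟨⟨f, hf⟩, hf', rfl⟩
    obtain ⟨S, rfl, hS⟩ := exists_quadPoly_eq hf
    refine ⟨S, ?_, rfl⟩
    rintro i j (h | ⟨hi, hj⟩)
    · obtain rfl : i = j := h
      exact hS i
    · obtain ⟨s, -, rfl⟩ := Finset.mem_map.mp hi
      obtain ⟨s', -, rfl⟩ := Finset.mem_map.mp hj
      exact (hker S hf).mp hf' s s'
  · rintro ⟨S, hS, rfl⟩
    have hS' : quadPoly S ∈ quadricsThrough (projectedPoints Γ k hk) :=
      mem_quadricsThrough.mpr fun i => hS i i (Or.inl rfl)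
    refine ⟨⟨quadPoly S, hS'⟩, (hker S hS').mpr fun s s' => hS _ _ (Or.inr ⟨?_, ?_⟩), rfl⟩ <;>
    exact Finset.mem_map_of_mem a.toEmbedding (Finset.mem_univ _)

/-- The rank of the restriction map does not depend on the span, and it is not injective. -/
theorem SymmetricFrame.exists_finrank_ker_rho (hv : SymmetricFrame (coordVec Γ)) (hm : 1 ≤ m)
    (hmn : m + 2 ≤ n) (hd : 2 * n + 2 * m + 1 ≤ d)
    (hw : (n + 2).choose 2 ≤ coneRank (coordVec Γ) 0 + (2 * n + m)) :
    ∃ c ≠ 0, ∀ a : Fin m ↪o Fin (d - (n - (m + 1))), Module.finrank L (LinearMap.ker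
      (rho (projectedPoints Γ (m + 1) (by omega)) a)) = c := by
  refine ⟨_, hv.exists_quadric_singular_along hm hmn hd hw, fun a => ?_⟩
  rw [hv.finrank_ker_rho, hv.finrank_quadrics_block (by omega) (by simp)]
  · rw [Nat.sub_sub]
  · refine Finset.disjoint_left.mpr fun i hi hi' => ?_
    obtain ⟨j, -, rfl⟩ := Finset.mem_map.mp hi'
    exact liftIndex_notMem_firstIndices j hi

theorem SymmetricFrame.surjective_rho_iff (hv : SymmetricFrame (coordVec Γ)) (hk : k ≤ n)
    (hmk : m ≤ k) (a : Fin m ↪o Fin (d - (n - k))) :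
    Function.Surjective (rho (projectedPoints Γ k hk) a) ↔ coneRank (coordVec Γ) (n - k) =
      m.choose 2 + Module.finrank L (LinearMap.ker (rho (projectedPoints Γ k hk) a)) := by
  have hfin : FiniteDimensional L (homogeneousSubmodule (Fin m) L 2) := by
    rw [← range_quadPoly]; infer_instance
  have hfin' : FiniteDimensional L (homogeneousSubmodule (Fin (k + 1)) L 2) := by
    rw [← range_quadPoly]; infer_instance
  have : FiniteDimensional L (spanQuadrics (projectedPoints Γ k hk) a) :=
    Submodule.finiteDimensional_of_le inf_le_left
  have : FiniteDimensional L (quadricsThrough (projectedPoints Γ k hk)) :=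
    Submodule.finiteDimensional_of_le inf_le_left
  have h1 := LinearMap.finrank_range_add_finrank_ker (rho (projectedPoints Γ k hk) a)
  rw [hv.finrank_quadricsThrough_projectedPoints] at h1
  have h2 := hv.finrank_spanQuadrics hk hmk a
  constructor
  · intro h
    rw [LinearMap.range_eq_top.mpr h, finrank_top, h2] at h1
    exact h1.symm
  · intro h
    refine LinearMap.range_eq_top.mp (Submodule.eq_top_of_finrank_eq ?_)
    omega

end ProjectedPoints

/-! ### The main theorem -/

theorem symmetricFrame_coordVec {L : Type*} [Field L] {n d : ℕ} (hlt : n < d)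
    {Γ : Fin d → ℙ L (Fin (n + 1) → L)} {g : (Fin (n + 1) → L) ≃ₗ[L] (Fin (n + 1) → L)}
    (hsym : InSymmetricPosition fun i => changeCoords g (Γ i))
    (hvert : ∀ i : Fin (n + 1), Γ (Fin.castLE hlt i) = vertex L i) :
    SymmetricFrame (coordVec Γ) where
  lt := hlt
  perm := finrank_apolar_comp_perm hsym
  vert i := by
    have h := hvert i
    rw [← (Γ (Fin.castLE hlt i)).mk_rep, vertex, Projectivization.mk_eq_mk_iff'] at h
    obtain ⟨c, hc⟩ := h
    refine ⟨c, ?_, ?_⟩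
    · rintro rfl
      rw [zero_smul] at hc
      exact (Γ (Fin.castLE hlt i)).rep_nonzero hc.symm
    · rw [coordVec, ← hc, ← Pi.single_smul, smul_eq_mul, mul_one]

end

theorem mainTheorem9 {L : Type*} [Field L] [CharZero L] {n m d : ℕ}
    (hm : 1 ≤ m) (hmn : m + 2 ≤ n) (hd : 2 * n + 2 * m + 1 ≤ d)
    (Γ : Fin d → ℙ L (Fin (n + 1) → L))
    (g : (Fin (n + 1) → L) ≃ₗ[L] (Fin (n + 1) → L))
    (hsym : InSymmetricPosition fun i => changeCoords g (Γ i))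
    (hvert : ∀ i : Fin (n + 1), Γ (Fin.castLE (by omega) i) = vertex L i)
    (hhilb : hilbertFunction Γ 2 = 2 * n + m) :
    List.TFAE
      [WeakConjecture Γ,
       (X 0 * X (Fin.last n) : MvPolynomial (Fin (n + 1)) L) ∉ initialIdeal (homogeneousIdeal Γ),
       ∀ i : Fin (n + 1),
        (X i * X (Fin.last n) : MvPolynomial (Fin (n + 1)) L) ∉ initialIdeal (homogeneousIdeal Γ),
       Module.finrank L (initialQuadricsFrom (homogeneousIdeal Γ) (n - m)) = (m - 1).choose 2,
       Module.finrank L (initialQuadricsFrom (homogeneousIdeal Γ) (n - m - 1)) =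
        m.choose 2 + 1] ∧
    ((∃ a : Fin m ↪o Fin (d - (n - (m + 1))),
        RhoHasMaximalRank (projectedPoints Γ (m + 1) (by omega)) a) →
      (∀ a : Fin m ↪o Fin (d - (n - (m + 1))),
        RhoHasMaximalRank (projectedPoints Γ (m + 1) (by omega)) a) ∧
      WeakConjecture Γ) := by
  have hv : SymmetricFrame (coordVec Γ) := symmetricFrame_coordVec (by omega) hsym hvert
  have hw : coneRank (coordVec Γ) 0 + (2 * n + m) = (n + 2).choose 2 := by
    rw [← hhilb]; exact hilbertFunction_two_add_coneRank Γ
  have hwc := weakConjecture_iff hv (by omega)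
  have hge := hv.le_coneRank_drop_zero hmn hw
  refine ⟨?_, ?_⟩
  · tfae_have 1 → 3 := by
      intro h i
      exact X_mul_X_last_notMem hv fun hi => hv.coneRank_drop_lt (hwc.mp h) hi
    tfae_have 3 → 2 := fun h => h 0
    tfae_have 2 → 1 := by
      intro h
      refine hwc.mpr ?_
      by_contra hne
      -- The first drop is always at least n - 1, so if it differs from n - 1 it is at least n.
      exact h (X_zero_mul_X_last_mem hv (by omega) (by omega))
    tfae_have 1 ↔ 4 := by
      rw [hwc, finrank_initialQuadricsFrom hv (by omega)]
      refine ⟨fun h => (hv.coneRank_of_drop_eq hm hmn hd hw h).2, fun h => ?_⟩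
      by_contra hne
      have := (hv.coneRank_of_drop_ne hm hmn hd hw hne).2
      omega
    tfae_have 1 ↔ 5 := by
      rw [hwc, finrank_initialQuadricsFrom hv (by omega)]
      refine ⟨fun h => (hv.coneRank_of_drop_eq hm hmn hd hw h).1, fun h => ?_⟩
      by_contra hne
      have := (hv.coneRank_of_drop_ne hm hmn hd hw hne).1
      omega
    tfae_finish
  · rintro ⟨a, ha⟩
    obtain ⟨c, hc0, hc⟩ := hv.exists_finrank_ker_rho hm hmn hd hw.ge
    have hsurj := hv.surjective_rho_iff (m := m) (k := m + 1) (by omega) (by omega)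
    -- The kernel is nonzero for every span, so maximal rank can only mean surjectivity.
    have ha' : Function.Surjective (rho (projectedPoints Γ (m + 1) (by omega)) a) := by
      refine ha.resolve_left fun hinj => hc0 ?_
      rw [← hc a, LinearMap.ker_eq_bot.mpr hinj, finrank_bot]
    rw [hsurj, hc] at ha'
    refine ⟨fun b => Or.inr ((hsurj b).mpr (by rw [hc, ha'])), hwc.mpr ?_⟩
    -- Surjectivity gives w_{n-m-1} = C(m,2) + c with c > 0, more than is possible when r_0 ≠ n - 1.
    by_contra hne
    have := (hv.coneRank_of_drop_ne hm hmn hd hw hne).1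
    rw [← Nat.sub_sub] at ha'
    omega
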